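/- For $\mathbf s=(s_1,\dots,s_6)\in\mathbb C^6$ let $$\zeta_3(\mathbf s,\lambda_2^\vee;SU(4))=\sum_{l,m,n=1}^\infty\frac{(-1)^{l+n}}{l^{s_1}m^{s_2}n^{s_3}(l+m)^{s_4}(m+n)^{s_5}(l+m+n)^{s_6}},$$ and for positive integers $P,Q$ and $x,y\in\{1,-1\}$ let $$\mathfrak T(P,s,Q;x,y)=\sum_{\substack{l\in\mathbb Z\setminus\{0\},\ m\ge1\\ l+m\ne0}}\frac{x^ly^m}{l^Pm^s(l+m)^Q}.$$ Let $\phi(s)=\sum_{n\ge1}(-1)^nn^{-s}=(2^{1-s}-1)\zeta(s)$, continued to an entire function ($\phi(1)=-\log 2$), and let $[x]$ denote the integer part of $x$. Let $p,q,a,b,c$ be positive integers. If one of the six arguments of $\zeta_3$ is a complex variable $s$ and the others are the fixed positive integers displayed below, the series converges absolutely for $\operatorname{Re}s>1$ and has a meromorphic continuation to $s\in\mathbb C$; the same holds for $s\mapsto\mathfrak T(P,s,Q;x,y)$. All functions below denote these continuations. Writing $\zeta_3(\cdot)$ for $\zeta_3(\cdot,\lambda_2^\vee;SU(4))$, we have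 $$\begin{aligned} &\zeta_3(p,q,s,a,b,c)+(-1)^p\zeta_3(p,a,s,q,c,b)\\ &+(-1)^{p+a}\zeta_3(q,a,c,p,s,b)+(-1)^{p+a+c}\zeta_3(q,s,c,b,a,p)\\ &+(-1)^{q}\zeta_3(a,q,b,p,s,c)+(-1)^{q+b}\zeta_3(a,s,b,c,q,p)\\ &+(-1)^{q+a}\zeta_3(a,p,b,q,c,s)+(-1)^{q+a+b}\zeta_3(a,c,b,s,p,q)\\ &+(-1)^{q+a+b+c}\zeta_3(s,c,p,a,b,q)+(-1)^{p+q+a}\zeta_3(q,p,c,a,b,s)\\ &+(-1)^{p+q+a+c}\zeta_3(q,b,c,s,p,a)+(-1)^{p+q+a+b+c}\zeta_3(s,b,p,q,c,a)\\ &=2(-1)^p\sum_{j=0}^{[p/2]}\phi(2j)\sum_{\omega=0}^{p-2j}\binom{\omega+a-1}{\omega}\binom{p+c-2j-\omega-1}{c-1}\mathfrak T(q+a+\omega,s,p+b+c-2j-\omega;1,-1)\\ &\quad+2(-1)^{p+a}\sum_{j=0}^{[c/2]}\phi(2j)\sum_{\omega=0}^{c-2j}\binom{\omega+a-1}{\omega}\binom{p+c-2j-\omega-1}{p-1}\mathfrak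 T(q,s+a+\omega,p+b+c-2j-\omega;-1,1)\\ &\quad+2(-1)^p\sum_{j=0}^{[a/2]}\phi(2j)\sum_{\omega=0}^{p-1}\binom{\omega+a-2j}{\omega}\binom{p+c-2-\omega}{c-1}\mathfrak T(q+a-2j+\omega+1,s,p+b+c-1-\omega;-1,-1)\\ &\quad+2(-1)^{p+a}\sum_{j=0}^{[a/2]}\phi(2j)\sum_{\omega=0}^{c-1}\binom{\omega+a-2j}{\omega}\binom{p+c-2-\omega}{p-1}\mathfrak T(q,s+a-2j+\omega+1,p+b+c-1-\omega;-1,-1) \end{aligned}$$ for every $s\in\mathbb C$ which is not a singularity of any of the functions on the two sides. Moreover, the right-hand side can be written in terms of the Riemann zeta-function: for all positive integers $P,Q$ and all $s\in\mathbb C$ at which no value $\zeta(1)$ occurs on the right, $$\begin{aligned} \mathfrak T(P,s,Q;1,-1)&=2(-1)^P\Big\{\sum_{k=0}^{[P/2]}\zeta(2k)\tbinom{P+Q-1-2k}{Q-1}\phi(s+P+Q-2k)+\sum_{k=0}^{[Q/2]}\zeta(2k)\tbinom{P+Q-1-2k}{P-1}\phi(s+P+Q-2k)\Big\},\\ \mathfrak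 T(P,s,Q;-1,1)&=2(-1)^P\Big\{\sum_{k=0}^{[P/2]}\phi(2k)\tbinom{P+Q-1-2k}{Q-1}\zeta(s+P+Q-2k)+\sum_{k=0}^{[Q/2]}\phi(2k)\tbinom{P+Q-1-2k}{P-1}\phi(s+P+Q-2k)\Big\},\\ \mathfrak T(P,s,Q;-1,-1)&=2(-1)^P\Big\{\sum_{k=0}^{[P/2]}\phi(2k)\tbinom{P+Q-1-2k}{Q-1}\phi(s+P+Q-2k)+\sum_{k=0}^{[Q/2]}\phi(2k)\tbinom{P+Q-1-2k}{P-1}\zeta(s+P+Q-2k)\Big\}. \end{aligned}$$ (In the first formula only the entire function $\phi$ depends on $s$, so it holds for all $s$.) -/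

import Mathlib

noncomputable section

namespace SU4Zeta

/-- The term of index `(l, m, n)` of the series for `ζ₃(𝐬, λ₂^∨; SU(4))`:
`(-1)^(l+n) / (l^s₁ m^s₂ n^s₃ (l+m)^s₄ (m+n)^s₅ (l+m+n)^s₆)`.
The sign is the character `exp (2πi ⟨λ₂^∨, l λ₁ + m λ₂ + n λ₃⟩) = exp (2πi (l/2 + m + n/2))`. -/
def zetaTerm (s : Fin 6 → ℂ) (x : ℕ+ × ℕ+ × ℕ+) : ℂ :=
  let l : ℕ := x.1
  let m : ℕ := x.2.1
  let n : ℕ := x.2.2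
  (-1) ^ (l + n) /
    ((l : ℂ) ^ s 0 * (m : ℂ) ^ s 1 * (n : ℂ) ^ s 2 *
      ((l + m : ℕ) : ℂ) ^ s 3 * ((m + n : ℕ) : ℂ) ^ s 4 * ((l + m + n : ℕ) : ℂ) ^ s 5)

/-- The summation range `l ≠ 0`, `m ≥ 1`, `l + m ≠ 0` of the double series `𝔗`. -/
abbrev TIndex : Type := {x : ℤ × ℕ+ // x.1 ≠ 0 ∧ x.1 + (x.2 : ℤ) ≠ 0}

/-- The term of index `(l, m)` of the series for `𝔗(P, s, Q; x, y)`: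
`x^l y^m / (l^P m^s (l+m)^Q)`. -/
def tTerm (P : ℕ) (s : ℂ) (Q : ℕ) (x y : ℂ) (i : TIndex) : ℂ :=
  let l : ℤ := i.1.1
  let m : ℕ := i.1.2
  x ^ l * y ^ m / ((l : ℂ) ^ P * (m : ℂ) ^ s * ((l + m : ℤ) : ℂ) ^ Q)

/-- `F` is a meromorphic function on the whole plane which agrees with `f` on `Re s > 1`; its
values are normalised (`MeromorphicNFOn`), so that it is analytic away from its poles.
By the identity theorem there is at most one such `F`. -/
structure IsMeroContinuation (f F : ℂ → ℂ) : Prop where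
  meromorphic : MeromorphicNFOn F Set.univ
  eq_of_one_lt_re : ∀ s : ℂ, 1 < s.re → F s = f s

open Classical in
/-- The meromorphic continuation to `ℂ` of a function given on the half plane `Re s > 1`
(and `f` itself if there is no such continuation). -/
def meroContinuation (f : ℂ → ℂ) : ℂ → ℂ :=
  if h : ∃ F, IsMeroContinuation f F then h.choose else f

/-- The meromorphic continuation of `s ↦ ζ₃(e(s), λ₂^∨; SU(4))`, for a line
`e : ℂ → ℂ⁶` in the space of exponents. -/
def zeta (e : ℂ → Fin 6 → ℂ) : ℂ → ℂ :=
  meroContinuation fun s => ∑' x, zetaTerm (e s) x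

/-- The meromorphic continuation in `s` of `𝔗(P, s, Q; x, y)`. -/
def T (P : ℕ) (s : ℂ) (Q : ℕ) (x y : ℂ) : ℂ :=
  meroContinuation (fun z => ∑' i, tTerm P z Q x y i) s

/-- `φ(s) = ∑_{n ≥ 1} (-1)^n n^{-s} = (2^{1-s} - 1) ζ(s)`, an entire function
(its value at the removable singularity `s = 1` is `-log 2`). -/
def phi (s : ℂ) : ℂ :=
  if s = 1 then -(Real.log 2 : ℂ) else ((2 : ℂ) ^ (1 - s) - 1) * riemannZeta s

/-- The exponent vectors, as functions of `s`, of the twelve zeta-functions on the left side. -/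
def exponents (p q a b c : ℕ) (i : Fin 12) (s : ℂ) : Fin 6 → ℂ :=
  (![![p, q, s, a, b, c],
     ![p, a, s, q, c, b],
     ![q, a, c, p, s, b],
     ![q, s, c, b, a, p],
     ![a, q, b, p, s, c],
     ![a, s, b, c, q, p],
     ![a, p, b, q, c, s],
     ![a, c, b, s, p, q],
     ![s, c, p, a, b, q],
     ![q, p, c, a, b, s],
     ![q, b, c, s, p, a],
     ![s, b, p, q, c, a]] : Fin 12 → Fin 6 → ℂ) i

/-- The exponents of the signs `(-1)^•` of the twelve terms on the left side. -/
def signs (p q a b c : ℕ) : Fin 12 → ℕ :=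
  ![0, p, p + a, p + a + c, q, q + b, q + a, q + a + b,
    q + a + b + c, p + q + a, p + q + a + c, p + q + a + b + c]

end SU4Zeta

end

/-! For `1 < re s` the relation computes one absolutely convergent sum in two ways. The summand is
(-1)^(l+n) / (l^p m^q n^s (l+m)^a (m+n)^b (l+m+n)^c), taken over all integers l, m and all n > 0 at
which no factor vanishes.

The planes l = 0, m = 0, l+m = 0, m+n = 0, l+m+n = 0 cut the half space n > 0 into twelve chambers,
half of the 24 Weyl chambers of type A₃. On each of them the absolute values of the six linear forms
are a permutation of L, M, N, L+M, M+N, L+M+N for a positive triple (L, M, N), and l+n has the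
parity of L+N. So each chamber contributes a sign times one of the twelve zeta-functions
(`hasSum_relExt`).

One may also sum over l first. For fixed m, n the summand is, up to a factor free of l, (-1)^l times
a rational function of l whose poles 0, -m, -(m+n) are omitted from the sum. By
`tendsto_sum_poleTerm` such a sum is computed pole by pole: the coefficient of X^(-j) in the Laurent
expansion is weighted by `lam x j`, the symmetric sum of x^l / l^j, and the pole k carries the sign
x^k. The constant coefficient has weight `lam x 0 = -1`, which accounts for the omitted points. Both
sides of that formula obey the same partial fraction recursion, so only a single pole has to be
checked. The Laurent coefficients supply the binomial coefficients, and the remaining sum over (m,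
n) gives the functions 𝔗 (`functional_relation_of_one_lt_re`). The same formula with two poles
evaluates 𝔗 itself (`tsum_tTerm_eq_tValue`), and the resulting combination of ζ and φ continues it.

For the triple series, grouping the terms by the value N of the linear form that carries the
exponent s gives a Dirichlet series with coefficients c(N). Partial fractions put c into the class
`Harm`, generated from constants by signs, division by n and summation (`exists_harm_update`).
Summation is compatible with continuation: expanding (n+1)^(-s) = n^(-s) (1+1/n)^(-s) expresses the
series of f through that of its differences and through values further to the right
(`Continuable.of_sub`). Finally both sides of the relation are meromorphic on the whole plane, and
the identity theorem extends it from `1 < re s`. -/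

open Complex Filter Topology Set

namespace SU4Zeta

/-! ### Meromorphic continuation -/

/-- Identity theorem for meromorphic functions in normal form. -/
theorem eqOn_of_meromorphicNFOn {F G : ℂ → ℂ} {U : Set ℂ} (hU : IsPreconnected U)
    (hF : MeromorphicNFOn F U) (hG : MeromorphicNFOn G U) {z : ℂ} (hz : z ∈ U)
    (h : F =ᶠ[𝓝 z] G) : EqOn F G U := by
  intro y hy
  have hFG : MeromorphicOn (F - G) U := hF.meromorphicOn.sub hG.meromorphicOn
  have hz' : meromorphicOrderAt (F - G) z = ⊤ := by
    rw [meromorphicOrderAt_eq_top_iff]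
    filter_upwards [h.filter_mono nhdsWithin_le_nhds] with w hw
    simp [hw]
  have hy' : meromorphicOrderAt (F - G) y = ⊤ := by
    by_contra hne
    exact hFG.meromorphicOrderAt_ne_top_of_isPreconnected hU hy hz hne hz'
  rw [meromorphicOrderAt_eq_top_iff] at hy'
  -- Normal form turns equality on a punctured neighbourhood of `y` into equality at `y` itself.
  refine (((hF hy).eventuallyEq_nhdsNE_iff_eventuallyEq_nhds (hG hy)).1 ?_).eq_of_nhds
  filter_upwards [hy'] with w hw
  exact sub_eq_zero.1 hw

theorem isOpen_halfPlane (x : ℝ) : IsOpen {s : ℂ | x < s.re} :=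
  isOpen_lt continuous_const continuous_re

theorem isPreconnected_halfPlane (x : ℝ) : IsPreconnected {s : ℂ | x < s.re} :=
  (convex_halfSpace_re_gt x).isPreconnected

theorem MeromorphicOn.congr_toNF {F : ℂ → ℂ} {U : Set ℂ} (hF : MeromorphicOn F U) {s : ℂ}
    (hs : s ∈ U) (h : AnalyticAt ℂ F s) : toMeromorphicNFOn F U s = F s := by
  rw [toMeromorphicNFOn_eq_toMeromorphicNFAt hF hs]
  exact congrFun (toMeromorphicNFAt_eq_self.2 h.meromorphicNFAt) s

/-- A function that continues meromorphically to every half plane `-N < Re s` continues to `ℂ`. -/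
theorem exists_isMeroContinuation {f : ℂ → ℂ} (hf : ∀ s : ℂ, 1 < s.re → AnalyticAt ℂ f s)
    (h : ∀ N : ℕ, ∃ F, MeromorphicOn F {s | -(N : ℝ) < s.re} ∧
      ∃ B : ℝ, ∀ s : ℂ, B < s.re → F s = f s) : ∃ F, IsMeroContinuation f F := by
  have h' : ∀ N : ℕ, ∃ F, MeromorphicNFOn F {s | -(N : ℝ) < s.re} ∧
      ∀ s : ℂ, 1 < s.re → F s = f s := by
    intro N
    obtain ⟨F, hF, B, hB⟩ := h N
    have hNF := meromorphicNFOn_toMeromorphicNFOn F {s | -(N : ℝ) < s.re}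
    refine ⟨toMeromorphicNFOn F {s | -(N : ℝ) < s.re}, hNF, ?_⟩
    have hsub : {s : ℂ | 1 < s.re} ⊆ {s | -(N : ℝ) < s.re} := by
      intro s hs
      have : (0 : ℝ) ≤ N := N.cast_nonneg
      simp only [mem_ofPred_eq] at hs ⊢
      linarith
    have hz : (1 : ℝ) < ((max B 1 + 1 : ℝ) : ℂ).re := by
      rw [ofReal_re]; linarith [le_max_right B 1]
    -- `F` is known to equal `f` only far to the right. The base point lies there, and since `f` is
    -- analytic on `1 < re`, the identity theorem carries the equality down to that line.
    refine eqOn_of_meromorphicNFOn (isPreconnected_halfPlane 1) (fun s hs => hNF (hsub hs))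
      (fun s hs => (hf s hs).meromorphicNFAt) (z := ((max B 1 + 1 : ℝ) : ℂ)) hz ?_
    have hev : ∀ᶠ s : ℂ in 𝓝 ((max B 1 + 1 : ℝ) : ℂ), max B 1 < s.re :=
      (isOpen_halfPlane _).mem_nhds (by simp only [mem_ofPred_eq, ofReal_re]; linarith)
    have hFf : ∀ s : ℂ, max B 1 < s.re → F =ᶠ[𝓝 s] f := fun s hs =>
      eventually_of_mem ((isOpen_halfPlane _).mem_nhds hs)
        fun w hw => hB w ((le_max_left _ _).trans_lt hw)
    filter_upwards [hev] with s hs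
    have h1 : 1 < s.re := (le_max_right _ _).trans_lt hs
    rw [MeromorphicOn.congr_toNF hF (hsub h1) ((hf s h1).congr (hFf s hs).symm),
      (hFf s hs).eq_of_nhds]
  choose F hF hFf using h'
  have hFF : ∀ N M : ℕ, N ≤ M → EqOn (F N) (F M) {s | -(N : ℝ) < s.re} := by
    intro N M hNM
    have hNM' : (N : ℝ) ≤ M := by exact_mod_cast hNM
    have hN0 : (0 : ℝ) ≤ N := N.cast_nonneg
    refine eqOn_of_meromorphicNFOn (isPreconnected_halfPlane _) (hF N)
      (fun s hs => hF M ?_) (z := 2) ?_ ?_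
    · simp only [mem_ofPred_eq] at hs ⊢; linarith
    · simp only [mem_ofPred_eq, re_ofNat]; linarith
    · filter_upwards [(isOpen_halfPlane 1).mem_nhds (show (1 : ℝ) < (2 : ℂ).re by simp)] with s hs
      rw [hFf N s hs, hFf M s hs]
  -- The continuations on different half planes agree on overlaps, so the value at `s` can be read
  -- off from any `N` with `-N < re s`; `ν s` is one such `N`.
  set ν : ℂ → ℕ := fun s => ⌈-s.re⌉₊ + 1 with hν
  have hνs : ∀ s : ℂ, -(ν s : ℝ) < s.re := by
    intro s
    have := Nat.le_ceil (-s.re)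
    simp only [hν]; push_cast; linarith
  have hG : ∀ s (M : ℕ), -(M : ℝ) < s.re → F (ν s) s = F M s := by
    intro s M hM
    rcases le_total (ν s) M with hle | hle
    · exact hFF _ _ hle (hνs s)
    · exact (hFF _ _ hle hM).symm
  refine ⟨fun s => F (ν s) s, fun s _ => ?_, fun s hs => hFf _ s hs⟩
  refine (meromorphicNFAt_congr (g := F (ν s)) ?_).2 (hF _ (hνs s))
  filter_upwards [(isOpen_halfPlane _).mem_nhds (hνs s)] with w hw
  exact hG w _ hw

theorem IsMeroContinuation.meroContinuation {f F : ℂ → ℂ} (h : IsMeroContinuation f F) :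
    IsMeroContinuation f (meroContinuation f) := by
  have h' : ∃ F, IsMeroContinuation f F := ⟨F, h⟩
  rw [SU4Zeta.meroContinuation, dif_pos h']
  exact h'.choose_spec

/-- If a meromorphic `G` agrees with `f` on `Re s > 1` and is analytic there, then the continuation
of `f` exists, and agrees with `G` wherever `G` is analytic. -/
theorem isMeroContinuation_of_meromorphic {f G : ℂ → ℂ} (hG : ∀ s, MeromorphicAt G s)
    (hGa : ∀ s : ℂ, 1 < s.re → AnalyticAt ℂ G s) (hGf : ∀ s : ℂ, 1 < s.re → G s = f s) :
    IsMeroContinuation f (meroContinuation f) ∧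
      ∀ s, AnalyticAt ℂ G s → meroContinuation f s = G s := by
  have hG' : MeromorphicOn G univ := fun s _ => hG s
  have hNF := meromorphicNFOn_toMeromorphicNFOn G univ
  have h0 : IsMeroContinuation f (toMeromorphicNFOn G univ) := ⟨hNF, fun s hs => by
    rw [MeromorphicOn.congr_toNF hG' (mem_univ s) (hGa s hs), hGf s hs]⟩
  refine ⟨h0.meroContinuation, fun s hs => ?_⟩
  rw [← MeromorphicOn.congr_toNF hG' (mem_univ s) hs]
  refine eqOn_of_meromorphicNFOn isPreconnected_univ h0.meroContinuation.meromorphic hNF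
    (mem_univ (2 : ℂ)) ?_ (mem_univ s)
  filter_upwards [(isOpen_halfPlane 1).mem_nhds (show (1 : ℝ) < (2 : ℂ).re by simp)] with w hw
  rw [h0.meroContinuation.eq_of_one_lt_re w hw, h0.eq_of_one_lt_re w hw]

/-- Two meromorphic functions that agree on a half plane agree where both are analytic. -/
theorem eq_of_analyticAt_of_eq_halfPlane {F G : ℂ → ℂ} (hF : ∀ s, MeromorphicAt F s)
    (hG : ∀ s, MeromorphicAt G s) {B : ℝ} (h : ∀ s : ℂ, B < s.re → F s = G s) {s : ℂ}
    (hFs : AnalyticAt ℂ F s) (hGs : AnalyticAt ℂ G s) : F s = G s := by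
  have hFG : MeromorphicOn (F - G) univ := fun s _ => (hF s).sub (hG s)
  have hz' : meromorphicOrderAt (F - G) ((B + 1 : ℝ) : ℂ) = ⊤ := by
    rw [meromorphicOrderAt_eq_top_iff]
    refine Filter.Eventually.filter_mono nhdsWithin_le_nhds ?_
    filter_upwards [(isOpen_halfPlane B).mem_nhds (show B < ((B + 1 : ℝ) : ℂ).re by simp)]
      with w hw
    simp [h w hw]
  have hy' : meromorphicOrderAt (F - G) s = ⊤ := by
    by_contra hne
    exact hFG.meromorphicOrderAt_ne_top_of_isPreconnected isPreconnected_univ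
      (mem_univ s) (mem_univ _) hne hz'
  rw [meromorphicOrderAt_eq_top_iff] at hy'
  have h0 := (hFs.sub hGs).continuousAt
  have h1 : Tendsto (F - G) (𝓝[≠] s) (𝓝 ((F - G) s)) := h0.tendsto.mono_left nhdsWithin_le_nhds
  have h2 : Tendsto (F - G) (𝓝[≠] s) (𝓝 0) :=
    tendsto_const_nhds.congr' (by filter_upwards [hy'] with w hw using hw.symm)
  exact sub_eq_zero.1 (tendsto_nhds_unique h1 h2)

/-! ### The functions `ζ` and `φ` -/

theorem half_ne_zero_unitAddCircle : ((1 / 2 : ℝ) : UnitAddCircle) ≠ 0 := by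
  intro h
  rw [AddCircle.coe_eq_zero_iff] at h
  obtain ⟨n, hn⟩ := h
  have h2 : (n : ℝ) = 1 / 2 := by simpa using hn
  have : (2 * n : ℤ) = 1 := by
    have : (2 * (n : ℝ)) = 1 := by rw [h2]; norm_num
    exact_mod_cast this
  omega

theorem hasSum_cosZeta_half {s : ℂ} (hs : 1 < s.re) :
    HasSum (fun n : ℕ => (-1 : ℂ) ^ n / (n : ℂ) ^ s)
      (HurwitzZeta.cosZeta ((1 / 2 : ℝ) : UnitAddCircle) s) := by
  have := HurwitzZeta.hasSum_nat_cosZeta (1 / 2) hs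
  refine this.congr_fun fun n => ?_
  rw [show 2 * Real.pi * (1 / 2) * n = n * Real.pi by ring, Real.cos_nat_mul_pi]
  push_cast
  rfl

/-- The even terms sum to 2^(-w) ζ(w), the odd ones to the rest of ζ(w) with opposite sign. -/
theorem eq_of_hasSum_neg_one_pow_div {w : ℂ} (hw : 1 < w.re) {C : ℂ} (hC : HasSum (fun n : ℕ => (-1 : ℂ) ^ n / (n : ℂ) ^ w) C) :
    C = ((2 : ℂ) ^ (1 - w) - 1) * riemannZeta w := by
  have hp : (2 : ℂ) ^ (1 - w) = 2 * (2 : ℂ) ^ (-w) := by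
    rw [sub_eq_add_neg, cpow_add _ _ two_ne_zero, cpow_one]
  have hsum : Summable fun n : ℕ => 1 / (n : ℂ) ^ w := Complex.summable_one_div_nat_cpow.2 hw
  have hz := zeta_eq_tsum_one_div_nat_cpow hw
  have hζ : HasSum (fun n : ℕ => 1 / (n : ℂ) ^ w) (riemannZeta w) := hz ▸ hsum.hasSum
  have he : HasSum (fun n : ℕ => 1 / ((2 * n : ℕ) : ℂ) ^ w) ((2 : ℂ) ^ (-w) * riemannZeta w) := by
    refine (hζ.mul_left _).congr_fun fun n => ?_
    rw [Nat.cast_mul, natCast_mul_natCast_cpow, cpow_neg, Nat.cast_ofNat]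
    simp [mul_comm]
  obtain ⟨o, ho⟩ : Summable fun n : ℕ => 1 / ((2 * n + 1 : ℕ) : ℂ) ^ w :=
    hsum.comp_injective (i := fun n : ℕ => 2 * n + 1) (fun a b h => by simpa using h)
  have hall : (2 : ℂ) ^ (-w) * riemannZeta w + o = riemannZeta w :=
    (HasSum.even_add_odd (f := fun n : ℕ => 1 / (n : ℂ) ^ w) he ho).unique hζ
  have h1 : HasSum (fun n : ℕ => (-1 : ℂ) ^ (2 * n) / ((2 * n : ℕ) : ℂ) ^ w)
      ((2 : ℂ) ^ (-w) * riemannZeta w) := he.congr_fun fun n => by simp [pow_mul]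
  have h3 : HasSum (fun n : ℕ => (-1 : ℂ) ^ (2 * n + 1) / ((2 * n + 1 : ℕ) : ℂ) ^ w)
      (-o) := ho.neg.congr_fun fun n => by simp [pow_succ, pow_mul, neg_div]
  have hC' := hC.unique
    (HasSum.even_add_odd (f := fun n : ℕ => (-1 : ℂ) ^ n / (n : ℂ) ^ w) h1 h3)
  rw [hC', hp]
  linear_combination (-1 : ℂ) * hall

theorem cosZeta_half_eq {s : ℂ} (hs : s ≠ 1) :
    HurwitzZeta.cosZeta ((1 / 2 : ℝ) : UnitAddCircle) s = ((2 : ℂ) ^ (1 - s) - 1) * riemannZeta s := by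
  have hpre : IsPreconnected ({1}ᶜ : Set ℂ) :=
    (isConnected_compl_singleton_of_one_lt_rank (by simp) (1 : ℂ)).isPreconnected
  have h2 : (2 : ℂ) ≠ 0 := two_ne_zero
  have hpow : Differentiable ℂ fun s : ℂ => (2 : ℂ) ^ (1 - s) - 1 := by
    intro s
    exact ((differentiableAt_id.const_sub 1).const_cpow (Or.inl h2)).sub_const 1
  have hA : AnalyticOnNhd ℂ (HurwitzZeta.cosZeta ((1 / 2 : ℝ) : UnitAddCircle)) {1}ᶜ :=
    (HurwitzZeta.differentiable_cosZeta_of_ne_zero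
      half_ne_zero_unitAddCircle).differentiableOn.analyticOnNhd isOpen_compl_singleton
  have hB : AnalyticOnNhd ℂ (fun s => ((2 : ℂ) ^ (1 - s) - 1) * riemannZeta s) {1}ᶜ := by
    refine DifferentiableOn.analyticOnNhd (fun s hs => ?_) isOpen_compl_singleton
    exact ((hpow s).mul (differentiableAt_riemannZeta hs)).differentiableWithinAt
  refine hA.eqOn_of_preconnected_of_eventuallyEq hB hpre (z₀ := 2) (by simp) ?_ hs
  filter_upwards [(isOpen_halfPlane 1).mem_nhds (show (1 : ℝ) < (2 : ℂ).re by simp)] with w hw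
  exact eq_of_hasSum_neg_one_pow_div hw (hasSum_cosZeta_half hw)

/-- Identifies `phi` with a function known to be entire. At `s = 1` the value is a limit: the slope
of 2^(1-s) tends to -log 2 and the residue of ζ is 1. -/
theorem phi_eq_cosZeta : phi = HurwitzZeta.cosZeta ((1 / 2 : ℝ) : UnitAddCircle) := by
  funext s
  by_cases hs : s = 1
  · subst hs
    rw [phi, if_pos rfl]
    have hd := HurwitzZeta.differentiable_cosZeta_of_ne_zero half_ne_zero_unitAddCircle
    have h1 : Tendsto (HurwitzZeta.cosZeta ((1 / 2 : ℝ) : UnitAddCircle)) (𝓝[≠] 1)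
        (𝓝 (HurwitzZeta.cosZeta ((1 / 2 : ℝ) : UnitAddCircle) 1)) :=
      (hd 1).continuousAt.tendsto.mono_left nhdsWithin_le_nhds
    have hder : HasDerivAt (fun s : ℂ => (2 : ℂ) ^ (1 - s)) (-(Real.log 2 : ℂ)) 1 := by
      have := ((hasDerivAt_id (1 : ℂ)).const_sub 1).const_cpow (c := (2 : ℂ))
        (Or.inl two_ne_zero)
      simpa [Complex.ofReal_log] using this
    have h2 : Tendsto (fun s : ℂ => ((2 : ℂ) ^ (1 - s) - 1) / (s - 1)) (𝓝[≠] 1)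
        (𝓝 (-(Real.log 2 : ℂ))) := by
      have := hasDerivAt_iff_tendsto_slope.1 hder
      refine this.congr fun s => ?_
      simp [slope, div_eq_inv_mul]
    refine (tendsto_nhds_unique h1 ?_).symm
    have h3 := h2.mul riemannZeta_residue_one
    rw [mul_one] at h3
    refine h3.congr' ?_
    filter_upwards [self_mem_nhdsWithin] with s hs
    rw [cosZeta_half_eq hs]
    have : s - 1 ≠ 0 := sub_ne_zero.2 hs
    field_simp
  · rw [phi, if_neg hs, cosZeta_half_eq hs]

theorem differentiable_phi : Differentiable ℂ phi := by
  rw [phi_eq_cosZeta]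
  exact HurwitzZeta.differentiable_cosZeta_of_ne_zero half_ne_zero_unitAddCircle

theorem analyticAt_phi (s : ℂ) : AnalyticAt ℂ phi s :=
  differentiable_phi.analyticAt s

theorem analyticAt_riemannZeta {s : ℂ} (hs : s ≠ 1) : AnalyticAt ℂ riemannZeta s :=
  DifferentiableOn.analyticAt (s := {1}ᶜ)
    (fun _ hz => (differentiableAt_riemannZeta hz).differentiableWithinAt)
    (isOpen_compl_singleton.mem_nhds hs)

theorem meromorphicAt_riemannZeta (s : ℂ) : MeromorphicAt riemannZeta s := by
  by_cases hs : s = 1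
  · subst hs
    -- (s-1) ζ(s), completed at 1 by its limit, has a removable singularity there.
    set g : ℂ → ℂ := Function.update (fun s => (s - 1) * riemannZeta s) 1 1 with hg
    have hgc : ContinuousAt g 1 := continuousAt_update_same.2 riemannZeta_residue_one
    have hd : ∀ᶠ z in 𝓝[≠] (1 : ℂ), DifferentiableAt ℂ g z := by
      filter_upwards [self_mem_nhdsWithin] with z hz
      have h1 : DifferentiableAt ℂ (fun s => (s - 1) * riemannZeta s) z :=
        (differentiableAt_id.sub_const 1).mul (differentiableAt_riemannZeta hz)
      refine h1.congr_of_eventuallyEq ?_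
      filter_upwards [isOpen_compl_singleton.mem_nhds hz] with w hw
      rw [hg, Function.update_of_ne hw]
    have ha := analyticAt_of_differentiable_on_punctured_nhds_of_continuousAt hd hgc
    have hm : MeromorphicAt (fun s => g s / (s - 1)) 1 :=
      ha.meromorphicAt.div ((analyticAt_id.sub analyticAt_const).meromorphicAt)
    refine hm.congr ?_
    filter_upwards [self_mem_nhdsWithin] with z hz
    have : z - 1 ≠ 0 := sub_ne_zero.2 hz
    rw [hg, Function.update_of_ne hz]
    field_simp
  · exact (analyticAt_riemannZeta hs).meromorphicAt

/-- The continuation of `∑ e ^ n / n ^ s` for a sign `e`. -/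
noncomputable def signZeta (e : ℂ) : ℂ → ℂ := if e = 1 then riemannZeta else phi

@[simp] theorem signZeta_one : signZeta 1 = riemannZeta := if_pos rfl

@[simp] theorem signZeta_neg_one : signZeta (-1) = phi := if_neg (by norm_num)

theorem hasSum_signZeta {e s : ℂ} (he : e = 1 ∨ e = -1) (hs : 1 < s.re) :
    HasSum (fun n : ℕ => e ^ n / (n : ℂ) ^ s) (signZeta e s) := by
  rcases he with rfl | rfl
  · rw [signZeta_one, zeta_eq_tsum_one_div_nat_cpow hs]
    simpa using (Complex.summable_one_div_nat_cpow.2 hs).hasSum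
  · rw [signZeta_neg_one, phi_eq_cosZeta]
    exact hasSum_cosZeta_half hs

/-- That the value is the same for both signs is what gives the constant Laurent coefficient the
uniform weight -1 later on. -/
theorem signZeta_zero {e : ℂ} (he : e = 1 ∨ e = -1) : signZeta e 0 = -1 / 2 := by
  rcases he with rfl | rfl
  · rw [signZeta_one, riemannZeta_zero]
  · simp [signZeta_neg_one, phi, riemannZeta_zero]; norm_num

theorem meromorphicAt_signZeta {e : ℂ} (he : e = 1 ∨ e = -1) (s : ℂ) :
    MeromorphicAt (signZeta e) s := by
  rcases he with rfl | rfl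
  · rw [signZeta_one]; exact meromorphicAt_riemannZeta s
  · rw [signZeta_neg_one]; exact (analyticAt_phi s).meromorphicAt

theorem analyticAt_signZeta {e : ℂ} (he : e = 1 ∨ e = -1) {s : ℂ} (hs : s ≠ 1) :
    AnalyticAt ℂ (signZeta e) s := by
  rcases he with rfl | rfl
  · rw [signZeta_one]; exact analyticAt_riemannZeta hs
  · rw [signZeta_neg_one]; exact analyticAt_phi s


/-! ### Dirichlet series with meromorphic continuation -/

/-- The binomial coefficient `(-s choose k)`. -/
noncomputable def negChoose : ℕ → ℂ → ℂ
  | 0, _ => 1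
  | k + 1, s => -s / (k + 1) * negChoose k (s + 1)

theorem differentiable_negChoose (k : ℕ) : Differentiable ℂ (negChoose k) := by
  induction k with
  | zero => exact differentiable_const 1
  | succ k ih =>
    have : negChoose (k + 1) = fun s => -s / (k + 1) * negChoose k (s + 1) := rfl
    rw [this]
    fun_prop

/-- The remainder of the binomial series of `(1 + t) ^ (-s)`. -/
noncomputable def binomRem (K : ℕ) (s : ℂ) (t : ℝ) : ℂ :=
  (1 + (t : ℂ)) ^ (-s) - ∑ k ∈ Finset.range K, negChoose k s * (t : ℂ) ^ k

/-- Differentiation lowers the order of the remainder by one and moves `s` to `s + 1`; this drives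
the induction for the size of the remainder. -/
theorem hasDerivAt_binomRem (K : ℕ) (s : ℂ) {t : ℝ} (ht : 0 ≤ t) :
    HasDerivAt (binomRem (K + 1) s) (-s * binomRem K (s + 1) t) t := by
  have hslit : (1 + (t : ℂ)) ∈ slitPlane := by
    left; simp; linarith
  have h1 : HasDerivAt (fun t : ℝ => (1 + (t : ℂ)) ^ (-s)) (-s * (1 + (t : ℂ)) ^ (-(s + 1))) t := by
    have h := ((hasDerivAt_id (t : ℂ)).const_add 1).cpow_const (c := -s) hslit
    have h' := h.comp_ofReal
    simpa [neg_add, sub_eq_add_neg, add_comm] using h'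
  have h2 : HasDerivAt (fun t : ℝ => ∑ k ∈ Finset.range (K + 1), negChoose k s * (t : ℂ) ^ k)
      (-s * ∑ k ∈ Finset.range K, negChoose k (s + 1) * (t : ℂ) ^ k) t := by
    have h : HasDerivAt (fun t : ℝ => ∑ k ∈ Finset.range (K + 1), negChoose k s * (t : ℂ) ^ k)
        (∑ k ∈ Finset.range (K + 1), negChoose k s * (k * (t : ℂ) ^ (k - 1))) t := by
      refine HasDerivAt.fun_sum fun k _ => ?_
      exact ((hasDerivAt_pow k (t : ℂ)).comp_ofReal).const_mul _
    convert h using 1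
    rw [Finset.sum_range_succ', Finset.mul_sum]
    simp only [Nat.cast_zero, zero_mul, mul_zero, add_zero, Nat.add_sub_cancel]
    refine Finset.sum_congr rfl fun k _ => ?_
    have : (k : ℂ) + 1 ≠ 0 := Nat.cast_add_one_ne_zero k
    simp only [negChoose, Nat.cast_add, Nat.cast_one]
    field_simp
  have := h1.sub h2
  rw [← mul_sub] at this
  exact this

/-- Induction on the order by the mean value inequality, as the remainder of positive order vanishes
at `t = 0`. Uniformity for `‖s‖ ≤ ρ` is needed for holomorphy of the remainder series; the radius
grows by one at each step because `s` is shifted. -/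
theorem exists_norm_binomRem_le (K : ℕ) : ∀ ρ : ℝ, 0 ≤ ρ → ∃ M : ℝ, 0 ≤ M ∧
    ∀ s : ℂ, ‖s‖ ≤ ρ → ∀ t ∈ Icc (0 : ℝ) 1, ‖binomRem K s t‖ ≤ M * t ^ K := by
  induction K with
  | zero =>
    intro ρ hρ
    refine ⟨2 ^ ρ, by positivity, fun s hs t ht => ?_⟩
    have h1 : (1 + (t : ℂ)) = ((1 + t : ℝ) : ℂ) := by push_cast; rfl
    have h0 : (0 : ℝ) < 1 + t := by linarith [ht.1]
    simp only [binomRem, Finset.range_zero, Finset.sum_empty, sub_zero, pow_zero, mul_one]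
    rw [h1, norm_cpow_eq_rpow_re_of_pos h0, neg_re]
    have h2 : -s.re ≤ ρ := (neg_le_abs _).trans ((abs_re_le_norm s).trans hs)
    calc (1 + t) ^ (-s.re) ≤ (1 + t) ^ ρ := Real.rpow_le_rpow_of_exponent_le (by linarith [ht.1]) h2
      _ ≤ 2 ^ ρ := Real.rpow_le_rpow h0.le (by linarith [ht.2]) hρ
  | succ K ih =>
    intro ρ hρ
    obtain ⟨M, hM, h⟩ := ih (ρ + 1) (by linarith)
    refine ⟨ρ * M, by positivity, fun s hs t ht => ?_⟩
    have hs1 : ‖s + 1‖ ≤ ρ + 1 := (norm_add_le _ _).trans (by simpa using hs)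
    have key := norm_image_sub_le_of_norm_deriv_le_segment' (a := 0) (b := t)
      (f := binomRem (K + 1) s) (C := ρ * M * t ^ K)
      (fun x hx => (hasDerivAt_binomRem K s hx.1).hasDerivWithinAt) (fun x hx => ?_) t
      ⟨ht.1, le_rfl⟩
    · have h0 : binomRem (K + 1) s 0 = 0 := by
        simp [binomRem, Finset.sum_range_succ', negChoose]
      rw [h0, sub_zero, sub_zero] at key
      rw [pow_succ]; linarith
    · rw [norm_mul, norm_neg]
      have := h (s + 1) hs1 x ⟨hx.1, hx.2.le.trans ht.2⟩
      calc ‖s‖ * ‖binomRem K (s + 1) x‖ ≤ ρ * (M * x ^ K) := by gcongr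
        _ ≤ ρ * (M * t ^ K) := by
          have := hx.1
          have := hx.2.le
          gcongr
        _ = ρ * M * t ^ K := by ring

/-- Polynomial growth. -/
def PolyGrowth (f : ℕ → ℂ) (A : ℕ) (C : ℝ) : Prop := 0 ≤ C ∧ ∀ n : ℕ, 1 ≤ n → ‖f n‖ ≤ C * (n : ℝ) ^ A

/-- The Dirichlet series of `f` continues meromorphically to `x < Re s`. -/
def ContinuesTo (f : ℕ → ℂ) (x : ℝ) : Prop :=
  ∃ F, MeromorphicOn F {s : ℂ | x < s.re} ∧ ∃ B : ℝ, ∀ s : ℂ, B < s.re → F s = LSeries f s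

/-- The sequence `f` has polynomial growth and its Dirichlet series continues meromorphically to
every half plane. -/
def Continuable (f : ℕ → ℂ) : Prop := (∃ A C, PolyGrowth f A C) ∧ ∀ x, ContinuesTo f x

theorem PolyGrowth.summable {f : ℕ → ℂ} {A : ℕ} {C : ℝ} (h : PolyGrowth f A C) {s : ℂ}
    (hs : (A : ℝ) + 1 < s.re) : LSeriesSummable f s := by
  refine LSeriesSummable_of_le_const_mul_rpow (x := (A : ℝ) + 1) hs ⟨C, fun n hn => ?_⟩
  simpa using h.2 n (Nat.one_le_iff_ne_zero.2 hn)

theorem hasSum_LSeries_succ {f : ℕ → ℂ} {s : ℂ} (h : LSeriesSummable f s) :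
    HasSum (fun n : ℕ => f (n + 1) * ((n + 1 : ℕ) : ℂ) ^ (-s)) (LSeries f s) := by
  have h1 := (hasSum_nat_add_iff' 1).2 h.LSeriesHasSum
  simp only [Finset.range_one, Finset.sum_singleton, LSeries.term_zero, sub_zero] at h1
  refine h1.congr_fun fun n => ?_
  rw [LSeries.term_of_ne_zero (Nat.succ_ne_zero n), cpow_neg, div_eq_mul_inv]

theorem PolyGrowth.analyticAt {f : ℕ → ℂ} {A : ℕ} {C : ℝ} (h : PolyGrowth f A C) {s : ℂ}
    (hs : (A : ℝ) + 1 < s.re) : AnalyticAt ℂ (LSeries f) s := by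
  refine LSeries_analyticOnNhd f s ?_
  refine lt_of_le_of_lt (LSeries.abscissaOfAbsConv_le_of_le_const_mul_rpow (x := (A : ℝ))
    ⟨C, fun n hn => ?_⟩) (by exact_mod_cast hs)
  simpa using h.2 n (Nat.one_le_iff_ne_zero.2 hn)

/-- The remainder in the translation formula for the Dirichlet series of `f`. -/
noncomputable def shiftRem (f : ℕ → ℂ) (K : ℕ) (s : ℂ) : ℂ :=
  ∑' n : ℕ, f (n + 1) * ((n + 1 : ℕ) : ℂ) ^ (-s) * binomRem K s (1 / (n + 1 : ℕ))

/-- The factors have sizes n^A, n^(-re s) and n^(-K), whose product is at most n^(-2) once `A + 2 -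
K < re s`. Raising `K` therefore moves the half plane of holomorphy of `shiftRem` arbitrarily far to
the left. -/
theorem PolyGrowth.norm_shiftRem_term_le {f : ℕ → ℂ} {A : ℕ} {C : ℝ} (h : PolyGrowth f A C) (K : ℕ)
    {M : ℝ} (_hM : 0 ≤ M) {s : ℂ} (hs : (A : ℝ) + 2 - K < s.re)
    (hR : ∀ t ∈ Icc (0 : ℝ) 1, ‖binomRem K s t‖ ≤ M * t ^ K) (n : ℕ) :
    ‖f (n + 1) * ((n + 1 : ℕ) : ℂ) ^ (-s) * binomRem K s (1 / (n + 1 : ℕ))‖ ≤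
      C * M * (1 / ((n + 1 : ℕ) : ℝ) ^ 2) := by
  have hC := h.1
  have hn0 : (0 : ℝ) < ((n + 1 : ℕ) : ℝ) := by positivity
  have hn1 : (1 : ℝ) ≤ ((n + 1 : ℕ) : ℝ) := by simp
  have h1 := h.2 (n + 1) (by omega)
  have h2 : ‖((n + 1 : ℕ) : ℂ) ^ (-s)‖ ≤ ((n + 1 : ℕ) : ℝ) ^ (-((A : ℝ) + 2 - K)) := by
    rw [norm_natCast_cpow_of_pos (Nat.succ_pos n), neg_re]
    exact Real.rpow_le_rpow_of_exponent_le hn1 (by linarith)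
  have h3 := hR (1 / ((n + 1 : ℕ) : ℝ)) ⟨by positivity, by rw [div_le_one hn0]; exact hn1⟩
  calc _ ≤ (C * ((n + 1 : ℕ) : ℝ) ^ A) * ((n + 1 : ℕ) : ℝ) ^ (-((A : ℝ) + 2 - K)) *
        (M * (1 / ((n + 1 : ℕ) : ℝ)) ^ K) := by
        rw [norm_mul, norm_mul]
        gcongr
    _ = C * M * (1 / ((n + 1 : ℕ) : ℝ) ^ 2) := by
      rw [show -((A : ℝ) + 2 - K) = (K : ℝ) - (A : ℝ) - (2 : ℕ) by push_cast; ring,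
        Real.rpow_sub hn0, Real.rpow_sub hn0, Real.rpow_natCast, Real.rpow_natCast,
        Real.rpow_natCast, one_div, inv_pow]
      field_simp

theorem summable_one_div_succ_sq : Summable fun n : ℕ => 1 / ((n + 1 : ℕ) : ℝ) ^ 2 :=
  (summable_nat_add_iff 1).2 (Real.summable_one_div_nat_pow.2 one_lt_two)

theorem PolyGrowth.differentiableOn_shiftRem {f : ℕ → ℂ} {A : ℕ} {C : ℝ} (h : PolyGrowth f A C)
    (K : ℕ) : DifferentiableOn ℂ (shiftRem f K) {s | (A : ℝ) + 2 - K < s.re} := by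
  intro s hs
  obtain ⟨M, hM, hR⟩ := exists_norm_binomRem_le K (‖s‖ + 1) (by positivity)
  have hopen : IsOpen ({s : ℂ | (A : ℝ) + 2 - K < s.re} ∩ Metric.ball s 1) :=
    (isOpen_halfPlane _).inter Metric.isOpen_ball
  have hmem : s ∈ {s : ℂ | (A : ℝ) + 2 - K < s.re} ∩ Metric.ball s 1 :=
    ⟨hs, Metric.mem_ball_self one_pos⟩
  have hd : DifferentiableOn ℂ (shiftRem f K)
      ({s : ℂ | (A : ℝ) + 2 - K < s.re} ∩ Metric.ball s 1) := by
    refine differentiableOn_tsum_of_summable_norm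
      (u := fun n : ℕ => C * M * (1 / ((n + 1 : ℕ) : ℝ) ^ 2))
      (summable_one_div_succ_sq.mul_left _) (fun n => ?_) hopen (fun n w hw => ?_)
    · have hn : ((n + 1 : ℕ) : ℂ) ≠ 0 := Nat.cast_ne_zero.2 (Nat.succ_ne_zero n)
      have hn' : (1 + ((1 / ((n + 1 : ℕ) : ℝ) : ℝ) : ℂ)) ≠ 0 := by
        have : (0 : ℝ) < 1 + 1 / ((n + 1 : ℕ) : ℝ) := by positivity
        exact_mod_cast this.ne'
      have hb := differentiable_negChoose
      refine Differentiable.differentiableOn ?_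
      refine Differentiable.mul ?_ ?_
      · exact (differentiable_const _).mul
          ((differentiable_id.neg).const_cpow (Or.inl hn))
      · refine ((differentiable_id.neg).const_cpow (Or.inl hn')).sub ?_
        exact Differentiable.fun_sum fun k _ => (hb k).mul (differentiable_const _)
    · refine h.norm_shiftRem_term_le K hM hw.1 (hR w ?_) n
      have h1 : ‖w - s‖ < 1 := by simpa [dist_eq_norm] using hw.2
      calc ‖w‖ = ‖s + (w - s)‖ := by ring_nf
        _ ≤ ‖s‖ + 1 := (norm_add_le _ _).trans (by linarith)
  exact (hd.differentiableAt (hopen.mem_nhds hmem)).differentiableWithinAt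

/-- The translation formula. -/
theorem PolyGrowth.hasSum_shift {f : ℕ → ℂ} {A : ℕ} {C : ℝ} (h : PolyGrowth f A C) (K : ℕ) {s : ℂ}
    (hs : (A : ℝ) + 2 < s.re) :
    HasSum (fun n : ℕ => f (n + 1) * ((n + 2 : ℕ) : ℂ) ^ (-s))
      (∑ k ∈ Finset.range K, negChoose k s * LSeries f (s + k) + shiftRem f K s) := by
  have h1 : ∀ k : ℕ, HasSum (fun n : ℕ => negChoose k s *
      (f (n + 1) * ((n + 1 : ℕ) : ℂ) ^ (-(s + k)))) (negChoose k s * LSeries f (s + k)) := fun k =>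
    (hasSum_LSeries_succ (h.summable (by
      have : (0 : ℝ) ≤ k := k.cast_nonneg
      simp only [add_re, natCast_re]; linarith))).mul_left _
  obtain ⟨M, hM, hR⟩ := exists_norm_binomRem_le K ‖s‖ (by positivity)
  have h2 : HasSum (fun n : ℕ => f (n + 1) * ((n + 1 : ℕ) : ℂ) ^ (-s) *
      binomRem K s (1 / (n + 1 : ℕ))) (shiftRem f K s) := by
    refine Summable.hasSum (Summable.of_norm_bounded
      (summable_one_div_succ_sq.mul_left (C * M)) fun n => ?_)
    refine h.norm_shiftRem_term_le K hM ?_ (hR s le_rfl) n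
    have : (0 : ℝ) ≤ K := K.cast_nonneg
    linarith
  refine ((hasSum_sum fun k (_ : k ∈ Finset.range K) => h1 k).add h2).congr_fun fun n => ?_
  have hn : ((n + 1 : ℕ) : ℂ) ≠ 0 := Nat.cast_ne_zero.2 (Nat.succ_ne_zero n)
  -- n+2 = (n+1)(1 + 1/(n+1)), and the last factor is expanded by the binomial series up to order
  -- `K`.
  have hpow : ((n + 2 : ℕ) : ℂ) ^ (-s) = ((n + 1 : ℕ) : ℂ) ^ (-s) *
      (1 + ((1 / ((n + 1 : ℕ) : ℝ) : ℝ) : ℂ)) ^ (-s) := by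
    have e1 : ((n + 2 : ℕ) : ℂ) =
        (((n + 1 : ℕ) : ℝ) : ℂ) * ((1 + 1 / ((n + 1 : ℕ) : ℝ) : ℝ) : ℂ) := by
      have hn' : ((n : ℂ) + 1) ≠ 0 := by exact_mod_cast hn
      push_cast; field_simp; ring
    rw [e1, mul_cpow_ofReal_nonneg (by positivity) (by positivity)]
    push_cast; rfl
  rw [hpow, binomRem]
  have hk : ∀ k : ℕ, ((n + 1 : ℕ) : ℂ) ^ (-(s + k)) =
      ((n + 1 : ℕ) : ℂ) ^ (-s) * (((1 / ((n + 1 : ℕ) : ℝ) : ℝ) : ℂ)) ^ k := by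
    intro k
    rw [neg_add, cpow_add _ _ hn, cpow_neg _ (k : ℂ), cpow_natCast]
    push_cast; rw [one_div, inv_pow]
  simp only [hk]
  rw [mul_sub, Finset.mul_sum]
  have : ∑ k ∈ Finset.range K, negChoose k s * (f (n + 1) * (((n + 1 : ℕ) : ℂ) ^ (-s) *
      (((1 / ((n + 1 : ℕ) : ℝ) : ℝ) : ℂ)) ^ k)) = ∑ k ∈ Finset.range K, f (n + 1) *
      ((n + 1 : ℕ) : ℂ) ^ (-s) * (negChoose k s * (((1 / ((n + 1 : ℕ) : ℝ) : ℝ) : ℂ)) ^ k) :=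
    Finset.sum_congr rfl fun k _ => by ring
  rw [this]
  ring


theorem ContinuesTo.mono {f : ℕ → ℂ} {x y : ℝ} (h : ContinuesTo f x) (hxy : x ≤ y) :
    ContinuesTo f y := by
  obtain ⟨F, hF, B, hB⟩ := h
  exact ⟨F, fun s hs => hF s (lt_of_le_of_lt hxy hs), B, hB⟩

theorem PolyGrowth.mono {f : ℕ → ℂ} {A A' : ℕ} {C C' : ℝ} (h : PolyGrowth f A C) (hA : A ≤ A')
    (hC : C ≤ C') : PolyGrowth f A' C' := by
  refine ⟨h.1.trans hC, fun n hn => (h.2 n hn).trans ?_⟩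
  have : (1 : ℝ) ≤ n := by exact_mod_cast hn
  have h0 := h.1
  have h1 : (n : ℝ) ^ A ≤ (n : ℝ) ^ A' := pow_le_pow_right₀ this hA
  have := h0.trans hC
  gcongr

theorem Continuable.congr {f g : ℕ → ℂ} (h : Continuable f) (hfg : ∀ n, 1 ≤ n → f n = g n) :
    Continuable g := by
  obtain ⟨⟨A, C, hC, hA⟩, h⟩ := h
  refine ⟨⟨A, C, hC, fun n hn => hfg n hn ▸ hA n hn⟩, fun x => ?_⟩
  obtain ⟨F, hF, B, hB⟩ := h x
  refine ⟨F, hF, B, fun s hs => ?_⟩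
  rw [hB s hs]
  exact LSeries_congr (fun {n} hn => hfg n (Nat.one_le_iff_ne_zero.2 hn)) s

theorem Continuable.add {f g : ℕ → ℂ} (hf : Continuable f) (hg : Continuable g) :
    Continuable (fun n => f n + g n) := by
  obtain ⟨⟨A, C, hA⟩, hf⟩ := hf
  obtain ⟨⟨A', C', hA'⟩, hg⟩ := hg
  have h1 := hA.mono (le_max_left A A') le_rfl
  have h2 := hA'.mono (le_max_right A A') le_rfl
  refine ⟨⟨max A A', C + C', add_nonneg hA.1 hA'.1, fun n hn => ?_⟩, fun x => ?_⟩
  · rw [add_mul]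
    exact (norm_add_le _ _).trans (add_le_add (h1.2 n hn) (h2.2 n hn))
  · obtain ⟨F, hF, B, hB⟩ := hf x
    obtain ⟨G, hG, B', hB'⟩ := hg x
    refine ⟨F + G, hF.add hG, max (max B B') ((max A A' : ℕ) + 1), fun s hs => ?_⟩
    simp only [max_lt_iff] at hs
    rw [Pi.add_apply, hB s hs.1.1, hB' s hs.1.2]
    exact (LSeries_add (h1.summable hs.2) (h2.summable hs.2)).symm

theorem Continuable.smul {f : ℕ → ℂ} (c : ℂ) (hf : Continuable f) :
    Continuable (fun n => c * f n) := by
  obtain ⟨⟨A, C, hA⟩, hf⟩ := hf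
  refine ⟨⟨A, ‖c‖ * C, mul_nonneg (norm_nonneg _) hA.1, fun n hn => ?_⟩, fun x => ?_⟩
  · rw [norm_mul, mul_assoc]
    exact mul_le_mul_of_nonneg_left (hA.2 n hn) (norm_nonneg _)
  · obtain ⟨F, hF, B, hB⟩ := hf x
    refine ⟨fun s => c * F s, (MeromorphicOn.const c).mul hF, B, fun s hs => ?_⟩
    simp only [hB s hs]
    exact (LSeries_smul f c s).symm

theorem meromorphicAt_comp_add_const {F : ℂ → ℂ} (c : ℂ) {s : ℂ} (h : MeromorphicAt F (s + c)) :
    MeromorphicAt (fun z => F (z + c)) s :=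
  MeromorphicAt.comp_analyticAt (f := F) (g := fun z => z + c) h
    (analyticAt_id.add analyticAt_const)

theorem Continuable.div {f : ℕ → ℂ} (hf : Continuable f) : Continuable (fun n => f n / n) := by
  obtain ⟨⟨A, C, hA⟩, hf⟩ := hf
  refine ⟨⟨A, C, hA.1, fun n hn => ?_⟩, fun x => ?_⟩
  · rw [norm_div, norm_natCast]
    exact (div_le_self (norm_nonneg _) (by exact_mod_cast hn)).trans (hA.2 n hn)
  · obtain ⟨F, hF, B, hB⟩ := hf x
    refine ⟨fun s => F (s + 1), fun s hs => meromorphicAt_comp_add_const 1 (hF _ ?_), B,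
      fun s hs => ?_⟩
    · have hs' : x < s.re := hs
      simp only [mem_ofPred_eq, add_re, one_re]; linarith
    · simp only
      rw [hB (s + 1) (by simp only [add_re, one_re]; linarith)]
      refine tsum_congr fun n => ?_
      rcases eq_or_ne n 0 with rfl | hn
      · simp
      · have hn' : (n : ℂ) ≠ 0 := Nat.cast_ne_zero.2 hn
        rw [LSeries.term_of_ne_zero hn, LSeries.term_of_ne_zero hn, cpow_add _ _ hn', cpow_one]
        field_simp

theorem continuable_sign {e : ℂ} (he : e = 1 ∨ e = -1) : Continuable (fun n => e ^ n) := by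
  have hb : ∀ n : ℕ, ‖e ^ n‖ ≤ 1 := by
    intro n; rcases he with rfl | rfl <;> simp
  refine ⟨⟨0, 1, zero_le_one, fun n _ => by simpa using hb n⟩, fun x => ?_⟩
  refine ⟨signZeta e, fun s _ => meromorphicAt_signZeta he s, 1, fun s hs => ?_⟩
  refine (hasSum_signZeta he hs).unique ?_
  have hsum : LSeriesSummable (fun n => e ^ n) s :=
    LSeriesSummable_of_bounded_of_one_lt_re (m := 1) (fun n _ => hb n) hs
  refine hsum.LSeriesHasSum.congr_fun fun n => ?_
  rcases eq_or_ne n 0 with rfl | hn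
  · simp [zero_cpow (ne_zero_of_one_lt_re hs)]
  · rw [LSeries.term_of_ne_zero hn]

/-- f(n) is a signed sum of f(1) and of g(2), …, g(n), so summation costs at most one power of n. -/
theorem polyGrowth_of_sub {f g : ℕ → ℂ} {e : ℂ} (he : e = 1 ∨ e = -1) {A : ℕ} {C : ℝ}
    (hg : PolyGrowth g A C) (h : ∀ n, 1 ≤ n → f (n + 1) - e * f n = g (n + 1)) :
    PolyGrowth f (A + 1) (‖f 1‖ + C) := by
  have he1 : ‖e‖ = 1 := by rcases he with rfl | rfl <;> simp
  refine ⟨add_nonneg (norm_nonneg _) hg.1, fun n hn => ?_⟩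
  have key : ‖f n‖ ≤ ‖f 1‖ + C * ((n - 1 : ℕ) : ℝ) * (n : ℝ) ^ A := by
    induction n, hn using Nat.le_induction with
    | base => simp
    | succ n hn ih =>
      have h1 : f (n + 1) = e * f n + g (n + 1) := by rw [← h n hn]; ring
      have h2 := hg.2 (n + 1) (by omega)
      have h3 : ((n - 1 : ℕ) : ℝ) = n - 1 := by rw [Nat.cast_sub hn]; simp
      have h4 : ((n + 1 - 1 : ℕ) : ℝ) = n := by simp
      have h5 : (n : ℝ) ^ A ≤ ((n + 1 : ℕ) : ℝ) ^ A := by gcongr; simp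
      have h6 : (0 : ℝ) ≤ (n : ℝ) - 1 := by
        have : (1 : ℝ) ≤ n := by exact_mod_cast hn
        linarith
      rw [h1, h4]
      rw [h3] at ih
      calc ‖e * f n + g (n + 1)‖ ≤ ‖f n‖ + ‖g (n + 1)‖ := by
            refine (norm_add_le _ _).trans ?_
            rw [norm_mul, he1, one_mul]
        _ ≤ (‖f 1‖ + C * (n - 1) * ((n + 1 : ℕ) : ℝ) ^ A) + C * ((n + 1 : ℕ) : ℝ) ^ A := by
            refine add_le_add (ih.trans ?_) h2
            have := mul_le_mul_of_nonneg_left h5 (mul_nonneg hg.1 h6)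
            linarith
        _ = ‖f 1‖ + C * n * ((n + 1 : ℕ) : ℝ) ^ A := by ring
  have hn1 : (1 : ℝ) ≤ n := by exact_mod_cast hn
  have h3 : ((n - 1 : ℕ) : ℝ) ≤ n := by exact_mod_cast Nat.sub_le n 1
  have h4 : (1 : ℝ) ≤ (n : ℝ) ^ (A + 1) := one_le_pow₀ hn1
  have hC := hg.1
  calc ‖f n‖ ≤ ‖f 1‖ * 1 + C * (n : ℝ) * (n : ℝ) ^ A := by
        rw [mul_one]; refine key.trans ?_; gcongr
    _ ≤ ‖f 1‖ * (n : ℝ) ^ (A + 1) + C * (n : ℝ) * (n : ℝ) ^ A := by gcongr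
    _ = (‖f 1‖ + C) * (n : ℝ) ^ (A + 1) := by ring

/-- The relation between the Dirichlet series of `f` and of its (twisted) differences. -/
theorem LSeries_sub_eq {f g : ℕ → ℂ} {e : ℂ} {A A' : ℕ} {C C' : ℝ}
    (hf : PolyGrowth f A C) (hg : PolyGrowth g A' C')
    (h : ∀ n, 1 ≤ n → f (n + 1) - e * f n = g (n + 1)) (K : ℕ) {s : ℂ}
    (hs : (A : ℝ) + 2 < s.re) (hs' : (A' : ℝ) + 1 < s.re) :
    LSeries g s - g 1 + f 1 = LSeries f s -
      e * (∑ k ∈ Finset.range K, negChoose k s * LSeries f (s + k) + shiftRem f K s) := by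
  have h1 := (hasSum_nat_add_iff' 1).2 (hasSum_LSeries_succ (hg.summable hs'))
  have h2 := (hasSum_nat_add_iff' 1).2
    (hasSum_LSeries_succ (hf.summable (s := s) (by linarith)))
  have h3 := (hf.hasSum_shift K hs).mul_left e
  have h4 := h1.unique ((h2.sub h3).congr_fun fun n => ?_)
  · simp only [Finset.range_one, Finset.sum_singleton, zero_add, Nat.cast_one, one_cpow, mul_one]
      at h4
    linear_combination h4
  · rw [← h (n + 1) (by omega)]; ring

theorem PolyGrowth.meromorphicAt_shiftRem {f : ℕ → ℂ} {A : ℕ} {C : ℝ} (hf : PolyGrowth f A C)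
    {K : ℕ} {s : ℂ} (hs : (A : ℝ) + 2 - K < s.re) : MeromorphicAt (shiftRem f K) s :=
  ((hf.differentiableOn_shiftRem K).analyticAt ((isOpen_halfPlane _).mem_nhds hs)).meromorphicAt

/-- A sequence whose differences `f (n + 1) - e f n` (`e = ±1`) are continuable is continuable. -/
theorem Continuable.of_sub {f g : ℕ → ℂ} {e : ℂ} (he : e = 1 ∨ e = -1) (hg : Continuable g)
    (h : ∀ n, 1 ≤ n → f (n + 1) - e * f n = g (n + 1)) : Continuable f := by
  obtain ⟨⟨A', C', hA'⟩, hg⟩ := hg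
  have hf := polyGrowth_of_sub he hA' h
  set A := A' + 1 with hA
  set C := ‖f 1‖ + C'
  refine ⟨⟨A, C, hf⟩, ?_⟩
  -- Each step gains a strip of width one: the relation expresses the series of `f` at `s` through
  -- its values at s+1, s+2, …, which are already continued.
  have step : ∀ N : ℕ, ContinuesTo f ((A : ℝ) + 1 - N) := by
    intro N
    induction N with
    | zero =>
      refine ⟨LSeries f, fun s hs => (hf.analyticAt ?_).meromorphicAt, 0, fun s _ => rfl⟩
      have hs' : (A : ℝ) + 1 - (0 : ℕ) < s.re := hs
      simpa using hs'
    | succ N ih =>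
      obtain ⟨F, hF, B, hB⟩ := ih
      obtain ⟨G, hG, B', hB'⟩ := hg ((A : ℝ) - 1 - N)
      have hs1 : ∀ s : ℂ, s ∈ {s : ℂ | (A : ℝ) + 1 - ((N + 1 : ℕ) : ℝ) < s.re} →
          (A : ℝ) - N < s.re := by
        intro s hs
        have hs' : (A : ℝ) + 1 - ((N + 1 : ℕ) : ℝ) < s.re := hs
        push_cast at hs'; linarith
      have hnc : ∀ (k : ℕ) (s : ℂ), MeromorphicAt (negChoose k) s := fun k s =>
        ((differentiable_negChoose k).analyticAt s).meromorphicAt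
      have hadd : ∀ (k : ℕ), ∀ s : ℂ, s.re + k = (s + k).re := fun k s => by simp
      have hkk : ∀ (k : ℕ), (0 : ℝ) ≤ k := fun k => k.cast_nonneg
      -- For `e = 1` the relation is used at s-1: the terms of index 0 cancel, the term of index 1
      -- is (s-1) times the series at s, and solving divides by s-1. For `e = -1` the two leading
      -- terms add up to twice the series at s, so no new pole arises. The orders `N + 4` and `N +
      -- 3` make the remainder holomorphic on the new half plane.
      rcases he with rfl | rfl
      · -- `e = 1`
        refine ⟨fun s => (s - 1)⁻¹ * (G (s - 1) - g 1 + f 1 +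
            shiftRem f (N + 4) (s - 1) + ∑ k ∈ Finset.range (N + 2),
            negChoose (k + 2) (s - 1) * F (s + (k + 1 : ℕ))), fun s hs => ?_,
          max (max B B') (max (A + 2) 1) + 1, fun s hs => ?_⟩
        · have hs' := hs1 s hs
          have hsub : AnalyticAt ℂ (fun z : ℂ => z - 1) s := analyticAt_id.sub analyticAt_const
          refine hsub.meromorphicAt.fun_inv.fun_mul (MeromorphicAt.fun_add
            (MeromorphicAt.fun_add (MeromorphicAt.fun_add (MeromorphicAt.fun_sub ?_
              (MeromorphicAt.const _ _)) (MeromorphicAt.const _ _)) ?_)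
            (MeromorphicAt.fun_sum fun k _ => MeromorphicAt.fun_mul ?_ ?_))
          · refine MeromorphicAt.comp_analyticAt (f := G) (hG _ ?_) hsub
            simp only [mem_ofPred_eq, sub_re, one_re]; linarith
          · refine MeromorphicAt.comp_analyticAt (f := shiftRem f (N + 4))
              (hf.meromorphicAt_shiftRem ?_) hsub
            simp only [sub_re, one_re]; push_cast; linarith
          · exact MeromorphicAt.comp_analyticAt (f := negChoose (k + 2)) (hnc _ _) hsub
          · refine meromorphicAt_comp_add_const _ (hF _ ?_)
            have := hkk k
            simp only [mem_ofPred_eq, ← hadd]; push_cast; linarith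
        · have hs2 : max (max B B') (max ((A : ℝ) + 2) 1) < s.re - 1 := by linarith
          simp only [max_lt_iff] at hs2
          obtain ⟨⟨h1, h2⟩, h3, h4⟩ := hs2
          have hA2 : (A' : ℝ) + 1 < (s - 1).re := by
            simp only [hA, Nat.cast_add, Nat.cast_one] at h3
            simp only [sub_re, one_re]; linarith
          have key := LSeries_sub_eq hf hA' h (N + 4) (s := s - 1)
            (by simp only [sub_re, one_re]; linarith) hA2
          have hsne : s - 1 ≠ 0 := by
            intro h0
            have := congrArg Complex.re h0
            simp only [sub_re, one_re, zero_re] at this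
            linarith
          have hB2 : ∀ k : ℕ, F (s + (k + 1 : ℕ)) = LSeries f (s + (k + 1 : ℕ)) := by
            intro k
            refine hB _ ?_
            have := hkk (k + 1)
            rw [← hadd]; linarith
          simp only [hB2]
          rw [hB' (s - 1) (by simpa using h2), key]
          rw [show N + 4 = (N + 2) + 1 + 1 from rfl, Finset.sum_range_succ',
            Finset.sum_range_succ']
          simp only [negChoose, Nat.cast_zero, zero_add, Nat.cast_one, sub_add_cancel, add_zero,
            Nat.cast_add, div_one, mul_one, one_mul]
          have e1 : ∀ k : ℕ, s - 1 + ((k : ℂ) + 1 + 1) = s + ((k : ℂ) + 1) := fun k => by ring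
          simp only [e1]
          field_simp
          ring
      · -- `e = -1`
        refine ⟨fun s => 2⁻¹ * (G s - g 1 + f 1 -
            (shiftRem f (N + 3) s + ∑ k ∈ Finset.range (N + 2),
            negChoose (k + 1) s * F (s + (k + 1 : ℕ)))), fun s hs => ?_,
          max (max B B') (A + 2), fun s hs => ?_⟩
        · have hs' := hs1 s hs
          refine (MeromorphicAt.const _ _).fun_mul (MeromorphicAt.fun_sub
            (MeromorphicAt.fun_add (MeromorphicAt.fun_sub (hG _ ?_)
              (MeromorphicAt.const _ _)) (MeromorphicAt.const _ _))
            (MeromorphicAt.fun_add (hf.meromorphicAt_shiftRem ?_)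
            (MeromorphicAt.fun_sum fun k _ => MeromorphicAt.fun_mul (hnc _ _) ?_)))
          · simp only [mem_ofPred_eq]; linarith
          · push_cast; linarith
          · refine meromorphicAt_comp_add_const _ (hF _ ?_)
            have := hkk k
            simp only [mem_ofPred_eq, ← hadd]; push_cast; linarith
        · simp only [max_lt_iff] at hs
          obtain ⟨⟨h1, h2⟩, h3⟩ := hs
          have hA2 : (A' : ℝ) + 1 < s.re := by
            simp only [hA, Nat.cast_add, Nat.cast_one] at h3
            linarith
          have key := LSeries_sub_eq hf hA' h (N + 3) h3 hA2
          have hB2 : ∀ k : ℕ, F (s + (k + 1 : ℕ)) = LSeries f (s + (k + 1 : ℕ)) := by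
            intro k
            refine hB _ ?_
            have := hkk (k + 1)
            rw [← hadd]; linarith
          simp only [hB2]
          rw [hB' s h2, key, show N + 3 = (N + 2) + 1 from rfl, Finset.sum_range_succ']
          simp only [Nat.cast_zero, add_zero, Nat.cast_add]
          rw [show negChoose 0 s = 1 from rfl]
          ring
  intro x
  obtain ⟨N, hN⟩ := exists_nat_ge ((A : ℝ) + 1 - x)
  exact (step N).mono (by linarith)


/-! ### Harmonic sequences -/

/-- The sequences obtained from constants by linear combinations, signs `(-1) ^ n`, division by `n`
and summation. Values at `0` are irrelevant. -/
inductive Harm : (ℕ → ℂ) → Prop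
  | one : Harm fun _ => 1
  | add {f g : ℕ → ℂ} : Harm f → Harm g → Harm fun n => f n + g n
  | smul {f : ℕ → ℂ} (c : ℂ) : Harm f → Harm fun n => c * f n
  | sgn {f : ℕ → ℂ} : Harm f → Harm fun n => (-1) ^ n * f n
  | div {f : ℕ → ℂ} : Harm f → Harm fun n => f n / n
  | anti {f g : ℕ → ℂ} : Harm g → (∀ n, 1 ≤ n → f (n + 1) - f n = g (n + 1)) → Harm f
  | congr {f g : ℕ → ℂ} : Harm f → (∀ n, 1 ≤ n → f n = g n) → Harm g

namespace Harm

variable {f g : ℕ → ℂ}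

theorem const (c : ℂ) : Harm fun _ => c := (one.smul c).congr fun _ _ => mul_one c

theorem neg (hf : Harm f) : Harm fun n => -f n := (hf.smul (-1)).congr fun _ _ => neg_one_mul _

theorem sub (hf : Harm f) (hg : Harm g) : Harm fun n => f n - g n :=
  (hf.add hg.neg).congr fun _ _ => (sub_eq_add_neg _ _).symm

theorem sgn_sgn (f : ℕ → ℂ) (n : ℕ) : (-1 : ℂ) ^ n * ((-1) ^ n * f n) = f n := by
  rw [← mul_assoc, ← mul_pow]; norm_num

/-- Induction on both factors. All generators but summation pass through the product directly; two
summatory sequences are handled by the discrete Leibniz rule. -/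
theorem mul (hf : Harm f) : ∀ {g : ℕ → ℂ}, Harm g → Harm fun n => f n * g n := by
  induction hf with
  | one => exact fun hg => hg.congr fun _ _ => (one_mul _).symm
  | add _ _ ih1 ih2 => exact fun hg => ((ih1 hg).add (ih2 hg)).congr fun _ _ => (add_mul _ _ _).symm
  | smul c _ ih => exact fun hg => ((ih hg).smul c).congr fun _ _ => (mul_assoc _ _ _).symm
  | sgn _ ih => exact fun hg => (ih hg).sgn.congr fun _ _ => (mul_assoc _ _ _).symm
  | div _ ih => exact fun hg => (ih hg).div.congr fun _ _ => (div_mul_eq_mul_div _ _ _).symm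
  | congr _ h ih => exact fun hg => (ih hg).congr fun n hn => by rw [h n hn]
  | @anti f φ hφ h ih =>
    intro g hg
    have hf : Harm f := hφ.anti h
    induction hg with
    | one => exact hf.congr fun _ _ => (mul_one _).symm
    | add _ _ ih1 ih2 => exact (ih1.add ih2).congr fun _ _ => (mul_add _ _ _).symm
    | smul c _ ih => exact (ih.smul c).congr fun _ _ => mul_left_comm _ _ _
    | sgn _ ih => exact ih.sgn.congr fun _ _ => mul_left_comm _ _ _
    | div _ ih => exact ih.div.congr fun _ _ => mul_div_assoc _ _ _
    | congr _ h ih => exact ih.congr fun n hn => by rw [h n hn]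
    | @anti g ψ hψ h' ih' =>
      -- With φ, ψ the differences of f, g, the difference of f g is f ψ + φ g - φ ψ, all taken at
      -- the upper index.
      refine anti ((ih'.add (ih (hψ.anti h'))).sub (ih hψ)) fun n hn => ?_
      have h1 := h n hn
      have h2 := h' n hn
      rw [← h1, ← h2]; ring

theorem divPow (hf : Harm f) (k : ℕ) : Harm fun n => f n / (n : ℂ) ^ k := by
  induction k with
  | zero => exact hf.congr fun _ _ => by simp
  | succ k ih => exact ih.div.congr fun _ _ => by rw [pow_succ, div_div]

/-- Multiplication by a power of a sign. -/
theorem sign (hf : Harm f) {e : ℂ} (he : e = 1 ∨ e = -1) : Harm fun n => e ^ n * f n := by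
  rcases he with rfl | rfl
  · exact hf.congr fun _ _ => by simp
  · exact hf.sgn

theorem of_sub {e : ℂ} (he : e = 1 ∨ e = -1) (hg : Harm g)
    (h : ∀ n, 1 ≤ n → f (n + 1) - e * f n = g (n + 1)) : Harm f := by
  have hee : e * e = 1 := by rcases he with rfl | rfl <;> norm_num
  have h1 : Harm fun n => e ^ n * f n := by
    refine (hg.sign he).anti fun n hn => ?_
    rw [← h n hn]
    rw [pow_succ]
    linear_combination (e ^ n * f n) * hee
  refine (h1.sign he).congr fun n _ => ?_
  rw [← mul_assoc, ← mul_pow, hee, one_pow, one_mul]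

theorem sum_Icc (hf : Harm f) : Harm fun n => ∑ k ∈ Finset.Icc 1 n, f k := by
  refine hf.anti fun n _ => ?_
  rw [Finset.sum_Icc_succ_top (by omega)]; ring

theorem sum_Ico (hf : Harm f) : Harm fun n => ∑ k ∈ Finset.Ico 1 n, f k := by
  refine (hf.sum_Icc.sub hf).congr fun n hn => ?_
  have : Finset.Icc 1 n = Finset.Ico 1 (n + 1) := by ext; simp; try omega
  rw [this, Finset.sum_Ico_succ_top hn]; ring

/-- The twisted sequence has to be carried along because the generator `sgn` exchanges the two. A
summation step is `Continuable.of_sub` with `e = 1` for the sequence and `e = -1` for its twist. -/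
theorem continuable (hf : Harm f) : Continuable f ∧ Continuable fun n => (-1) ^ n * f n := by
  induction hf with
  | one =>
    exact ⟨(continuable_sign (Or.inl rfl)).congr fun _ _ => one_pow _,
      (continuable_sign (Or.inr rfl)).congr fun _ _ => (mul_one _).symm⟩
  | add _ _ ih1 ih2 =>
    exact ⟨ih1.1.add ih2.1, (ih1.2.add ih2.2).congr fun _ _ => (mul_add _ _ _).symm⟩
  | smul c _ ih => exact ⟨ih.1.smul c, (ih.2.smul c).congr fun _ _ => mul_left_comm _ _ _⟩
  | @sgn f _ ih => exact ⟨ih.2, ih.1.congr fun n _ => (sgn_sgn f n).symm⟩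
  | div _ ih => exact ⟨ih.1.div, ih.2.div.congr fun _ _ => mul_div_assoc _ _ _⟩
  | congr _ h ih =>
    exact ⟨ih.1.congr h, ih.2.congr fun n hn => by rw [h n hn]⟩
  | @anti f g _ h ih =>
    refine ⟨ih.1.of_sub (Or.inl rfl) fun n hn => by rw [one_mul]; exact h n hn,
      ih.2.of_sub (Or.inr rfl) fun n hn => ?_⟩
    rw [← h n hn, pow_succ]; ring

/-! ### Convolution -/

/-- The additive convolution `∑ f a g b` over `a + b = N`, `a, b ≥ 1`. -/
def conv (f g : ℕ → ℂ) (N : ℕ) : ℂ := ∑ a ∈ Finset.Ico 1 N, f a * g (N - a)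

theorem conv_comm (f g : ℕ → ℂ) (N : ℕ) : conv f g N = conv g f N := by
  refine Finset.sum_nbij' (fun a => N - a) (fun a => N - a) ?_ ?_ ?_ ?_ ?_
  · intro a ha; simp only [Finset.mem_Ico] at ha ⊢; omega
  · intro a ha; simp only [Finset.mem_Ico] at ha ⊢; omega
  · intro a ha; simp only [Finset.mem_Ico] at ha; omega
  · intro a ha; simp only [Finset.mem_Ico] at ha; omega
  · intro a ha
    simp only [Finset.mem_Ico] at ha
    rw [show N - (N - a) = a by omega, mul_comm]

theorem conv_congr {f f' g g' : ℕ → ℂ} (hf : ∀ n, 1 ≤ n → f n = f' n)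
    (hg : ∀ n, 1 ≤ n → g n = g' n) (N : ℕ) : conv f g N = conv f' g' N := by
  refine Finset.sum_congr rfl fun a ha => ?_
  simp only [Finset.mem_Ico] at ha
  rw [hf a ha.1, hg (N - a) (by omega)]

theorem conv_sgn_right (f g : ℕ → ℂ) (N : ℕ) :
    conv f (fun n => (-1) ^ n * g n) N = (-1) ^ N * conv (fun n => (-1) ^ n * f n) g N := by
  rw [conv, conv, Finset.mul_sum]
  refine Finset.sum_congr rfl fun a ha => ?_
  simp only [Finset.mem_Ico] at ha
  have : (-1 : ℂ) ^ N = (-1) ^ (N - a) * (-1) ^ a := by rw [← pow_add]; congr 1; omega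
  rw [this]
  have h2 := sgn_sgn f a
  linear_combination (-(-1) ^ (N - a) * g (N - a)) * h2

theorem conv_add_right (f g h : ℕ → ℂ) (N : ℕ) :
    conv f (fun n => g n + h n) N = conv f g N + conv f h N := by
  rw [conv, conv, conv, ← Finset.sum_add_distrib]
  exact Finset.sum_congr rfl fun a _ => mul_add _ _ _

theorem conv_smul_right (c : ℂ) (f g : ℕ → ℂ) (N : ℕ) :
    conv f (fun n => c * g n) N = c * conv f g N := by
  rw [conv, conv, Finset.mul_sum]
  exact Finset.sum_congr rfl fun a _ => mul_left_comm _ _ _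

theorem conv_one (f : ℕ → ℂ) (N : ℕ) : conv f (fun _ => 1) N = ∑ k ∈ Finset.Ico 1 N, f k := by
  simp [conv]

theorem conv_one_harm (hf : Harm f) : Harm (conv f fun _ => 1) :=
  hf.sum_Ico.congr fun n _ => (conv_one f n).symm

/-- Convolution with a summatory sequence. -/
theorem conv_anti {f g ψ : ℕ → ℂ} (h : ∀ n, 1 ≤ n → g (n + 1) - g n = ψ (n + 1))
    (hf : Harm (conv f fun _ => 1)) (hψ : Harm (conv f ψ)) : Harm (conv f g) := by
  -- Subtracting this constant makes the first values of g and ψ agree, so that the boundary term in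
  -- the difference of the convolution is exactly the missing last term of the convolution with ψ.
  set c := g 1 - ψ 1 with hc
  have h0 : Harm (conv f fun n => g n + -c * 1) := by
    refine hψ.anti fun N hN => ?_
    rw [conv, conv, conv, Finset.sum_Ico_succ_top hN, Finset.sum_Ico_succ_top hN, add_sub_right_comm,
      ← Finset.sum_sub_distrib]
    congr 1
    · refine Finset.sum_congr rfl fun a ha => ?_
      simp only [Finset.mem_Ico] at ha
      have := h (N - a) (by omega)
      rw [show N + 1 - a = N - a + 1 by omega, ← this]; ring
    · rw [show N + 1 - N = 1 by omega]
      simp only [hc]; ring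
  refine (h0.add (hf.smul c)).congr fun N _ => ?_
  rw [conv_add_right, conv_smul_right]; ring

/-- Induction on both sequences. Signs move across the convolution, summation is peeled off by
`conv_anti`, and two divisions are resolved by 1/(a b) = (1/a + 1/b)/N for a + b = N. -/
theorem conv_harm (hf : Harm f) : ∀ {g : ℕ → ℂ}, Harm g → Harm (conv f g) := by
  induction hf with
  | one => exact fun hg => (conv_one_harm hg).congr fun N _ => conv_comm _ _ N
  | @add f1 f2 _ _ ih1 ih2 =>
    intro g hg
    refine ((ih1 hg).add (ih2 hg)).congr fun N _ => ?_
    rw [conv_comm _ g N, conv_comm _ g N, conv_comm _ g N, conv_add_right]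
  | @smul f c _ ih =>
    intro g hg
    refine ((ih hg).smul c).congr fun N _ => ?_
    rw [conv_comm _ g N, conv_comm _ g N, conv_smul_right]
  | @sgn f _ ih =>
    intro g hg
    refine (ih hg.sgn).sgn.congr fun N _ => ?_
    rw [conv_sgn_right, sgn_sgn (conv (fun n => (-1) ^ n * f n) g)]
  | @anti f φ hφ h ih =>
    intro g hg
    refine (conv_anti (f := g) h (conv_one_harm hg) ?_).congr fun N _ => conv_comm _ _ N
    exact (ih hg).congr fun N _ => conv_comm _ _ N
  | congr _ h ih =>
    exact fun hg => (ih hg).congr fun N _ => conv_congr h (fun _ _ => rfl) N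
  | @div φ hφ ihφ =>
    intro g hg
    -- φ is generalised because the sign case of the inner induction replaces it by its twist.
    have key : ∀ φ : ℕ → ℂ, Harm φ → (∀ {g : ℕ → ℂ}, Harm g → Harm (conv φ g)) →
        Harm (conv (fun n => φ n / n) g) := by
      clear hφ ihφ φ
      induction hg with
      | one => exact fun φ hφ _ => conv_one_harm hφ.div
      | add _ _ ih1 ih2 =>
        exact fun φ hφ P => ((ih1 φ hφ P).add (ih2 φ hφ P)).congr fun N _ =>
          (conv_add_right _ _ _ N).symm
      | smul c _ ih =>
        exact fun φ hφ P => ((ih φ hφ P).smul c).congr fun N _ => (conv_smul_right _ _ _ N).symm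
      | @sgn g _ ih =>
        intro φ hφ P
        have := (ih (fun n => (-1) ^ n * φ n) hφ.sgn fun {g'} hg' =>
          (P hg'.sgn).sgn.congr fun N _ => by
            rw [conv_sgn_right, sgn_sgn (fun N => conv (fun n => (-1) ^ n * φ n) g' N)]).sgn
        refine this.congr fun N _ => ?_
        rw [conv_sgn_right]
        congr 1
        exact conv_congr (fun n _ => mul_div_assoc _ _ _) (fun _ _ => rfl) N
      | @anti g ψ _ h ih =>
        exact fun φ hφ P => conv_anti h (conv_one_harm hφ.div) (ih φ hφ P)
      | congr _ h ih =>
        exact fun φ hφ P => (ih φ hφ P).congr fun N _ => conv_congr (fun _ _ => rfl) h N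
      | @div ψ hψ ih =>
        intro φ hφ P
        refine ((P hψ.div).add (ih φ hφ P)).div.congr fun N hN => ?_
        rw [conv, conv, conv, ← Finset.sum_add_distrib, Finset.sum_div]
        refine Finset.sum_congr rfl fun a ha => ?_
        simp only [Finset.mem_Ico] at ha
        have h1 : (a : ℂ) ≠ 0 := Nat.cast_ne_zero.2 (by omega)
        have h2 : ((N - a : ℕ) : ℂ) ≠ 0 := Nat.cast_ne_zero.2 (by omega)
        have h3 : (N : ℂ) ≠ 0 := Nat.cast_ne_zero.2 (by omega)
        have h4 : (N : ℂ) = a + (N - a : ℕ) := by rw [← Nat.cast_add]; congr 1; omega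
        field_simp
        rw [h4]
    exact key φ hφ ihφ

end Harm


/-! ### Alternating sums -/

/-- The alternating series `∑_{n ≥ 1} (-1) ^ n f n` converges to `S`. -/
def HasAltSum (f : ℕ → ℂ) (S : ℂ) : Prop :=
  Tendsto (fun N => ∑ n ∈ Finset.range N, (-1 : ℂ) ^ (n + 1) * f (n + 1)) atTop (𝓝 S)

namespace HasAltSum

variable {f g : ℕ → ℂ} {S S' : ℂ}

theorem unique (h : HasAltSum f S) (h' : HasAltSum f S') : S = S' := tendsto_nhds_unique h h'

theorem smul (c : ℂ) (h : HasAltSum f S) : HasAltSum (fun n => c * f n) (c * S) := by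
  refine (Tendsto.const_mul c h).congr fun N => ?_
  rw [Finset.mul_sum]
  exact Finset.sum_congr rfl fun _ _ => mul_left_comm _ _ _

theorem sub (h : HasAltSum f S) (h' : HasAltSum g S') : HasAltSum (fun n => f n - g n) (S - S') := by
  refine (Tendsto.sub h h').congr fun N => ?_
  rw [← Finset.sum_sub_distrib]
  exact Finset.sum_congr rfl fun _ _ => (mul_sub _ _ _).symm

theorem congr (h : HasAltSum f S) (hfg : ∀ n, 1 ≤ n → f n = g n) : HasAltSum g S := by
  refine Tendsto.congr (fun N => ?_) h
  exact Finset.sum_congr rfl fun n _ => by rw [hfg (n + 1) (by omega)]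

theorem of_hasSum (h : HasSum (fun n => (-1 : ℂ) ^ (n + 1) * f (n + 1)) S) : HasAltSum f S :=
  h.tendsto_sum_nat

end HasAltSum

/-- The sum `∑_{n ≥ 1} (-1) ^ n / (x + n) ^ i`. -/
noncomputable def altTail (i x : ℕ) : ℂ :=
  limUnder atTop fun N => ∑ n ∈ Finset.range N, (-1 : ℂ) ^ (n + 1) * (1 / ((x + (n + 1) : ℕ) : ℂ) ^ i)

/-- Leibniz's criterion, with the sum bounded by the first term. For `i = 1` the convergence is only
conditional, hence limits of partial sums. -/
theorem exists_hasAltSum {i : ℕ} (hi : 1 ≤ i) (x : ℕ) :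
    ∃ S : ℝ, HasAltSum (fun n => 1 / ((x + n : ℕ) : ℂ) ^ i) S ∧ |S| ≤ 1 / ((x + 1 : ℕ) : ℝ) ^ i := by
  set f : ℕ → ℝ := fun n => 1 / ((x + (n + 1) : ℕ) : ℝ) ^ i with hf
  have hfa : Antitone f := by
    intro m n hmn
    simp only [hf]
    gcongr
  have hf0 : Tendsto f atTop (𝓝 0) := by
    have h1 : Tendsto (fun n : ℕ => (1 / (n : ℝ)) ^ i) atTop (𝓝 0) := by
      simpa [show i ≠ 0 by omega] using (tendsto_one_div_atTop_nhds_zero_nat (𝕜 := ℝ)).pow i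
    have h2 := h1.comp (tendsto_add_atTop_nat (x + 1))
    refine h2.congr fun n => ?_
    simp only [hf, Function.comp, one_div, inv_pow]
    congr 3; omega
  obtain ⟨l, hl⟩ := hfa.tendsto_alternating_series_of_tendsto_zero hf0
  have h0 := hfa.alternating_series_le_tendsto hl 0
  have h1 := hfa.tendsto_le_alternating_series hl 0
  simp only [mul_zero, Finset.range_zero, Finset.sum_empty, zero_add, Finset.range_one,
    Finset.sum_singleton, pow_zero, one_mul] at h0 h1
  refine ⟨-l, ?_, ?_⟩
  · have h2 := ((continuous_ofReal.tendsto _).comp hl).neg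
    rw [HasAltSum]
    push_cast
    refine h2.congr fun N => ?_
    simp only [Function.comp, hf]
    push_cast
    rw [← Finset.sum_neg_distrib]
    refine Finset.sum_congr rfl fun n _ => ?_
    rw [pow_succ]; ring
  · rw [abs_neg, abs_of_nonneg h0]
    simpa [hf] using h1

theorem hasAltSum_altTail {i : ℕ} (hi : 1 ≤ i) (x : ℕ) :
    HasAltSum (fun n => 1 / ((x + n : ℕ) : ℂ) ^ i) (altTail i x) := by
  obtain ⟨S, hS, -⟩ := exists_hasAltSum hi x
  exact tendsto_nhds_limUnder ⟨(S : ℂ), hS⟩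

theorem norm_altTail_le {i : ℕ} (hi : 1 ≤ i) (x : ℕ) : ‖altTail i x‖ ≤ 1 / ((x + 1 : ℕ) : ℝ) := by
  obtain ⟨S, hS, hb⟩ := exists_hasAltSum hi x
  rw [(hasAltSum_altTail hi x).unique hS, norm_real, Real.norm_eq_abs]
  refine hb.trans (one_div_le_one_div_of_le (by positivity) ?_)
  exact le_self_pow₀ (by simp) (by omega)

/-- Shifting x by one reverses all signs and drops the first term. This two-term recursion makes
`altTail` harmonic and drives all later manipulations with it. -/
theorem altTail_succ {i : ℕ} (hi : 1 ≤ i) (x : ℕ) :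
    altTail i (x + 1) + altTail i x = -(1 / ((x + 1 : ℕ) : ℂ) ^ i) := by
  have h1 := hasAltSum_altTail hi (x + 1)
  have h2 := (tendsto_add_atTop_iff_nat 1).2 (hasAltSum_altTail hi x)
  refine tendsto_nhds_unique (Tendsto.add h1 h2) (tendsto_const_nhds.congr fun N => ?_)
  rw [Finset.sum_range_succ' _ N, ← add_assoc, ← Finset.sum_add_distrib, Finset.sum_eq_zero]
  · simp
  · intro n _
    simp only
    rw [show x + 1 + (n + 1) = x + (n + 1 + 1) by omega, pow_succ]; ring

theorem harm_altTail {i : ℕ} (hi : 1 ≤ i) : Harm (altTail i) := by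
  refine Harm.of_sub (g := fun n => -(1 / (n : ℂ) ^ i)) (Or.inr rfl) (Harm.one.divPow i).neg
    fun n _ => ?_
  rw [← altTail_succ hi n]; ring

/-! ### Infinite sums -/

/-- The sum `∑_{m ≥ 1} W l m / (m ^ q (l + m) ^ u)`. -/
noncomputable def corr (W : ℕ → ℕ → ℂ) (q u l : ℕ) : ℂ :=
  ∑' m : ℕ, W l (m + 1) / (((m + 1 : ℕ) : ℂ) ^ q * ((l + (m + 1) : ℕ) : ℂ) ^ u)

theorem summable_corr {W : ℕ → ℕ → ℂ} {q u l d : ℕ} {C : ℝ}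
    (hW : ∀ m, 1 ≤ m → ‖W l m‖ ≤ C / (m : ℝ) ^ d) (h : 2 ≤ q + u + d) :
    Summable fun m : ℕ => W l (m + 1) / (((m + 1 : ℕ) : ℂ) ^ q * ((l + (m + 1) : ℕ) : ℂ) ^ u) := by
  have hC : 0 ≤ C := by simpa using (norm_nonneg _).trans (hW 1 le_rfl)
  refine Summable.of_norm_bounded (summable_one_div_succ_sq.mul_left C) fun m => ?_
  have h1 := hW (m + 1) (by omega)
  have h0 : (0 : ℝ) < ((m + 1 : ℕ) : ℝ) := by positivity
  have h2 : ((m + 1 : ℕ) : ℝ) ≤ ((l + (m + 1) : ℕ) : ℝ) := by exact_mod_cast Nat.le_add_left _ _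
  have h3 : ((m + 1 : ℕ) : ℝ) ^ 2 ≤ ((m + 1 : ℕ) : ℝ) ^ d * (((m + 1 : ℕ) : ℝ) ^ q *
      ((l + (m + 1) : ℕ) : ℝ) ^ u) := by
    calc ((m + 1 : ℕ) : ℝ) ^ 2 ≤ ((m + 1 : ℕ) : ℝ) ^ (q + u + d) :=
          pow_le_pow_right₀ (by simp) h
      _ = ((m + 1 : ℕ) : ℝ) ^ d * (((m + 1 : ℕ) : ℝ) ^ q * ((m + 1 : ℕ) : ℝ) ^ u) := by ring
      _ ≤ _ := by gcongr
  rw [norm_div, norm_mul, norm_pow, norm_pow, norm_natCast, norm_natCast]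
  calc _ ≤ C / ((m + 1 : ℕ) : ℝ) ^ d / (((m + 1 : ℕ) : ℝ) ^ q * ((l + (m + 1) : ℕ) : ℝ) ^ u) := by
        gcongr
    _ = C * (1 / (((m + 1 : ℕ) : ℝ) ^ d * (((m + 1 : ℕ) : ℝ) ^ q *
      ((l + (m + 1) : ℕ) : ℝ) ^ u))) := by rw [div_div, mul_one_div]
    _ ≤ _ := by gcongr

theorem corr_term_mul (w : ℂ) (q u l m : ℕ) :
    (l : ℂ) * (w / (((m + 1 : ℕ) : ℂ) ^ (q + 1) * ((l + (m + 1) : ℕ) : ℂ) ^ (u + 1))) =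
      w / (((m + 1 : ℕ) : ℂ) ^ (q + 1) * ((l + (m + 1) : ℕ) : ℂ) ^ u) -
      w / (((m + 1 : ℕ) : ℂ) ^ q * ((l + (m + 1) : ℕ) : ℂ) ^ (u + 1)) := by
  have h1 : ((m + 1 : ℕ) : ℂ) ≠ 0 := Nat.cast_ne_zero.2 (by omega)
  have h2 : ((l + (m + 1) : ℕ) : ℂ) ≠ 0 := Nat.cast_ne_zero.2 (by omega)
  have h3 : (l : ℂ) = ((l + (m + 1) : ℕ) : ℂ) - ((m + 1 : ℕ) : ℂ) := by push_cast; ring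
  rw [h3]
  field_simp
  ring

/-- Multiplication by `l` lowers the weight. -/
theorem corr_mul {W : ℕ → ℕ → ℂ} {q u l d : ℕ} {C : ℝ}
    (hW : ∀ m, 1 ≤ m → ‖W l m‖ ≤ C / (m : ℝ) ^ d) (h : 2 ≤ q + u + 1 + d) :
    (l : ℂ) * corr W (q + 1) (u + 1) l = corr W (q + 1) u l - corr W q (u + 1) l := by
  rw [corr, ← tsum_mul_left, corr, corr, ← (summable_corr (q := q + 1) (u := u) hW
    (by omega)).tsum_sub (summable_corr (q := q) (u := u + 1) hW (by omega))]
  exact tsum_congr fun m => corr_term_mul _ _ _ _ _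

theorem harm_of_mul {f g : ℕ → ℂ} (hg : Harm g) (h : ∀ l : ℕ, 1 ≤ l → (l : ℂ) * f l = g l) :
    Harm f := by
  refine hg.div.congr fun l hl => ?_
  have : (l : ℂ) ≠ 0 := Nat.cast_ne_zero.2 (by omega)
  rw [← h l hl]
  field_simp

/-- Multiplying by l = (l+m) - m lowers one of the two exponents. For merely bounded weights the
descent has to stop at (1, 1), since the series with exponents (1, 0) and (0, 1) may diverge. -/
theorem harm_corr_of_base {W : ℕ → ℕ → ℂ} {C : ℝ} (hW : ∀ l m, 1 ≤ m → ‖W l m‖ ≤ C)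
    (h0 : ∀ u, 2 ≤ u → Harm (corr W 0 u)) (h0' : ∀ q, 2 ≤ q → Harm (corr W q 0))
    (h1 : Harm (corr W 1 1)) (N : ℕ) : ∀ q u, q + u = N → 2 ≤ q + u → Harm (corr W q u) := by
  have hW' : ∀ l m, 1 ≤ m → ‖W l m‖ ≤ C / (m : ℝ) ^ 0 := by simpa using hW
  induction N with
  | zero => intro q u h h'; omega
  | succ N ih =>
    intro q u hN h2
    rcases q with _ | q
    · exact h0 u (by omega)
    rcases u with _ | u
    · exact h0' (q + 1) (by omega)
    by_cases hqu : q = 0 ∧ u = 0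
    · rw [hqu.1, hqu.2]; exact h1
    · refine harm_of_mul ((ih (q + 1) u (by omega) (by omega)).sub
        (ih q (u + 1) (by omega) (by omega))) fun l _ => corr_mul (hW' l) (by omega)

/-- The decay 1/m of the weight makes the exponents (1, 0) and (0, 1) convergent, so that (1, 1) can
be reduced as well. -/
theorem harm_corr_of_decay {W : ℕ → ℕ → ℂ} (hW : ∀ l m, 1 ≤ m → ‖W l m‖ ≤ 1 / (m : ℝ))
    (h0 : ∀ u, 1 ≤ u → Harm (corr W 0 u)) (h0' : ∀ q, 1 ≤ q → Harm (corr W q 0))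
    {q u : ℕ} (h : 2 ≤ q + u) : Harm (corr W q u) := by
  have hW' : ∀ l m, 1 ≤ m → ‖W l m‖ ≤ 1 / (m : ℝ) ^ 1 := by simpa using hW
  refine harm_corr_of_base (C := 1) (fun l m hm => (hW l m hm).trans ?_)
    (fun u hu => h0 u (by omega)) (fun q hq => h0' q (by omega)) ?_ _ q u rfl h
  · rw [div_le_one (by exact_mod_cast hm)]; exact_mod_cast hm
  · exact harm_of_mul ((h0' 1 le_rfl).sub (h0 1 le_rfl)) fun l _ => corr_mul (hW' l) (by omega)

/-- In the variable k = l + m this is a tail over k > l; passing from l to l+1 removes one term and,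
up to the sign `e`, changes nothing else. -/
theorem harm_corr_zero_left {Y : ℕ → ℂ} (hY : Harm Y) {e : ℂ} (he : e = 1 ∨ e = -1) {u : ℕ}
    (hs : ∀ l : ℕ, Summable fun m : ℕ => e ^ (m + 1) * Y (l + (m + 1)) /
      (((m + 1 : ℕ) : ℂ) ^ 0 * ((l + (m + 1) : ℕ) : ℂ) ^ u)) :
    Harm (corr (fun l m => e ^ m * Y (l + m)) 0 u) := by
  have hee : e * e = 1 := by rcases he with rfl | rfl <;> norm_num
  refine Harm.of_sub he (hY.divPow u).neg fun l _ => ?_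
  rw [corr, corr, (hs l).tsum_eq_zero_add, mul_add, ← tsum_mul_left]
  have : ∀ m : ℕ, e * (e ^ (m + 1 + 1) * Y (l + (m + 1 + 1)) /
      (((m + 1 + 1 : ℕ) : ℂ) ^ 0 * ((l + (m + 1 + 1) : ℕ) : ℂ) ^ u)) =
      e ^ (m + 1) * Y (l + 1 + (m + 1)) /
      (((m + 1 : ℕ) : ℂ) ^ 0 * ((l + 1 + (m + 1) : ℕ) : ℂ) ^ u) := by
    intro m
    rw [show l + (m + 1 + 1) = l + 1 + (m + 1) by omega, pow_succ e (m + 1)]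
    simp only [pow_zero, one_mul]
    rw [← mul_div_assoc]
    congr 1
    linear_combination (e ^ (m + 1) * Y (l + 1 + (m + 1))) * hee
  rw [tsum_congr this]
  simp only [zero_add, pow_one, pow_zero, one_mul]
  rw [← mul_div_assoc, ← mul_assoc, hee]
  ring

theorem harm_corr_zero_right {W : ℕ → ℂ} (q : ℕ) : Harm (corr (fun _ m => W m) q 0) :=
  (Harm.const (∑' m : ℕ, W (m + 1) / ((m + 1 : ℕ) : ℂ) ^ q)).congr fun l _ => by
    simp [corr]

/-- Times l, the summand is e^m (1/m - 1/(l+m)). For `e = 1` the sum is a harmonic number, obtained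
by telescoping its difference in l; for `e = -1` it is a difference of two alternating tails. -/
theorem harm_corr_sign_one_one {e : ℂ} (he : e = 1 ∨ e = -1) :
    Harm (corr (fun _ m => e ^ m) 1 1) := by
  have hb : ∀ (l m : ℕ), 1 ≤ m → ‖(fun _ m => e ^ m : ℕ → ℕ → ℂ) l m‖ ≤ 1 / (m : ℝ) ^ 0 := by
    intro _ m _; rcases he with rfl | rfl <;> simp
  have hs : ∀ l : ℕ, HasSum (fun m : ℕ => e ^ (m + 1) * (1 / ((m + 1 : ℕ) : ℂ) -
      1 / ((l + (m + 1) : ℕ) : ℂ))) ((l : ℂ) * corr (fun _ m => e ^ m) 1 1 l) := by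
    intro l
    have h := (summable_corr (W := fun _ m => e ^ m) (l := l) (q := 1) (u := 1) (hb l) (by omega)).hasSum.mul_left (l : ℂ)
    refine h.congr_fun fun m => ?_
    have := corr_term_mul (e ^ (m + 1)) 0 0 l m
    simp only [zero_add] at this
    rw [this]; simp only [pow_one, pow_zero, mul_one, one_mul]; ring
  rcases he with rfl | rfl
  · refine harm_of_mul (g := fun l => (l : ℂ) * corr (fun _ m => 1 ^ m) 1 1 l) ?_ fun _ _ => rfl
    refine (Harm.one.div).anti fun l _ => ?_
    have h1 := ((hs (l + 1)).sub (hs l)).tendsto_sum_nat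
    refine tendsto_nhds_unique h1 ?_
    have h2 : ∀ N : ℕ, ∑ m ∈ Finset.range N, ((1 : ℂ) ^ (m + 1) * (1 / ((m + 1 : ℕ) : ℂ) -
        1 / ((l + 1 + (m + 1) : ℕ) : ℂ)) - (1 : ℂ) ^ (m + 1) * (1 / ((m + 1 : ℕ) : ℂ) -
        1 / ((l + (m + 1) : ℕ) : ℂ))) = 1 / ((l + 1 : ℕ) : ℂ) - 1 / ((N + (l + 1) : ℕ) : ℂ) := by
      intro N
      have := Finset.sum_range_sub' (fun m => 1 / ((m + (l + 1) : ℕ) : ℂ)) N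
      simp only [zero_add] at this
      rw [← this]
      refine Finset.sum_congr rfl fun m _ => ?_
      rw [show l + 1 + (m + 1) = m + 1 + (l + 1) by omega, show l + (m + 1) = m + (l + 1) by omega]
      ring
    have h3 : Tendsto (fun N : ℕ => 1 / ((N + (l + 1) : ℕ) : ℂ)) atTop (𝓝 0) :=
      tendsto_one_div_atTop_nhds_zero_nat.comp (tendsto_add_atTop_nat (l + 1))
    have h4 := (tendsto_const_nhds (x := 1 / ((l + 1 : ℕ) : ℂ))).sub h3
    rw [sub_zero] at h4
    exact h4.congr fun N => (h2 N).symm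
  · refine harm_of_mul ((Harm.const (altTail 1 0)).sub (harm_altTail le_rfl)) fun l _ => ?_
    have h1 : HasAltSum (fun m => 1 / (m : ℂ) - 1 / ((l + m : ℕ) : ℂ)) _ := HasAltSum.of_hasSum (hs l)
    refine h1.unique (((hasAltSum_altTail le_rfl 0).sub (hasAltSum_altTail le_rfl l)).congr
      fun n _ => ?_)
    simp

theorem harm_corr_sign {e : ℂ} (he : e = 1 ∨ e = -1) {q u : ℕ} (h : 2 ≤ q + u) :
    Harm (corr (fun _ m => e ^ m) q u) := by
  have hb : ∀ (l m : ℕ), 1 ≤ m → ‖(fun _ m => e ^ m : ℕ → ℕ → ℂ) l m‖ ≤ 1 := by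
    intro _ m _; rcases he with rfl | rfl <;> simp
  refine harm_corr_of_base hb (fun u hu => ?_) (fun q _ => harm_corr_zero_right q)
    (harm_corr_sign_one_one he) _ q u rfl h
  have := harm_corr_zero_left Harm.one he (u := u) fun l => by
    simpa using summable_corr (W := fun _ m => e ^ m) (q := 0) (u := u) (l := l) (d := 0) (C := 1)
      (by simpa using hb l) (by omega)
  simpa using this

theorem one_div_succ_le {m x : ℕ} (hm : 1 ≤ m) (hx : m ≤ x + 1) :
    1 / ((x + 1 : ℕ) : ℝ) ≤ 1 / (m : ℝ) :=
  one_div_le_one_div_of_le (by exact_mod_cast hm) (by exact_mod_cast hx)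

theorem norm_sign_mul_altTail_le {e : ℂ} (he : e = 1 ∨ e = -1) {i : ℕ} (hi : 1 ≤ i) (l m : ℕ)
    (hm : 1 ≤ m) : ‖e ^ m * altTail i (l + m)‖ ≤ 1 / (m : ℝ) := by
  have : ‖e ^ m‖ = 1 := by rcases he with rfl | rfl <;> simp
  rw [norm_mul, this, one_mul]
  exact (norm_altTail_le hi _).trans (one_div_succ_le hm (by omega))

/-- If q = 0 the sum is a tail in l + m. If u = 0 only the weight depends on l, and adding the
values at l and l+1 replaces it by an inverse power of l+1+m, which gives a sum with sign weights.
-/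
theorem harm_corr_sign_altTail {e : ℂ} (he : e = 1 ∨ e = -1) {i : ℕ} (hi : 1 ≤ i) {q u : ℕ}
    (h : 2 ≤ q + u) : Harm (corr (fun l m => e ^ m * altTail i (l + m)) q u) := by
  have hb := norm_sign_mul_altTail_le he hi
  have hb' : ∀ l m : ℕ, 1 ≤ m → ‖e ^ m * altTail i (l + m)‖ ≤ 1 / (m : ℝ) ^ 1 := by simpa using hb
  refine harm_corr_of_decay hb (fun u hu => ?_) (fun q hq => ?_) h
  · exact harm_corr_zero_left (harm_altTail hi) he fun l =>
      summable_corr (W := fun l m => e ^ m * altTail i (l + m)) (q := 0) (u := u) (hb' l) (by omega)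
  · refine Harm.of_sub (g := fun n => -corr (fun _ m => e ^ m) q i n) (Or.inr rfl)
      (harm_corr_sign he (by omega)).neg fun l _ => ?_
    rw [neg_one_mul, sub_neg_eq_add, corr, corr, corr, ← tsum_neg,
      ← (summable_corr (W := fun l m => e ^ m * altTail i (l + m)) (q := q) (u := 0)
        (hb' (l + 1)) (by omega)).tsum_add
        (summable_corr (W := fun l m => e ^ m * altTail i (l + m)) (q := q) (u := 0)
          (hb' l) (by omega))]
    refine tsum_congr fun m => ?_
    have := altTail_succ hi (l + (m + 1))
    rw [show l + (m + 1) + 1 = l + 1 + (m + 1) by omega] at this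
    simp only [pow_zero, mul_one]
    rw [← add_div, ← mul_add, this, mul_neg, neg_div, mul_one_div, div_div, mul_comm (((l + 1 + (m + 1) : ℕ) : ℂ) ^ i)]

/-- Here the weight does not depend on l + m, so for q = 0 the recursion of `altTail` is used in m:
combined with the shift of l + m it yields a two-term relation in l for the auxiliary sum `L`, in
which the weight starts at index 0. -/
theorem harm_corr_altTail {i : ℕ} (hi : 1 ≤ i) {q u : ℕ} (h : 2 ≤ q + u) :
    Harm (corr (fun _ m => altTail i m) q u) := by
  have hb : ∀ l m : ℕ, 1 ≤ m → ‖(fun _ m => altTail i m : ℕ → ℕ → ℂ) l m‖ ≤ 1 / (m : ℝ) :=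
    fun l m hm => (norm_altTail_le hi m).trans (one_div_succ_le hm (by omega))
  refine harm_corr_of_decay hb (fun u hu => ?_) (fun q _ => harm_corr_zero_right q) h
  have hk := harm_corr_sign (Or.inl rfl) (q := i) (u := u) (by omega)
  set L : ℕ → ℂ := fun l => ∑' m : ℕ, altTail i m / ((l + (m + 1) : ℕ) : ℂ) ^ u with hL
  have hLs : ∀ l, Summable fun m : ℕ => altTail i m / ((l + (m + 1) : ℕ) : ℂ) ^ u := by
    intro l
    have := summable_corr (W := fun _ m => altTail i (m - 1)) (q := 0) (u := u) (l := l) (d := 1)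
      (C := 1) (fun m hm => by
        rw [pow_one]
        exact (norm_altTail_le hi (m - 1)).trans (one_div_succ_le hm (by omega))) (by omega)
    simpa using this
  have hks : ∀ l, Summable fun m : ℕ =>
      1 / (((m + 1 : ℕ) : ℂ) ^ i * ((l + (m + 1) : ℕ) : ℂ) ^ u) := fun l =>
    summable_corr (W := fun _ _ => 1) (d := 0) (C := 1) (by simp) (by omega)
  have hLh : Harm L := by
    refine Harm.of_sub (Or.inr rfl) (((Harm.const (altTail i 0)).divPow u).sub hk) fun l _ => ?_
    rw [neg_one_mul, sub_neg_eq_add, hL]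
    simp only
    rw [(hLs l).tsum_eq_zero_add, add_left_comm, ← (hLs (l + 1)).tsum_add
      ((summable_nat_add_iff 1).2 (hLs l)), sub_eq_add_neg, corr, ← tsum_neg]
    congr 1
    refine tsum_congr fun m => ?_
    rw [show l + (m + 1 + 1) = l + 1 + (m + 1) by omega, ← add_div, add_comm, altTail_succ hi m]
    rw [one_pow, neg_div, div_div]
  refine (hLh.add hk).neg.congr fun l _ => ?_
  simp only [hL, corr, one_pow]
  rw [← (hLs l).tsum_add (hks l), ← tsum_neg]
  refine tsum_congr fun m => ?_
  have := altTail_succ hi m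
  rw [pow_zero, one_mul, ← div_div, ← add_div, ← neg_div]
  congr 1
  linear_combination -this


/-! ### Partial fractions for the inner alternating sum -/

/-- Partial fractions in n: any two of n, m+n, l+m+n differ by m, l or l+m, so a product of two
inverses is a difference of inverses divided by one of these. The reduction ends with one linear
form, that is, with `altTail` at 0, m or l+m. The class `R` is abstract because the outer summations
ask for different closure properties. -/
theorem exists_altSum {R : (ℕ → ℕ → ℂ) → Prop}
    (hsub : ∀ {ψ χ}, R ψ → R χ → R fun m l => ψ m l - χ m l)
    (hm : ∀ {ψ}, R ψ → R fun m l => ψ m l / m)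
    (hl : ∀ {ψ}, R ψ → R fun m l => ψ m l / l)
    (hlm : ∀ {ψ}, R ψ → R fun m l => ψ m l / (l + m : ℕ))
    (hc : ∀ c, R fun _ _ => c)
    (ha : ∀ i, 1 ≤ i → R fun m _ => altTail i m)
    (hb : ∀ i, 1 ≤ i → R fun m l => altTail i (l + m)) (N : ℕ) :
    ∀ r v w, r + v + w = N → 1 ≤ N → ∃ ψ, R ψ ∧ ∀ m l : ℕ, 1 ≤ m → 1 ≤ l →
      HasAltSum (fun n => 1 / ((n : ℂ) ^ r * ((m + n : ℕ) : ℂ) ^ v * ((l + m + n : ℕ) : ℂ) ^ w))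
        (ψ m l) := by
  induction N with
  | zero => intro r v w h h'; omega
  | succ N ih =>
    intro r v w hN _
    by_cases h1 : 1 ≤ r ∧ 1 ≤ v
    · obtain ⟨r, rfl⟩ : ∃ r', r = r' + 1 := ⟨r - 1, by omega⟩
      obtain ⟨v, rfl⟩ : ∃ v', v = v' + 1 := ⟨v - 1, by omega⟩
      obtain ⟨ψ, hψ, h⟩ := ih (r + 1) v w (by omega) (by omega)
      obtain ⟨χ, hχ, h'⟩ := ih r (v + 1) w (by omega) (by omega)
      refine ⟨_, hm (hsub hψ hχ), fun m l hm' hl' => ?_⟩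
      rw [div_eq_inv_mul]
      refine (((h m l hm' hl').sub (h' m l hm' hl')).smul (m : ℂ)⁻¹).congr fun n hn => ?_
      have e1 : (n : ℂ) ≠ 0 := Nat.cast_ne_zero.2 (by omega)
      have e2 : (m : ℂ) ≠ 0 := Nat.cast_ne_zero.2 (by omega)
      have e3 : ((m + n : ℕ) : ℂ) ≠ 0 := Nat.cast_ne_zero.2 (by omega)
      have e4 : ((l + m + n : ℕ) : ℂ) ≠ 0 := Nat.cast_ne_zero.2 (by omega)
      have e5 : (m : ℂ) = ((m + n : ℕ) : ℂ) - n := by push_cast; ring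
      field_simp
      rw [e5]; ring
    by_cases h2 : 1 ≤ v ∧ 1 ≤ w
    · obtain ⟨w, rfl⟩ : ∃ r', w = r' + 1 := ⟨w - 1, by omega⟩
      obtain ⟨v, rfl⟩ : ∃ v', v = v' + 1 := ⟨v - 1, by omega⟩
      obtain ⟨ψ, hψ, h⟩ := ih r (v + 1) w (by omega) (by omega)
      obtain ⟨χ, hχ, h'⟩ := ih r v (w + 1) (by omega) (by omega)
      refine ⟨_, hl (hsub hψ hχ), fun m l hm' hl' => ?_⟩
      rw [div_eq_inv_mul]
      refine (((h m l hm' hl').sub (h' m l hm' hl')).smul (l : ℂ)⁻¹).congr fun n hn => ?_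
      have e1 : (n : ℂ) ≠ 0 := Nat.cast_ne_zero.2 (by omega)
      have e2 : (l : ℂ) ≠ 0 := Nat.cast_ne_zero.2 (by omega)
      have e3 : ((m + n : ℕ) : ℂ) ≠ 0 := Nat.cast_ne_zero.2 (by omega)
      have e4 : ((l + m + n : ℕ) : ℂ) ≠ 0 := Nat.cast_ne_zero.2 (by omega)
      have e5 : (l : ℂ) = ((l + m + n : ℕ) : ℂ) - (m + n : ℕ) := by push_cast; ring
      field_simp
      rw [e5]; ring
    by_cases h3 : 1 ≤ r ∧ 1 ≤ w
    · obtain ⟨w, rfl⟩ : ∃ r', w = r' + 1 := ⟨w - 1, by omega⟩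
      obtain ⟨r, rfl⟩ : ∃ v', r = v' + 1 := ⟨r - 1, by omega⟩
      obtain ⟨ψ, hψ, h⟩ := ih (r + 1) v w (by omega) (by omega)
      obtain ⟨χ, hχ, h'⟩ := ih r v (w + 1) (by omega) (by omega)
      refine ⟨_, hlm (hsub hψ hχ), fun m l hm' hl' => ?_⟩
      rw [div_eq_inv_mul]
      refine (((h m l hm' hl').sub (h' m l hm' hl')).smul ((l + m : ℕ) : ℂ)⁻¹).congr fun n hn => ?_
      have e1 : (n : ℂ) ≠ 0 := Nat.cast_ne_zero.2 (by omega)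
      have e2 : ((l + m : ℕ) : ℂ) ≠ 0 := Nat.cast_ne_zero.2 (by omega)
      have e3 : ((m + n : ℕ) : ℂ) ≠ 0 := Nat.cast_ne_zero.2 (by omega)
      have e4 : ((l + m + n : ℕ) : ℂ) ≠ 0 := Nat.cast_ne_zero.2 (by omega)
      have e5 : ((l + m : ℕ) : ℂ) = ((l + m + n : ℕ) : ℂ) - n := by push_cast; ring
      field_simp
      rw [e5]; ring
    by_cases hr : 1 ≤ r
    · obtain ⟨rfl, rfl⟩ : v = 0 ∧ w = 0 := by omega
      exact ⟨_, hc (altTail r 0), fun m l _ _ => (hasAltSum_altTail hr 0).congr fun n _ => by simp⟩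
    by_cases hv : 1 ≤ v
    · obtain ⟨rfl, rfl⟩ : r = 0 ∧ w = 0 := by omega
      exact ⟨_, ha v hv, fun m l _ _ => (hasAltSum_altTail hv m).congr fun n _ => by simp⟩
    · obtain ⟨rfl, rfl⟩ : r = 0 ∧ v = 0 := by omega
      exact ⟨_, hb w (by omega), fun m l _ _ =>
        (hasAltSum_altTail (by omega) (l + m)).congr fun n _ => by simp⟩

/-- With two positive exponents the series converges absolutely, so the conditional sum is the
unconditional one. -/
theorem tsum_eq_of_hasAltSum {r v w m l : ℕ} (hr : 1 ≤ r) (hv : 1 ≤ v) {S : ℂ}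
    (h : HasAltSum (fun n => 1 / ((n : ℂ) ^ r * ((m + n : ℕ) : ℂ) ^ v *
      ((l + m + n : ℕ) : ℂ) ^ w)) S) :
    ∑' n : ℕ, (-1 : ℂ) ^ (n + 1) * (1 / (((n + 1 : ℕ) : ℂ) ^ r * ((m + (n + 1) : ℕ) : ℂ) ^ v *
      ((l + m + (n + 1) : ℕ) : ℂ) ^ w)) = S := by
  have hs := summable_corr (W := fun _ n => (-1) ^ n / ((l + m + n : ℕ) : ℂ) ^ w) (q := r) (u := v)
    (l := m) (d := 0) (C := 1) (fun n hn => by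
      rw [norm_div, norm_pow, norm_neg, norm_one, one_pow, norm_pow, norm_natCast, pow_zero]
      exact div_le_div_of_nonneg_left zero_le_one one_pos
        (one_le_pow₀ (by exact_mod_cast (by omega : 1 ≤ l + m + n)))) (by omega)
  refine (HasAltSum.of_hasSum ?_).unique h
  refine Summable.hasSum (hs.congr fun n => ?_)
  rw [div_div, mul_one_div, mul_comm (((l + m + (n + 1) : ℕ) : ℂ) ^ w)]

/-- All the weighted sums `corr W q u` with `q, u ≥ 1` are harmonic. -/
def CorrHarm (W : ℕ → ℕ → ℂ) : Prop := ∀ q u, 1 ≤ q → 1 ≤ u →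
  (∀ N, 1 ≤ N → Summable fun m : ℕ =>
    W N (m + 1) / (((m + 1 : ℕ) : ℂ) ^ q * ((N + (m + 1) : ℕ) : ℂ) ^ u)) ∧ Harm (corr W q u)

namespace CorrHarm

variable {V W : ℕ → ℕ → ℂ}

theorem congr (hW : CorrHarm W) (h : ∀ N m, 1 ≤ N → 1 ≤ m → W N m = V N m) : CorrHarm V := by
  intro q u hq hu
  refine ⟨fun N hN => ((hW q u hq hu).1 N hN).congr fun m => ?_,
    (hW q u hq hu).2.congr fun N hN => tsum_congr fun m => ?_⟩
  · rw [h N (m + 1) hN (by omega)]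
  · rw [h N (m + 1) hN (by omega)]

theorem sub (hV : CorrHarm V) (hW : CorrHarm W) : CorrHarm fun N m => V N m - W N m := by
  intro q u hq hu
  have h1 := hV q u hq hu
  have h2 := hW q u hq hu
  refine ⟨fun N hN => ((h1.1 N hN).sub (h2.1 N hN)).congr fun m => (sub_div _ _ _).symm,
    (h1.2.sub h2.2).congr fun N hN => ?_⟩
  rw [corr, corr, corr, ← (h1.1 N hN).tsum_sub (h2.1 N hN)]
  exact tsum_congr fun m => (sub_div _ _ _).symm

theorem mul (hW : CorrHarm W) {g : ℕ → ℂ} (hg : Harm g) : CorrHarm fun N m => g N * W N m := by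
  intro q u hq hu
  have h1 := hW q u hq hu
  refine ⟨fun N hN => ((h1.1 N hN).mul_left (g N)).congr fun m => (mul_div_assoc _ _ _).symm,
    (hg.mul h1.2).congr fun N hN => ?_⟩
  rw [corr, corr, ← tsum_mul_left]
  exact tsum_congr fun m => (mul_div_assoc _ _ _).symm

theorem div_left (hW : CorrHarm W) : CorrHarm fun N m => W N m / N :=
  (hW.mul Harm.one.div).congr fun _ _ _ _ => by rw [one_div_mul_eq_div]

theorem div_right (hW : CorrHarm W) : CorrHarm fun N m => W N m / m := by
  intro q u hq hu
  have h1 := hW (q + 1) u (by omega) hu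
  refine ⟨fun N hN => (h1.1 N hN).congr fun m => ?_, h1.2.congr fun N _ => tsum_congr fun m => ?_⟩
  all_goals rw [div_div, ← mul_assoc, ← pow_succ']

theorem div_add (hW : CorrHarm W) : CorrHarm fun N m => W N m / (N + m : ℕ) := by
  intro q u hq hu
  have h1 := hW q (u + 1) hq (by omega)
  refine ⟨fun N hN => (h1.1 N hN).congr fun m => ?_, h1.2.congr fun N _ => tsum_congr fun m => ?_⟩
  all_goals rw [div_div, mul_left_comm, ← pow_succ']

theorem sign {e : ℂ} (he : e = 1 ∨ e = -1) : CorrHarm fun _ m => e ^ m := fun q u _ _ =>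
  ⟨fun _ _ => summable_corr (W := fun _ m => e ^ m) (C := 1) (d := 0)
    (fun m _ => by rcases he with rfl | rfl <;> simp) (by omega), harm_corr_sign he (by omega)⟩

theorem sign_altTail {e : ℂ} (he : e = 1 ∨ e = -1) {i : ℕ} (hi : 1 ≤ i) :
    CorrHarm fun N m => e ^ m * altTail i (N + m) := fun q u _ _ =>
  ⟨fun N _ => summable_corr (W := fun N m => e ^ m * altTail i (N + m)) (C := 1) (d := 1)
    (by simpa using norm_sign_mul_altTail_le he hi N) (by omega),
    harm_corr_sign_altTail he hi (by omega)⟩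

theorem altTail {i : ℕ} (hi : 1 ≤ i) : CorrHarm fun _ m => altTail i m := fun q u _ _ =>
  ⟨fun N _ => summable_corr (W := fun _ m => SU4Zeta.altTail i m) (C := 1) (d := 1)
    (fun m hm => by
      simpa using (norm_altTail_le hi m).trans (one_div_succ_le hm (by omega))) (by omega),
    harm_corr_altTail hi (by omega)⟩

end CorrHarm

/-- The finite sums attached to the exponent on `l + m`. -/
def FinHarm (ψ : ℕ → ℕ → ℂ) : Prop := ∀ p q, Harm fun a =>
  ∑ l ∈ Finset.Ico 1 a, (-1) ^ l * ψ (a - l) l / ((l : ℂ) ^ p * ((a - l : ℕ) : ℂ) ^ q)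

theorem harm_conv_div {f g : ℕ → ℂ} (hf : Harm f) (hg : Harm g) (p q : ℕ) : Harm fun a =>
    ∑ l ∈ Finset.Ico 1 a, f l * g (a - l) / ((l : ℂ) ^ p * ((a - l : ℕ) : ℂ) ^ q) := by
  refine (Harm.conv_harm (hf.divPow p) (hg.divPow q)).congr fun a _ => ?_
  exact Finset.sum_congr rfl fun l _ => div_mul_div_comm _ _ _ _

/-- On the diagonal l + m = a, division by l + m and the factor `altTail i (l + m)` come out of the
finite sum; everything else is a convolution of harmonic sequences. -/
theorem finHarm_altSum (r v w : ℕ) (h : 1 ≤ r + v + w) :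
    ∃ ψ, FinHarm ψ ∧ ∀ m l : ℕ, 1 ≤ m → 1 ≤ l →
      HasAltSum (fun n => 1 / ((n : ℂ) ^ r * ((m + n : ℕ) : ℂ) ^ v * ((l + m + n : ℕ) : ℂ) ^ w))
        (ψ m l) := by
  refine exists_altSum (R := FinHarm) ?_ ?_ ?_ ?_ ?_ ?_ ?_ _ r v w rfl h
  · intro ψ χ hψ hχ p q
    refine ((hψ p q).sub (hχ p q)).congr fun a _ => ?_
    rw [← Finset.sum_sub_distrib]
    exact Finset.sum_congr rfl fun l _ => by rw [mul_sub, sub_div]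
  · intro ψ hψ p q
    refine (hψ p (q + 1)).congr fun a _ => Finset.sum_congr rfl fun l _ => ?_
    rw [← mul_div_assoc, div_div]; congr 1; ring
  · intro ψ hψ p q
    refine (hψ (p + 1) q).congr fun a _ => Finset.sum_congr rfl fun l _ => ?_
    rw [← mul_div_assoc, div_div]; congr 1; ring
  · intro ψ hψ p q
    refine (hψ p q).div.congr fun a _ => ?_
    rw [Finset.sum_div]
    refine Finset.sum_congr rfl fun l hl => ?_
    simp only [Finset.mem_Ico] at hl
    simp only
    rw [show l + (a - l) = a by omega, ← mul_div_assoc, div_right_comm]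
  · intro c p q
    refine (harm_conv_div Harm.one.sgn (Harm.const c) p q).congr fun a _ => ?_
    simp only [mul_one]
  · intro i hi p q
    refine (harm_conv_div Harm.one.sgn (harm_altTail hi) p q).congr fun a _ => ?_
    simp only [mul_one]
  · intro i hi p q
    refine ((harm_altTail hi).mul (harm_conv_div Harm.one.sgn Harm.one p q)).congr fun a _ => ?_
    rw [Finset.mul_sum]
    refine Finset.sum_congr rfl fun l hl => ?_
    simp only [Finset.mem_Ico] at hl
    simp only
    rw [show l + (a - l) = a by omega]; ring

/-- The triple finite sums attached to the exponent on `l + m + n`. -/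
noncomputable def tripleSum (p q r u v N : ℕ) : ℂ :=
  ∑ l ∈ Finset.Ico 1 N, (-1) ^ l / ((l : ℂ) ^ p * ((N - l : ℕ) : ℂ) ^ v) *
    ∑ m ∈ Finset.Ico 1 (N - l), (-1) ^ (N - l - m) /
      ((m : ℂ) ^ q * ((N - l - m : ℕ) : ℂ) ^ r * ((l + m : ℕ) : ℂ) ^ u)

/-- Without the factors m and n, the inner sum runs over consecutive values k = l + m and is (-1)^N
times a difference of two partial sums, one depending on N and the other on l. -/
theorem harm_tripleSum_base (p u v : ℕ) : Harm (tripleSum p 0 0 u v) := by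
  set P : ℕ → ℂ := fun n => ∑ k ∈ Finset.Icc 1 n, (-1) ^ k * 1 / (k : ℂ) ^ u with hP
  have hPh : Harm P := (Harm.one.sgn.divPow u).sum_Icc
  have hQh : Harm fun n => ∑ k ∈ Finset.Ico 1 n, (-1) ^ k * 1 / (k : ℂ) ^ u :=
    (Harm.one.sgn.divPow u).sum_Ico
  refine (((hQh.mul (harm_conv_div Harm.one.sgn Harm.one p v)).sub
    (harm_conv_div hPh.sgn Harm.one p v)).sgn).congr fun N _ => ?_
  rw [tripleSum, Finset.mul_sum, ← Finset.sum_sub_distrib, Finset.mul_sum]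
  refine Finset.sum_congr rfl fun l hl => ?_
  simp only [Finset.mem_Ico] at hl
  have h1 : ∑ m ∈ Finset.Ico 1 (N - l), (-1 : ℂ) ^ (N - l - m) /
      ((m : ℂ) ^ 0 * ((N - l - m : ℕ) : ℂ) ^ 0 * ((l + m : ℕ) : ℂ) ^ u) =
      (-1) ^ N * (∑ k ∈ Finset.Ico 1 N, (-1) ^ k * 1 / (k : ℂ) ^ u - P l) := by
    have h2 : ∑ k ∈ Finset.Ico 1 N, (-1 : ℂ) ^ k * 1 / (k : ℂ) ^ u - P l =
        ∑ k ∈ Finset.Ico (1 + l) (N - l + l), (-1 : ℂ) ^ k * 1 / (k : ℂ) ^ u := by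
      rw [hP, sub_eq_iff_eq_add', Nat.sub_add_cancel (by omega)]
      have : Finset.Icc 1 l = Finset.Ico 1 (1 + l) := by ext; simp; omega
      simp only [this]
      exact (Finset.sum_Ico_consecutive _ (by omega) (by omega)).symm
    rw [h2, ← Finset.sum_Ico_add', Finset.mul_sum]
    refine Finset.sum_congr rfl fun m hm => ?_
    simp only [Finset.mem_Ico] at hm
    have h3 : (-1 : ℂ) ^ N = (-1) ^ (N - l - m) * (-1) ^ (m + l) := by
      rw [← pow_add]; congr 1; omega
    have h4 : (-1 : ℂ) ^ (m + l) * (-1) ^ (m + l) = 1 := by rw [← mul_pow]; norm_num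
    rw [h3, add_comm l m, pow_zero, pow_zero, one_mul, one_mul, mul_one, ← mul_div_assoc, mul_assoc,
      h4, mul_one]
  rw [h1]
  ring

/-- The identities N = (l+m) + n and l = (l+m) - m lower q + r + u until either u = 0, a nested
convolution, or q = r = 0. -/
theorem harm_tripleSum (M : ℕ) : ∀ p q r u v, q + r + u = M → Harm (tripleSum p q r u v) := by
  induction M with
  | zero =>
    intro p q r u v h
    obtain ⟨rfl, rfl, rfl⟩ : q = 0 ∧ r = 0 ∧ u = 0 := by omega
    exact harm_tripleSum_base p 0 v
  | succ M ih =>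
    intro p q r u v h
    rcases u with _ | u
    · have h1 := harm_conv_div Harm.one Harm.one.sgn q r
      refine (harm_conv_div Harm.one.sgn h1 p v).congr fun N _ => ?_
      rw [tripleSum]
      refine Finset.sum_congr rfl fun l _ => ?_
      rw [mul_div_right_comm, mul_one]
      congr 1
      refine Finset.sum_congr rfl fun m _ => ?_
      rw [one_mul, mul_one, pow_zero, mul_one]
    rcases r with _ | r
    · rcases q with _ | q
      · exact harm_tripleSum_base p _ v
      · refine ((ih (p + 1) (q + 1) 0 u v (by omega)).sub
          (ih (p + 1) q 0 (u + 1) v (by omega))).congr fun N _ => ?_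
        rw [tripleSum, tripleSum, tripleSum, ← Finset.sum_sub_distrib]
        refine Finset.sum_congr rfl fun l hl => ?_
        simp only [Finset.mem_Ico] at hl
        rw [Finset.mul_sum, Finset.mul_sum, Finset.mul_sum, ← Finset.sum_sub_distrib]
        refine Finset.sum_congr rfl fun m hm => ?_
        simp only [Finset.mem_Ico] at hm
        have e1 : (l : ℂ) ≠ 0 := Nat.cast_ne_zero.2 (by omega)
        have e2 : (m : ℂ) ≠ 0 := Nat.cast_ne_zero.2 (by omega)
        have e3 : ((l + m : ℕ) : ℂ) ≠ 0 := Nat.cast_ne_zero.2 (by omega)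
        have e4 : ((N - l : ℕ) : ℂ) ≠ 0 := Nat.cast_ne_zero.2 (by omega)
        have e5 : ((l + m : ℕ) : ℂ) = l + m := by push_cast; ring
        rw [pow_zero, mul_one]
        field_simp
        rw [e5]; ring
    · refine ((ih p q r (u + 1) v (by omega)).add
        (ih p q (r + 1) u v (by omega))).div.congr fun N hN => ?_
      rw [tripleSum, tripleSum, tripleSum, ← Finset.sum_add_distrib, Finset.sum_div]
      refine Finset.sum_congr rfl fun l hl => ?_
      simp only [Finset.mem_Ico] at hl
      rw [Finset.mul_sum, Finset.mul_sum, Finset.mul_sum, ← Finset.sum_add_distrib, Finset.sum_div]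
      refine Finset.sum_congr rfl fun m hm => ?_
      simp only [Finset.mem_Ico] at hm
      have e0 : (N : ℂ) ≠ 0 := Nat.cast_ne_zero.2 (by omega)
      have e1 : (l : ℂ) ≠ 0 := Nat.cast_ne_zero.2 (by omega)
      have e2 : (m : ℂ) ≠ 0 := Nat.cast_ne_zero.2 (by omega)
      have e3 : ((l + m : ℕ) : ℂ) ≠ 0 := Nat.cast_ne_zero.2 (by omega)
      have e4 : ((N - l : ℕ) : ℂ) ≠ 0 := Nat.cast_ne_zero.2 (by omega)
      have e6 : ((N - l - m : ℕ) : ℂ) ≠ 0 := Nat.cast_ne_zero.2 (by omega)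
      have e5 : (N : ℂ) = ((l + m : ℕ) : ℂ) + ((N - l - m : ℕ) : ℂ) := by
        rw [← Nat.cast_add]; congr 1; omega
      field_simp
      rw [e5]; ring


/-! ### Continuation of the triple series -/

/-- The term of the triple series at natural numbers. -/
noncomputable def natTerm (s : Fin 6 → ℂ) (l m n : ℕ) : ℂ :=
  (-1) ^ (l + n) /
    ((l : ℂ) ^ s 0 * (m : ℂ) ^ s 1 * (n : ℂ) ^ s 2 *
      ((l + m : ℕ) : ℂ) ^ s 3 * ((m + n : ℕ) : ℂ) ^ s 4 * ((l + m + n : ℕ) : ℂ) ^ s 5)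

theorem zetaTerm_eq (s : Fin 6 → ℂ) (x : ℕ+ × ℕ+ × ℕ+) :
    zetaTerm s x = natTerm s x.1 x.2.1 x.2.2 := rfl

/-- The six factors dominate l² m² n²: l is bounded by l and l+m+n, m by m and l+m, n by n and m+n.
-/
theorem norm_natTerm_le {s : Fin 6 → ℂ} (hs : ∀ j, 1 ≤ (s j).re) {l m n : ℕ} (hl : 1 ≤ l)
    (hm : 1 ≤ m) (hn : 1 ≤ n) :
    ‖natTerm s l m n‖ ≤ 1 / (l : ℝ) ^ 2 * (1 / (m : ℝ) ^ 2 * (1 / (n : ℝ) ^ 2)) := by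
  have key : ∀ (k : ℕ) (j : Fin 6), 1 ≤ k → (k : ℝ) ≤ ‖(k : ℂ) ^ s j‖ := by
    intro k j hk
    rw [norm_natCast_cpow_of_pos hk]
    calc (k : ℝ) = (k : ℝ) ^ (1 : ℝ) := (Real.rpow_one _).symm
      _ ≤ _ := Real.rpow_le_rpow_of_exponent_le (by exact_mod_cast hk) (hs j)
  rw [natTerm, norm_div, norm_pow, norm_neg, norm_one, one_pow]
  simp only [norm_mul]
  rw [one_div_mul_one_div, one_div_mul_one_div]
  have hl0 : (0 : ℝ) < l := by exact_mod_cast hl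
  have hm0 : (0 : ℝ) < m := by exact_mod_cast hm
  have hn0 : (0 : ℝ) < n := by exact_mod_cast hn
  refine one_div_le_one_div_of_le (by positivity) ?_
  have h3 : (m : ℝ) ≤ ‖((l + m : ℕ) : ℂ) ^ s 3‖ :=
    le_trans (by exact_mod_cast (by omega : m ≤ l + m)) (key (l + m) 3 (by omega))
  have h4 : (n : ℝ) ≤ ‖((m + n : ℕ) : ℂ) ^ s 4‖ :=
    le_trans (by exact_mod_cast (by omega : n ≤ m + n)) (key (m + n) 4 (by omega))
  have h5 : (l : ℝ) ≤ ‖((l + m + n : ℕ) : ℂ) ^ s 5‖ :=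
    le_trans (by exact_mod_cast (by omega : l ≤ l + m + n)) (key (l + m + n) 5 (by omega))
  calc (l : ℝ) ^ 2 * ((m : ℝ) ^ 2 * (n : ℝ) ^ 2) = (l : ℝ) * m * n * m * n * l := by ring
    _ ≤ _ := by
      have h0 := key l 0 hl
      have h1 := key m 1 hm
      have h2 := key n 2 hn
      gcongr

/-- The summable bound for the terms. -/
noncomputable def sqBound (y : ℕ × ℕ × ℕ) : ℝ :=
  1 / ((y.1 + 1 : ℕ) : ℝ) ^ 2 * (1 / ((y.2.1 + 1 : ℕ) : ℝ) ^ 2 * (1 / ((y.2.2 + 1 : ℕ) : ℝ) ^ 2))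

theorem summable_sqBound : Summable sqBound := by
  have h := summable_one_div_succ_sq
  have h0 : ∀ n : ℕ, 0 ≤ 1 / ((n + 1 : ℕ) : ℝ) ^ 2 := fun n => by positivity
  have h2 := h.mul_of_nonneg h h0 h0
  exact h.mul_of_nonneg h2 h0 fun y => mul_nonneg (h0 _) (h0 _)

theorem norm_natTerm_succ_le {s : Fin 6 → ℂ} (hs : ∀ j, 1 ≤ (s j).re) (y : ℕ × ℕ × ℕ) :
    ‖natTerm s (y.1 + 1) (y.2.1 + 1) (y.2.2 + 1)‖ ≤ sqBound y :=
  norm_natTerm_le hs (by omega) (by omega) (by omega)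

theorem summable_natTerm {s : Fin 6 → ℂ} (hs : ∀ j, 1 ≤ (s j).re) :
    Summable fun y : ℕ × ℕ × ℕ => natTerm s (y.1 + 1) (y.2.1 + 1) (y.2.2 + 1) :=
  Summable.of_norm_bounded summable_sqBound (norm_natTerm_succ_le hs)

/-- Triples of positive integers as triples of natural numbers. -/
def pnatTripleEquiv : ℕ+ × ℕ+ × ℕ+ ≃ ℕ × ℕ × ℕ :=
  Equiv.pnatEquivNat.prodCongr (Equiv.pnatEquivNat.prodCongr Equiv.pnatEquivNat)

theorem zetaTerm_pnatTripleEquiv_symm (s : Fin 6 → ℂ) (y : ℕ × ℕ × ℕ) :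
    zetaTerm s (pnatTripleEquiv.symm y) = natTerm s (y.1 + 1) (y.2.1 + 1) (y.2.2 + 1) := by
  rw [zetaTerm_eq]
  simp [pnatTripleEquiv, Equiv.pnatEquivNat]

theorem summable_zetaTerm {s : Fin 6 → ℂ} (hs : ∀ j, 1 ≤ (s j).re) : Summable (zetaTerm s) := by
  rw [← pnatTripleEquiv.symm.summable_iff]
  exact (summable_natTerm hs).congr fun y => (zetaTerm_pnatTripleEquiv_symm s y).symm

theorem tsum_zetaTerm (s : Fin 6 → ℂ) : ∑' x, zetaTerm s x =
    ∑' y : ℕ × ℕ × ℕ, natTerm s (y.1 + 1) (y.2.1 + 1) (y.2.2 + 1) := by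
  rw [← pnatTripleEquiv.symm.tsum_eq]
  exact tsum_congr fun y => zetaTerm_pnatTripleEquiv_symm s y

theorem one_le_re_update {e : Fin 6 → ℕ} (he : ∀ j, 1 ≤ e j) (k : Fin 6) {s : ℂ} (hs : 1 < s.re)
    (j : Fin 6) : 1 ≤ ((Function.update (fun j => (e j : ℂ)) k s : Fin 6 → ℂ) j).re := by
  by_cases h : j = k
  · subst h; simpa using hs.le
  · rw [Function.update_of_ne h, natCast_re]
    exact_mod_cast he j

theorem analyticAt_tsum_zetaTerm {e : Fin 6 → ℕ} (he : ∀ j, 1 ≤ e j) (k : Fin 6) {s : ℂ}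
    (hs : 1 < s.re) :
    AnalyticAt ℂ (fun s => ∑' x, zetaTerm (Function.update (fun j => (e j : ℂ)) k s) x) s := by
  have h : DifferentiableOn ℂ
      (fun s => ∑' x, zetaTerm (Function.update (fun j => (e j : ℂ)) k s) x) {s | 1 < s.re} := by
    simp only [tsum_zetaTerm]
    refine differentiableOn_tsum_of_summable_norm summable_sqBound (fun y => ?_)
      (isOpen_halfPlane 1) fun y w hw => norm_natTerm_succ_le (one_le_re_update he k hw) y
    refine Differentiable.differentiableOn ?_
    have hpow : ∀ (a : ℕ) (j : Fin 6), 1 ≤ a → Differentiable ℂ fun s : ℂ =>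
        (a : ℂ) ^ (Function.update (fun j => (e j : ℂ)) k s : Fin 6 → ℂ) j := by
      intro a j ha
      have ha' : (a : ℂ) ≠ 0 := Nat.cast_ne_zero.2 (by omega)
      by_cases h : j = k
      · subst h
        simp only [Function.update_self]
        exact differentiable_id.const_cpow (Or.inl ha')
      · simp only [Function.update_of_ne h]
        exact differentiable_const _
    have hne : ∀ (a : ℕ) (z : ℂ), 1 ≤ a → (a : ℂ) ^ z ≠ 0 := fun a z ha =>
      by
      rw [Ne, cpow_eq_zero_iff]
      exact fun h => absurd h.1 (Nat.cast_ne_zero.2 (by omega))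
    unfold natTerm
    refine (differentiable_const _).div ?_ fun s => ?_
    · exact (((((hpow _ _ (by omega)).mul (hpow _ _ (by omega))).mul (hpow _ _ (by omega))).mul
        (hpow _ _ (by omega))).mul (hpow _ _ (by omega))).mul (hpow _ _ (by omega))
    · refine mul_ne_zero (mul_ne_zero (mul_ne_zero (mul_ne_zero (mul_ne_zero ?_ ?_) ?_) ?_) ?_) ?_
      all_goals exact hne _ _ (by omega)
  exact h.analyticAt ((isOpen_halfPlane 1).mem_nhds hs)

/-- Summation over the antidiagonals. -/
theorem hasSum_antidiagonal {F : ℕ → ℕ → ℂ}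
    (h : Summable fun y : ℕ × ℕ => F (y.1 + 1) (y.2 + 1)) :
    HasSum (fun N : ℕ => ∑ a ∈ Finset.Ico 1 (N + 1), F a (N + 1 - a))
      (∑' y : ℕ × ℕ, F (y.1 + 1) (y.2 + 1)) := by
  have h1 := (Finset.HasAntidiagonal.sigmaAntidiagonalEquivProd (A := ℕ)).hasSum_iff.2 h.hasSum
  have h2 := h1.sigma (g := fun N => ∑ a ∈ Finset.Ico 1 (N + 2), F a (N + 2 - a)) fun N => by
    have h3 : ∑ a ∈ Finset.Ico 1 (N + 2), F a (N + 2 - a) =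
        ∑ y ∈ Finset.HasAntidiagonal.antidiagonal N, F (y.1 + 1) (y.2 + 1) := by
      rw [Finset.Nat.sum_antidiagonal_eq_sum_range_succ (fun a b => F (a + 1) (b + 1)),
        Finset.sum_Ico_eq_sum_range]
      refine Finset.sum_congr rfl fun a ha => ?_
      simp only [Finset.mem_range] at ha
      rw [add_comm 1 a, show N + 2 - (a + 1) = N - a + 1 by omega]
    rw [h3, ← Finset.sum_coe_sort]
    exact hasSum_fintype _
  have h4 := (hasSum_nat_add_iff (f := fun N : ℕ =>
    ∑ a ∈ Finset.Ico 1 (N + 1), F a (N + 1 - a)) 1).1 h2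
  simpa using h4

/-- The series with a variable exponent on `l`. -/
theorem exists_harm_exponent_zero (q r u v w : ℕ) (hq : 1 ≤ q) (hr : 1 ≤ r) (hu : 1 ≤ u)
    (hv : 1 ≤ v) (hw : 1 ≤ w) : ∃ c, Harm c ∧ ∀ s : ℂ, 1 < s.re →
      HasSum (fun N : ℕ => c (N + 1) * ((N + 1 : ℕ) : ℂ) ^ (-s))
        (∑' x, zetaTerm ![s, q, r, u, v, w] x) := by
  -- The summation is over n first, then m, and l is the index of the Dirichlet series; accordingly
  -- the first variable of `CorrHarm` is l.
  have hR : ∃ ψ : ℕ → ℕ → ℂ, CorrHarm (fun N m => ψ m N) ∧ ∀ m l : ℕ, 1 ≤ m → 1 ≤ l →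
      HasAltSum (fun n => 1 / ((n : ℂ) ^ r * ((m + n : ℕ) : ℂ) ^ v * ((l + m + n : ℕ) : ℂ) ^ w))
        (ψ m l) := by
    refine exists_altSum (R := fun ψ => CorrHarm fun N m => ψ m N) (fun h h' => h.sub h')
      (fun h => h.div_right) (fun h => h.div_left) (fun h => h.div_add) (fun c => ?_)
      (fun i hi => CorrHarm.altTail hi) (fun i hi => ?_) _ r v w rfl (by omega)
    · exact ((CorrHarm.sign (Or.inl rfl)).mul (Harm.const c)).congr fun _ _ _ _ => by simp
    · exact (CorrHarm.sign_altTail (Or.inl rfl) hi).congr fun _ _ _ _ => by simp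
  obtain ⟨ψ, hψ, hsum⟩ := hR
  refine ⟨_, (hψ q u hq hu).2.sgn, fun s hs => ?_⟩
  have hre : ∀ j, 1 ≤ ((![s, q, r, u, v, w] : Fin 6 → ℂ) j).re := by
    intro j; fin_cases j <;> simp <;> first | exact hs.le | assumption
  have hS := summable_natTerm hre
  rw [tsum_zetaTerm, hS.tsum_prod]
  refine (hS.prod).hasSum.congr_fun fun l => ?_
  rw [(hS.prod_factor l).tsum_prod]
  have : ∀ m : ℕ, ∑' n : ℕ, natTerm ![s, q, r, u, v, w] (l + 1) (m + 1) (n + 1) =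
      ((-1) ^ (l + 1) * ((l + 1 : ℕ) : ℂ) ^ (-s)) * (ψ (m + 1) (l + 1) /
        (((m + 1 : ℕ) : ℂ) ^ q * ((l + 1 + (m + 1) : ℕ) : ℂ) ^ u)) := by
    intro m
    rw [← tsum_eq_of_hasAltSum hr hv (hsum (m + 1) (l + 1) (by omega) (by omega)), ← tsum_div_const,
      ← tsum_mul_left]
    refine tsum_congr fun n => ?_
    simp only [natTerm, Matrix.cons_val, cpow_natCast]
    rw [cpow_neg, pow_add]
    ring
  simp only [this]
  rw [tsum_mul_left, corr]
  ring

/-- The series with a variable exponent on `m`. -/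
theorem exists_harm_exponent_one (p r u v w : ℕ) (hp : 1 ≤ p) (hr : 1 ≤ r) (hu : 1 ≤ u)
    (hv : 1 ≤ v) (hw : 1 ≤ w) : ∃ c, Harm c ∧ ∀ s : ℂ, 1 < s.re →
      HasSum (fun N : ℕ => c (N + 1) * ((N + 1 : ℕ) : ℂ) ^ (-s))
        (∑' x, zetaTerm ![p, s, r, u, v, w] x) := by
  -- Now m is the index of the Dirichlet series and l is summed over, so the sign (-1)^l belongs to
  -- the weight.
  have hR : ∃ ψ : ℕ → ℕ → ℂ, CorrHarm (fun N l => (-1) ^ l * ψ N l) ∧ ∀ m l : ℕ, 1 ≤ m → 1 ≤ l →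
      HasAltSum (fun n => 1 / ((n : ℂ) ^ r * ((m + n : ℕ) : ℂ) ^ v * ((l + m + n : ℕ) : ℂ) ^ w))
        (ψ m l) := by
    refine exists_altSum (R := fun ψ => CorrHarm fun N l => (-1) ^ l * ψ N l)
      (fun h h' => (h.sub h').congr fun _ _ _ _ => (mul_sub _ _ _).symm)
      (fun h => h.div_left.congr fun _ _ _ _ => mul_div_assoc _ _ _)
      (fun h => h.div_right.congr fun _ _ _ _ => mul_div_assoc _ _ _)
      (fun h => h.div_add.congr fun _ _ _ _ => by rw [mul_div_assoc, add_comm]) (fun c => ?_)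
      (fun i hi => ?_) (fun i hi => ?_) _ r v w rfl (by omega)
    · exact ((CorrHarm.sign (Or.inr rfl)).mul (Harm.const c)).congr fun _ _ _ _ => mul_comm _ _
    · exact ((CorrHarm.sign (Or.inr rfl)).mul (harm_altTail hi)).congr fun _ _ _ _ => mul_comm _ _
    · exact (CorrHarm.sign_altTail (Or.inr rfl) hi).congr fun _ _ _ _ => by rw [add_comm]
  obtain ⟨ψ, hψ, hsum⟩ := hR
  refine ⟨_, (hψ p u hp hu).2, fun s hs => ?_⟩
  have hre : ∀ j, 1 ≤ ((![p, s, r, u, v, w] : Fin 6 → ℂ) j).re := by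
    intro j; fin_cases j <;> simp <;> first | exact hs.le | assumption
  have hS := summable_natTerm hre
  have hS' : Summable fun y : ℕ × ℕ × ℕ =>
      natTerm ![p, s, r, u, v, w] (y.2.1 + 1) (y.1 + 1) (y.2.2 + 1) := by
    rw [← (Equiv.prodAssoc ℕ ℕ ℕ).summable_iff, ← ((Equiv.prodComm ℕ ℕ).prodCongr
      (Equiv.refl ℕ)).summable_iff]
    rw [← (Equiv.prodAssoc ℕ ℕ ℕ).summable_iff] at hS
    exact hS
  have hT : ∑' y : ℕ × ℕ × ℕ, natTerm ![p, s, r, u, v, w] (y.1 + 1) (y.2.1 + 1) (y.2.2 + 1) =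
      ∑' y : ℕ × ℕ × ℕ, natTerm ![p, s, r, u, v, w] (y.2.1 + 1) (y.1 + 1) (y.2.2 + 1) := by
    rw [← (Equiv.prodAssoc ℕ ℕ ℕ).tsum_eq, ← ((Equiv.prodComm ℕ ℕ).prodCongr
      (Equiv.refl ℕ)).tsum_eq, ← (Equiv.prodAssoc ℕ ℕ ℕ).tsum_eq (fun y =>
      natTerm ![p, s, r, u, v, w] (y.2.1 + 1) (y.1 + 1) (y.2.2 + 1))]
    rfl
  rw [tsum_zetaTerm, hT, hS'.tsum_prod]
  refine (hS'.prod).hasSum.congr_fun fun m => ?_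
  rw [(hS'.prod_factor m).tsum_prod]
  have : ∀ l : ℕ, ∑' n : ℕ, natTerm ![p, s, r, u, v, w] (l + 1) (m + 1) (n + 1) =
      (((m + 1 : ℕ) : ℂ) ^ (-s)) * ((-1) ^ (l + 1) * ψ (m + 1) (l + 1) /
        (((l + 1 : ℕ) : ℂ) ^ p * ((m + 1 + (l + 1) : ℕ) : ℂ) ^ u)) := by
    intro l
    rw [← tsum_eq_of_hasAltSum hr hv (hsum (m + 1) (l + 1) (by omega) (by omega)), ← tsum_mul_left,
      ← tsum_div_const, ← tsum_mul_left]
    refine tsum_congr fun n => ?_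
    simp only [natTerm, Matrix.cons_val, cpow_natCast]
    rw [cpow_neg, pow_add, add_comm (m + 1) (l + 1)]
    ring
  simp only [this]
  rw [tsum_mul_left, corr, mul_comm]

/-- The series with a variable exponent on `l + m`. -/
theorem exists_harm_exponent_three (p q r v w : ℕ) (hp : 1 ≤ p) (hq : 1 ≤ q) (hr : 1 ≤ r)
    (hv : 1 ≤ v) (hw : 1 ≤ w) : ∃ c, Harm c ∧ ∀ s : ℂ, 1 < s.re →
      HasSum (fun N : ℕ => c (N + 1) * ((N + 1 : ℕ) : ℂ) ^ (-s))
        (∑' x, zetaTerm ![p, q, r, s, v, w] x) := by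
  obtain ⟨ψ, hψ, hsum⟩ := finHarm_altSum r v w (by omega)
  refine ⟨_, hψ p q, fun s hs => ?_⟩
  have hre : ∀ j, 1 ≤ ((![p, q, r, s, v, w] : Fin 6 → ℂ) j).re := by
    intro j; fin_cases j <;> simp <;> first | exact hs.le | assumption
  have hS := summable_natTerm hre
  rw [tsum_zetaTerm, ← (Equiv.prodAssoc ℕ ℕ ℕ).tsum_eq]
  rw [← (Equiv.prodAssoc ℕ ℕ ℕ).summable_iff] at hS
  have hS1 : Summable fun y : (ℕ × ℕ) × ℕ =>
    natTerm ![p, q, r, s, v, w] (y.1.1 + 1) (y.1.2 + 1) (y.2 + 1) := hS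
  change HasSum _ (∑' y : (ℕ × ℕ) × ℕ,
    natTerm ![p, q, r, s, v, w] (y.1.1 + 1) (y.1.2 + 1) (y.2 + 1))
  rw [hS1.tsum_prod]
  have key : ∀ l m : ℕ, 1 ≤ l → 1 ≤ m → ∑' n : ℕ, natTerm ![p, q, r, s, v, w] l m (n + 1) =
      (-1) ^ l * ψ m l / ((l : ℂ) ^ p * (m : ℂ) ^ q) * ((l + m : ℕ) : ℂ) ^ (-s) := by
    intro l m hl hm
    rw [← tsum_eq_of_hasAltSum hr hv (hsum m l hm hl), ← tsum_mul_left, ← tsum_div_const,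
      ← tsum_mul_right]
    refine tsum_congr fun n => ?_
    simp only [natTerm, Matrix.cons_val, cpow_natCast]
    rw [cpow_neg, pow_add]
    ring
  have hS2 := hS1.prod
  -- After the sum over n, the pairs (l, m) are collected by N = l + m.
  refine (hasSum_antidiagonal (F := fun l m => ∑' n : ℕ, natTerm ![p, q, r, s, v, w] l m (n + 1))
    hS2).congr_fun fun N => ?_
  rw [Finset.sum_mul]
  refine Finset.sum_congr rfl fun l hl => ?_
  simp only [Finset.mem_Ico] at hl
  rw [key l (N + 1 - l) hl.1 (by omega), show l + (N + 1 - l) = N + 1 by omega]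

/-- The series with a variable exponent on `l + m + n`. -/
theorem exists_harm_exponent_five (p q r u v : ℕ) (hp : 1 ≤ p) (hq : 1 ≤ q) (hr : 1 ≤ r)
    (hu : 1 ≤ u) (hv : 1 ≤ v) : ∃ c, Harm c ∧ ∀ s : ℂ, 1 < s.re →
      HasSum (fun N : ℕ => c (N + 1) * ((N + 1 : ℕ) : ℂ) ^ (-s))
        (∑' x, zetaTerm ![p, q, r, u, v, s] x) := by
  refine ⟨_, harm_tripleSum _ p q r u v rfl, fun s hs => ?_⟩
  have hre : ∀ j, 1 ≤ ((![p, q, r, u, v, s] : Fin 6 → ℂ) j).re := by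
    intro j; fin_cases j <;> simp <;> first | exact hs.le | assumption
  have hS := summable_natTerm hre
  rw [tsum_zetaTerm]
  -- For fixed l the pairs (m, n) are collected by their sum; a second collection then groups by l +
  -- (m + n).
  let E : (Σ y : ℕ × ℕ, Finset.HasAntidiagonal.antidiagonal y.2) ≃ ℕ × ℕ × ℕ :=
    { toFun := fun x => (x.1.1, x.2.1.1, x.2.1.2)
      invFun := fun y => ⟨(y.1, y.2.1 + y.2.2), ⟨y.2, by simp⟩⟩
      left_inv := by
        rintro ⟨⟨l, b⟩, ⟨⟨m, n⟩, h⟩⟩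
        rw [Finset.HasAntidiagonal.mem_antidiagonal] at h
        obtain rfl : m + n = b := h
        rfl
      right_inv := fun _ => rfl }
  set G : ℕ → ℕ → ℂ := fun l b => ∑ m ∈ Finset.Ico 1 b,
    natTerm ![p, q, r, u, v, s] l m (b - m) with hG
  have h1 := (E.hasSum_iff.2 hS.hasSum).sigma (g := fun y => G (y.1 + 1) (y.2 + 2)) fun y => by
    have h3 : G (y.1 + 1) (y.2 + 2) = ∑ z ∈ Finset.HasAntidiagonal.antidiagonal y.2,
        natTerm ![p, q, r, u, v, s] (y.1 + 1) (z.1 + 1) (z.2 + 1) := by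
      rw [Finset.Nat.sum_antidiagonal_eq_sum_range_succ (fun a b =>
        natTerm ![p, q, r, u, v, s] (y.1 + 1) (a + 1) (b + 1)), hG]
      simp only
      rw [Finset.sum_Ico_eq_sum_range]
      refine Finset.sum_congr rfl fun a ha => ?_
      simp only [Finset.mem_range] at ha
      rw [add_comm 1 a, show y.2 + 2 - (a + 1) = y.2 - a + 1 by omega]
    rw [h3, ← Finset.sum_coe_sort]
    exact hasSum_fintype _
  have h2 : HasSum (fun y : ℕ × ℕ => G (y.1 + 1) (y.2 + 1))
      (∑' y : ℕ × ℕ × ℕ, natTerm ![p, q, r, u, v, s] (y.1 + 1) (y.2.1 + 1) (y.2.2 + 1)) := by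
    have hinj : Function.Injective fun y : ℕ × ℕ => (y.1, y.2 + 1) := by
      rintro ⟨a, b⟩ ⟨a', b'⟩ h
      simpa using h
    refine (hinj.hasSum_iff fun y hy => ?_).1 h1
    rcases y with ⟨a, _ | b⟩
    · simp [hG]
    · exact absurd ⟨(a, b), rfl⟩ hy
  have h3 := hasSum_antidiagonal h2.summable
  rw [h2.tsum_eq] at h3
  refine h3.congr_fun fun N => ?_
  rw [tripleSum, Finset.sum_mul]
  refine Finset.sum_congr rfl fun l hl => ?_
  simp only [Finset.mem_Ico] at hl
  rw [hG, Finset.mul_sum, Finset.sum_mul]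
  refine Finset.sum_congr rfl fun m hm => ?_
  simp only [Finset.mem_Ico] at hm
  simp only [natTerm, Matrix.cons_val, cpow_natCast]
  rw [show m + (N + 1 - l - m) = N + 1 - l by omega,
    show l + m + (N + 1 - l - m) = N + 1 by omega, cpow_neg, pow_add]
  ring


/-- The symmetry `l ↔ n` of the triple series. -/
theorem tsum_zetaTerm_reverse (a₀ a₁ a₂ a₃ a₄ a₅ : ℂ) :
    ∑' x, zetaTerm ![a₀, a₁, a₂, a₃, a₄, a₅] x = ∑' x, zetaTerm ![a₂, a₁, a₀, a₄, a₃, a₅] x := by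
  let E : ℕ × ℕ × ℕ ≃ ℕ × ℕ × ℕ :=
    { toFun := fun y => (y.2.2, y.2.1, y.1)
      invFun := fun y => (y.2.2, y.2.1, y.1)
      left_inv := fun _ => rfl
      right_inv := fun _ => rfl }
  rw [tsum_zetaTerm, tsum_zetaTerm, ← E.tsum_eq]
  refine tsum_congr fun y => ?_
  simp only [natTerm, Matrix.cons_val, E, Equiv.coe_fn_mk]
  rw [add_comm (y.2.2 + 1) (y.1 + 1), add_comm (y.2.2 + 1) (y.2.1 + 1),
    add_comm (y.2.1 + 1) (y.1 + 1),
    show y.2.1 + 1 + (y.2.2 + 1) + (y.1 + 1) = y.1 + 1 + (y.2.1 + 1) + (y.2.2 + 1) by omega]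
  congr 1
  ring

theorem exists_harm_update {e : Fin 6 → ℕ} (he : ∀ j, 1 ≤ e j) (k : Fin 6) :
    ∃ c, Harm c ∧ ∀ s : ℂ, 1 < s.re →
      HasSum (fun N : ℕ => c (N + 1) * ((N + 1 : ℕ) : ℂ) ^ (-s))
        (∑' x, zetaTerm (Function.update (fun j => (e j : ℂ)) k s) x) := by
  have hup : ∀ (s : ℂ) (v : Fin 6 → ℂ), (∀ j, v j = if j = k then s else (e j : ℂ)) →
      Function.update (fun j => (e j : ℂ)) k s = v := by
    intro s v hv
    funext j
    rw [hv j, Function.update_apply]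
  fin_cases k
  · obtain ⟨c, hc, h⟩ := exists_harm_exponent_zero (e 1) (e 2) (e 3) (e 4) (e 5) (he 1) (he 2)
      (he 3) (he 4) (he 5)
    refine ⟨c, hc, fun s hs => ?_⟩
    rw [hup s ![s, e 1, e 2, e 3, e 4, e 5] (by intro j; fin_cases j <;> simp)]
    exact h s hs
  · obtain ⟨c, hc, h⟩ := exists_harm_exponent_one (e 0) (e 2) (e 3) (e 4) (e 5) (he 0) (he 2)
      (he 3) (he 4) (he 5)
    refine ⟨c, hc, fun s hs => ?_⟩
    rw [hup s ![e 0, s, e 2, e 3, e 4, e 5] (by intro j; fin_cases j <;> simp)]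
    exact h s hs
  · obtain ⟨c, hc, h⟩ := exists_harm_exponent_zero (e 1) (e 0) (e 4) (e 3) (e 5) (he 1) (he 0)
      (he 4) (he 3) (he 5)
    refine ⟨c, hc, fun s hs => ?_⟩
    rw [hup s ![e 0, e 1, s, e 3, e 4, e 5] (by intro j; fin_cases j <;> simp),
      tsum_zetaTerm_reverse]
    exact h s hs
  · obtain ⟨c, hc, h⟩ := exists_harm_exponent_three (e 0) (e 1) (e 2) (e 4) (e 5) (he 0) (he 1)
      (he 2) (he 4) (he 5)
    refine ⟨c, hc, fun s hs => ?_⟩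
    rw [hup s ![e 0, e 1, e 2, s, e 4, e 5] (by intro j; fin_cases j <;> simp)]
    exact h s hs
  · obtain ⟨c, hc, h⟩ := exists_harm_exponent_three (e 2) (e 1) (e 0) (e 3) (e 5) (he 2) (he 1)
      (he 0) (he 3) (he 5)
    refine ⟨c, hc, fun s hs => ?_⟩
    rw [hup s ![e 0, e 1, e 2, e 3, s, e 5] (by intro j; fin_cases j <;> simp),
      tsum_zetaTerm_reverse]
    exact h s hs
  · obtain ⟨c, hc, h⟩ := exists_harm_exponent_five (e 0) (e 1) (e 2) (e 3) (e 4) (he 0) (he 1)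
      (he 2) (he 3) (he 4)
    refine ⟨c, hc, fun s hs => ?_⟩
    rw [hup s ![e 0, e 1, e 2, e 3, e 4, s] (by intro j; fin_cases j <;> simp)]
    exact h s hs

/-- The triple series with one variable exponent continues meromorphically. -/
theorem exists_isMeroContinuation_zetaTerm {e : Fin 6 → ℕ} (he : ∀ j, 1 ≤ e j) (k : Fin 6) :
    ∃ F, IsMeroContinuation
      (fun s => ∑' x, zetaTerm (Function.update (fun j => (e j : ℂ)) k s) x) F := by
  obtain ⟨c, hc, h⟩ := exists_harm_update he k
  obtain ⟨⟨A, C, hA⟩, hcont⟩ := hc.continuable.1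
  refine exists_isMeroContinuation (fun s hs => analyticAt_tsum_zetaTerm he k hs) fun N => ?_
  obtain ⟨F, hF, B, hB⟩ := hcont (-(N : ℝ))
  refine ⟨F, hF, max B (A + 1), fun s hs => ?_⟩
  rw [max_lt_iff] at hs
  rw [hB s hs.1]
  refine (hasSum_LSeries_succ (hA.summable hs.2)).unique (h s ?_)
  have : (0 : ℝ) ≤ A := A.cast_nonneg
  linarith [hs.2]

theorem exponents_eq_update {p q a b c : ℕ} (hp : 0 < p) (hq : 0 < q) (ha : 0 < a) (hb : 0 < b)
    (hc : 0 < c) (i : Fin 12) : ∃ (e : Fin 6 → ℕ) (k : Fin 6), (∀ j, 1 ≤ e j) ∧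
      ∀ s, exponents p q a b c i s = Function.update (fun j => (e j : ℂ)) k s := by
  refine ⟨(![![p, q, 1, a, b, c], ![p, a, 1, q, c, b], ![q, a, c, p, 1, b], ![q, 1, c, b, a, p],
     ![a, q, b, p, 1, c], ![a, 1, b, c, q, p], ![a, p, b, q, c, 1], ![a, c, b, 1, p, q],
     ![1, c, p, a, b, q], ![q, p, c, a, b, 1], ![q, b, c, 1, p, a],
     ![1, b, p, q, c, a]] : Fin 12 → Fin 6 → ℕ) i,
     (![2, 2, 4, 1, 4, 1, 5, 3, 0, 5, 3, 0] : Fin 12 → Fin 6) i, ?_, ?_⟩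
  · fin_cases i <;> intro j <;> fin_cases j <;> first | exact le_rfl | assumption
  · intro s
    funext j
    fin_cases i <;> fin_cases j <;> simp [exponents]

theorem summable_zetaTerm_exponents {p q a b c : ℕ} (hp : 0 < p) (hq : 0 < q) (ha : 0 < a)
    (hb : 0 < b) (hc : 0 < c) (i : Fin 12) {s : ℂ} (hs : 1 < s.re) :
    Summable (zetaTerm (exponents p q a b c i s)) := by
  obtain ⟨e, k, he, h⟩ := exponents_eq_update hp hq ha hb hc i
  rw [h s]
  exact summable_zetaTerm (one_le_re_update he k hs)

theorem isMeroContinuation_zeta {p q a b c : ℕ} (hp : 0 < p) (hq : 0 < q) (ha : 0 < a)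
    (hb : 0 < b) (hc : 0 < c) (i : Fin 12) :
    IsMeroContinuation (fun s => ∑' x, zetaTerm (exponents p q a b c i s) x)
      (zeta (exponents p q a b c i)) := by
  obtain ⟨e, k, he, h⟩ := exponents_eq_update hp hq ha hb hc i
  obtain ⟨F, hF⟩ := exists_isMeroContinuation_zetaTerm he k
  simp only [← h] at hF
  exact hF.meroContinuation


theorem sum_Icc_neg_succ (f : ℤ → ℂ) (M : ℕ) :
    ∑ l ∈ Finset.Icc (-((M + 1 : ℕ) : ℤ)) ((M + 1 : ℕ) : ℤ), f l =
      ∑ l ∈ Finset.Icc (-(M : ℤ)) M, f l + (f (M + 1) + f (-(M + 1))) := by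
  rw [Nat.cast_add, Nat.cast_one, Finset.Icc_succ_succ, Finset.sum_union (by simp),
    Finset.sum_pair (by lia)]
  ring

theorem sum_Icc_neg_shift_sub (f : ℤ → ℂ) (M : ℕ) :
    ∑ l ∈ Finset.Icc (-(M : ℤ)) M, f (l - 1) =
      ∑ l ∈ Finset.Icc (-(M : ℤ)) M, f l + (f (-M - 1) - f M) := by
  induction M with
  | zero => simp
  | succ M ih =>
    rw [sum_Icc_neg_succ, sum_Icc_neg_succ f, ih]
    push_cast
    rw [show ((M : ℤ) + 1 - 1) = M by ring, show (-(M : ℤ) - 1) = -(M + 1) by ring,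
      show (-((M : ℤ) + 1) - 1) = -(M + 1) - 1 by ring]
    ring

/-- Symmetric partial sums of a null sequence over `ℤ` do not see translations. -/
theorem tendsto_sum_Icc_shift {f : ℤ → ℂ} (hf : Tendsto f cofinite (𝓝 0)) {L : ℂ}
    (h : Tendsto (fun M : ℕ => ∑ l ∈ Finset.Icc (-(M : ℤ)) M, f l) atTop (𝓝 L)) (k : ℤ) :
    Tendsto (fun M : ℕ => ∑ l ∈ Finset.Icc (-(M : ℤ)) M, f (l - k)) atTop (𝓝 L) := by
  have key : ∀ g : ℤ → ℂ, Tendsto g cofinite (𝓝 0) →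
      Tendsto (fun M : ℕ => g (-M - 1) - g M) atTop (𝓝 0) := by
    intro g hg
    have h1 : Tendsto (fun M : ℕ => g (-M - 1)) atTop (𝓝 0) := by
      refine hg.comp ?_
      rw [← Nat.cofinite_eq_atTop]
      exact Function.Injective.tendsto_cofinite fun a b hab => by simpa using hab
    have h2 : Tendsto (fun M : ℕ => g M) atTop (𝓝 0) := by
      refine hg.comp ?_
      rw [← Nat.cofinite_eq_atTop]
      exact Nat.cast_injective.tendsto_cofinite
    simpa using h1.sub h2
  have hshift : ∀ k : ℤ, Tendsto (fun l => f (l - k)) cofinite (𝓝 0) := fun k =>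
    hf.comp (sub_left_injective.tendsto_cofinite)
  induction k using Int.induction_on with
  | zero => simpa using h
  | succ k ih =>
    have := ih.add (key _ (hshift k))
    rw [add_zero] at this
    refine this.congr fun M => ?_
    rw [← sum_Icc_neg_shift_sub fun l => f (l - k)]
    exact Finset.sum_congr rfl fun l _ => by congr 1; ring
  | pred k ih =>
    have := ih.sub (key _ (hshift (-k - 1)))
    rw [sub_zero] at this
    refine this.congr fun M => ?_
    have h2 := sum_Icc_neg_shift_sub (fun l => f (l - (-k - 1))) M
    rw [sub_eq_iff_eq_add, ← h2]
    exact Finset.sum_congr rfl fun l _ => by congr 1; ring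

/-- The values `∑_{l ≠ 0} x^l / l^i`, in the sense of symmetric summation. -/
noncomputable def lam (x : ℂ) (i : ℕ) : ℂ := if Even i then 2 * signZeta x i else 0

theorem lam_zero {x : ℂ} (hx : x = 1 ∨ x = -1) : lam x 0 = -1 := by
  norm_num [lam, signZeta_zero hx]

theorem sign_zpow_neg {x : ℂ} (hx : x = 1 ∨ x = -1) (l : ℤ) : x ^ (-l) = x ^ l := by
  rcases hx with rfl | rfl
  · simp
  · rw [zpow_neg, ← inv_zpow]; norm_num

theorem norm_sign_zpow {x : ℂ} (hx : x = 1 ∨ x = -1) (l : ℤ) : ‖x ^ l‖ = 1 := by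
  rcases hx with rfl | rfl <;> simp

theorem sign_ne_zero {x : ℂ} (hx : x = 1 ∨ x = -1) : x ≠ 0 := by
  rcases hx with rfl | rfl <;> norm_num

theorem tendsto_sign_zpow_div {x : ℂ} (hx : x = 1 ∨ x = -1) {i : ℕ} (hi : 1 ≤ i) :
    Tendsto (fun l : ℤ => x ^ l / (l : ℂ) ^ i) cofinite (𝓝 0) := by
  rw [tendsto_zero_iff_norm_tendsto_zero]
  have h1 : Tendsto (fun l : ℤ => ‖(l : ℂ)‖) cofinite atTop := by
    simp only [Complex.norm_intCast]
    rw [Int.cofinite_eq, tendsto_sup]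
    exact ⟨tendsto_abs_atBot_atTop.comp (tendsto_intCast_atBot_iff.mpr tendsto_id),
      tendsto_abs_atTop_atTop.comp tendsto_intCast_atTop_atTop⟩
  have h2 := tendsto_inv_atTop_zero.comp ((tendsto_pow_atTop (by omega : i ≠ 0)).comp h1)
  refine h2.congr fun l => ?_
  simp [norm_sign_zpow hx]

theorem tendsto_sum_sign_zpow_div {x : ℂ} (hx : x = 1 ∨ x = -1) {i : ℕ} (hi : 1 ≤ i) :
    Tendsto (fun M : ℕ => ∑ l ∈ Finset.Icc (-(M : ℤ)) M, x ^ l / (l : ℂ) ^ i) atTop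
      (𝓝 (lam x i)) := by
  have hsum : ∀ M : ℕ, ∑ l ∈ Finset.Icc (-(M : ℤ)) M, x ^ l / (l : ℂ) ^ i =
      (1 + (-1) ^ i) * ∑ n ∈ Finset.range (M + 1), x ^ n / (n : ℂ) ^ i := by
    intro M
    induction M with
    | zero => simp [show i ≠ 0 by omega]
    | succ M ih =>
      rw [sum_Icc_neg_succ, ih, Finset.sum_range_succ _ (M + 1), sign_zpow_neg hx]
      push_cast
      rw [show (-((M : ℂ) + 1)) = (-1) * (M + 1) by ring, mul_pow,
        show x ^ ((M : ℤ) + 1) = x ^ (M + 1) by exact_mod_cast zpow_natCast x (M + 1)]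
      rcases neg_one_pow_eq_or ℂ i with h | h <;> rw [h] <;> ring
  simp only [hsum]
  unfold lam
  split_ifs with he
  · have h2 : 1 < (i : ℂ).re := by
      rw [natCast_re]
      exact_mod_cast (show 1 < i by rcases he with ⟨r, hr⟩; omega)
    have := (hasSum_signZeta hx h2).tendsto_sum_nat
    simp only [cpow_natCast] at this
    rw [he.neg_one_pow, show (1 + 1 : ℂ) = 2 by norm_num]
    exact ((tendsto_add_atTop_iff_nat 1).mpr this).const_mul 2
  · rw [(Nat.not_even_iff_odd.mp he).neg_one_pow]
    simp

/-- The germ `X + t`, as a Laurent series. -/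
noncomputable def lin (t : ℂ) : LaurentSeries ℂ := HahnSeries.single 1 1 + HahnSeries.C t

theorem lin_eq (t : ℂ) : lin t = HahnSeries.ofPowerSeries ℤ ℂ (PowerSeries.X + PowerSeries.C t) := by
  simp [lin, HahnSeries.ofPowerSeries_X, HahnSeries.ofPowerSeries_C]

theorem lin_ne_zero (t : ℂ) : lin t ≠ 0 := by
  intro h
  have := congrArg (fun φ : LaurentSeries ℂ => φ.coeff 1) h
  simp [lin, HahnSeries.C_apply] at this

theorem lin_sub_lin (s t : ℂ) : lin s - lin t = HahnSeries.C (s - t) := by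
  simp [lin]

theorem inv_lin_zero_pow (i : ℕ) : (lin 0 ^ i)⁻¹ = HahnSeries.single (-(i : ℤ)) (1 : ℂ) := by
  rw [lin, map_zero, add_zero, HahnSeries.single_pow, HahnSeries.inv_single]
  simp

/-- Coefficients of `(X + t)^(-a)`. -/
noncomputable def invPow (a : ℕ) (t : ℂ) : PowerSeries ℂ :=
  PowerSeries.mk fun k => (-1) ^ k * ((k + a - 1).choose k : ℂ) / t ^ (a + k)

theorem coeff_invPow (a : ℕ) (t : ℂ) (k : ℕ) :
    PowerSeries.coeff k (invPow a t) = (-1) ^ k * ((k + a - 1).choose k : ℂ) / t ^ (a + k) := by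
  simp [invPow]

theorem invPow_zero (t : ℂ) : invPow 0 t = 1 := by
  ext k
  rw [coeff_invPow, PowerSeries.coeff_one]
  rcases k with _ | k
  · simp
  · simp [Nat.choose_succ_self]

theorem X_add_C_mul_invPow (a : ℕ) {t : ℂ} (ht : t ≠ 0) :
    (PowerSeries.X + PowerSeries.C t) * invPow (a + 1) t = invPow a t := by
  ext k
  rw [add_mul, map_add, PowerSeries.coeff_C_mul]
  rcases k with _ | k
  · simp [coeff_invPow]
    field_simp
    ring
  · rw [PowerSeries.coeff_succ_X_mul, coeff_invPow, coeff_invPow, coeff_invPow]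
    rw [show k + (a + 1) - 1 = k + a by omega, show k + 1 + (a + 1) - 1 = k + a + 1 by omega,
      show k + 1 + a - 1 = k + a by omega, Nat.choose_succ_succ]
    push_cast
    field_simp
    ring

theorem inv_lin_pow (a : ℕ) {t : ℂ} (ht : t ≠ 0) :
    (lin t ^ a)⁻¹ = HahnSeries.ofPowerSeries ℤ ℂ (invPow a t) := by
  induction a with
  | zero => simp [invPow_zero]
  | succ a ih =>
    rw [pow_succ, mul_inv, ih, ← X_add_C_mul_invPow a ht, map_mul, ← lin_eq]
    field_simp [lin_ne_zero t]


/-- A product of powers of `(l - k)⁻¹`, `k ∈ K`, with the sign `x^l`, extended by `0` to `K`. -/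
noncomputable def poleTerm (x : ℂ) (K : Finset ℤ) (e : ℤ → ℕ) (l : ℤ) : ℂ :=
  if l ∈ K then 0 else x ^ l / ∏ k ∈ K, ((l : ℂ) - k) ^ e k

/-- The Laurent expansion at `k` of the rational function `∏ k' ∈ K, (z - k')^(-e k')`. -/
noncomputable def germ (K : Finset ℤ) (e : ℤ → ℕ) (k : ℤ) : LaurentSeries ℂ :=
  (∏ k' ∈ K, lin ((k : ℂ) - k') ^ e k')⁻¹

/-- The pairing of a Laurent series with the numbers `lam x i`. -/
noncomputable def lamFun (x : ℂ) (D : ℕ) (φ : LaurentSeries ℂ) : ℂ :=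
  ∑ j ∈ Finset.range (D + 1), lam x j * φ.coeff (-(j : ℤ))

theorem lamFun_sub (x : ℂ) (D : ℕ) (φ ψ : LaurentSeries ℂ) :
    lamFun x D (φ - ψ) = lamFun x D φ - lamFun x D ψ := by
  simp [lamFun, mul_sub, Finset.sum_sub_distrib]

theorem lamFun_C_mul (x : ℂ) (D : ℕ) (t : ℂ) (φ : LaurentSeries ℂ) :
    lamFun x D (HahnSeries.C t * φ) = t * lamFun x D φ := by
  simp only [lamFun, HahnSeries.C_mul_eq_smul, HahnSeries.coeff_smul, Finset.mul_sum, smul_eq_mul]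
  exact Finset.sum_congr rfl fun j _ => by ring

theorem prod_pow_update {R : Type*} [CommRing R] {K : Finset ℤ} {e : ℤ → ℕ} {k : ℤ} (hk : k ∈ K)
    (he : 1 ≤ e k) (f : ℤ → R) :
    ∏ k' ∈ K, f k' ^ e k' = f k * ∏ k' ∈ K, f k' ^ Function.update e k (e k - 1) k' := by
  rw [← Finset.mul_prod_erase K _ hk, ← Finset.mul_prod_erase K (fun k' => f k' ^ _) hk,
    Function.update_self, ← mul_assoc, ← pow_succ', Nat.sub_add_cancel he]
  congr 1
  refine Finset.prod_congr rfl fun j hj => ?_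
  rw [Function.update_of_ne (Finset.ne_of_mem_erase hj)]

theorem sum_update_pred {K : Finset ℤ} {e : ℤ → ℕ} {k : ℤ} (hk : k ∈ K) (he : 1 ≤ e k) :
    ∑ k' ∈ K, e k' = ∑ k' ∈ K, Function.update e k (e k - 1) k' + 1 := by
  rw [← Finset.add_sum_erase K _ hk, ← Finset.add_sum_erase K (Function.update e k (e k - 1)) hk,
    Function.update_self]
  have : ∑ j ∈ K.erase k, Function.update e k (e k - 1) j = ∑ j ∈ K.erase k, e j :=
    Finset.sum_congr rfl fun j hj => by
      rw [Function.update_of_ne (Finset.ne_of_mem_erase hj)]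
  omega

theorem poleTerm_sub (x : ℂ) {K : Finset ℤ} {e : ℤ → ℕ} {k₁ k₂ : ℤ} (h₁ : k₁ ∈ K) (h₂ : k₂ ∈ K)
    (e₁ : 1 ≤ e k₁) (e₂ : 1 ≤ e k₂) (l : ℤ) :
    ((k₂ : ℂ) - k₁) * poleTerm x K e l = poleTerm x K (Function.update e k₁ (e k₁ - 1)) l -
      poleTerm x K (Function.update e k₂ (e k₂ - 1)) l := by
  unfold poleTerm
  split_ifs with hl
  · simp
  have hne : ∀ k ∈ K, (l : ℂ) - k ≠ 0 := fun k hk => by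
    rw [← Int.cast_sub, Int.cast_ne_zero, sub_ne_zero]
    exact fun h => hl (h ▸ hk)
  have A := prod_pow_update h₁ e₁ fun k => (l : ℂ) - k
  have B := prod_pow_update h₂ e₂ fun k => (l : ℂ) - k
  have hP : ∀ e' : ℤ → ℕ, ∏ k ∈ K, ((l : ℂ) - k) ^ e' k ≠ 0 := fun e' =>
    Finset.prod_ne_zero_iff.mpr fun k hk => pow_ne_zero _ (hne k hk)
  have hA := hP (Function.update e k₁ (e k₁ - 1))
  have hB := hP (Function.update e k₂ (e k₂ - 1))
  have h0 := hP e
  rw [div_sub_div _ _ hA hB, mul_div_assoc', div_eq_div_iff h0 (mul_ne_zero hA hB)]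
  linear_combination x ^ l * (∏ k ∈ K, ((l : ℂ) - k) ^ Function.update e k₁ (e k₁ - 1) k) * B -
    x ^ l * (∏ k ∈ K, ((l : ℂ) - k) ^ Function.update e k₂ (e k₂ - 1) k) * A

theorem germ_sub {K : Finset ℤ} {e : ℤ → ℕ} {k₁ k₂ : ℤ} (h₁ : k₁ ∈ K) (h₂ : k₂ ∈ K)
    (e₁ : 1 ≤ e k₁) (e₂ : 1 ≤ e k₂) (k : ℤ) :
    HahnSeries.C ((k₂ : ℂ) - k₁) * germ K e k = germ K (Function.update e k₁ (e k₁ - 1)) k -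
      germ K (Function.update e k₂ (e k₂ - 1)) k := by
  unfold germ
  have A := prod_pow_update h₁ e₁ fun k' => lin ((k : ℂ) - k')
  have B := prod_pow_update h₂ e₂ fun k' => lin ((k : ℂ) - k')
  have hP : ∀ e' : ℤ → ℕ, ∏ k' ∈ K, lin ((k : ℂ) - k') ^ e' k' ≠ 0 := fun e' =>
    Finset.prod_ne_zero_iff.mpr fun k' _ => pow_ne_zero _ (lin_ne_zero _)
  have hA := hP (Function.update e k₁ (e k₁ - 1))
  have hB := hP (Function.update e k₂ (e k₂ - 1))
  have h0 := hP e
  have hC : HahnSeries.C ((k₂ : ℂ) - k₁) = lin ((k : ℂ) - k₁) - lin ((k : ℂ) - k₂) := by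
    rw [lin_sub_lin]; congr 1; ring
  rw [hC, inv_sub_inv hA hB, ← div_eq_mul_inv, div_eq_div_iff h0 (mul_ne_zero hA hB)]
  linear_combination
    (∏ k' ∈ K, lin ((k : ℂ) - k') ^ Function.update e k₁ (e k₁ - 1) k') * B -
    (∏ k' ∈ K, lin ((k : ℂ) - k') ^ Function.update e k₂ (e k₂ - 1) k') * A

theorem lamFun_single {x : ℂ} {D i : ℕ} (hi : i ≤ D) :
    lamFun x D ((lin 0 ^ i)⁻¹) = lam x i := by
  rw [lamFun, inv_lin_zero_pow, Finset.sum_eq_single i]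
  · simp
  · intro j _ hj
    rw [HahnSeries.coeff_single_of_ne (by simpa using hj), mul_zero]
  · intro h
    exact absurd (Finset.mem_range.mpr (by omega)) h

theorem lamFun_ofPowerSeries {x : ℂ} (hx : x = 1 ∨ x = -1) (D : ℕ) (φ : PowerSeries ℂ) :
    lamFun x D (HahnSeries.ofPowerSeries ℤ ℂ φ) = -PowerSeries.coeff 0 φ := by
  rw [lamFun, Finset.sum_eq_single 0]
  · rw [lam_zero hx]
    have := HahnSeries.ofPowerSeries_apply_coeff (Γ := ℤ) φ 0
    simp only [Nat.cast_zero, neg_zero] at this ⊢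
    rw [this]
    ring
  · intro j _ hj
    have : (HahnSeries.ofPowerSeries ℤ ℂ φ).coeff (-(j : ℤ)) = 0 := by
      rw [HahnSeries.ofPowerSeries_apply]
      refine HahnSeries.embDomain_of_notMem_range ?_
      rintro ⟨n, hn⟩
      simp at hn
      omega
    rw [this, mul_zero]
  · simp

theorem tendsto_sum_poleTerm_of_single {x : ℂ} (hx : x = 1 ∨ x = -1) {K : Finset ℤ} {e : ℤ → ℕ}
    {D : ℕ} {k₀ : ℤ} (hk₀ : k₀ ∈ K) (he : 1 ≤ e k₀) (heD : e k₀ ≤ D)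
    (h0 : ∀ k ∈ K, k ≠ k₀ → e k = 0) :
    Tendsto (fun M : ℕ => ∑ l ∈ Finset.Icc (-(M : ℤ)) M, poleTerm x K e l) atTop
      (𝓝 (∑ k ∈ K, x ^ k * lamFun x D (germ K e k))) := by
  have hx0 := sign_ne_zero hx
  set h : ℤ → ℂ := fun l => x ^ l / (l : ℂ) ^ e k₀ with hh
  have hprod : ∀ {R : Type} [CommRing R] (f : ℤ → R), ∏ k ∈ K, f k ^ e k = f k₀ ^ e k₀ := by
    intro R _ f
    refine Finset.prod_eq_single_of_mem k₀ hk₀ fun k hk hne => ?_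
    rw [h0 k hk hne, pow_zero]
  have hterm : ∀ l, poleTerm x K e l = if l ∈ K then 0 else x ^ k₀ * h (l - k₀) := by
    intro l
    unfold poleTerm
    rw [hprod fun k => (l : ℂ) - k, hh]
    simp only [zpow_sub₀ hx0, Int.cast_sub]
    split_ifs
    · rfl
    · field_simp
  have hgerm : ∀ k ∈ K, x ^ k * lamFun x D (germ K e k) =
      (if k = k₀ then x ^ k₀ * lam x (e k₀) else 0) - x ^ k₀ * h (k - k₀) := by
    intro k hk
    rw [germ, hprod fun k' => lin ((k : ℂ) - k')]
    by_cases hkk : k = k₀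
    · subst hkk
      rw [sub_self, lamFun_single heD, if_pos rfl, hh]
      simp [show e k ≠ 0 by omega]
    · have ht : (k : ℂ) - k₀ ≠ 0 := by
        rw [← Int.cast_sub, Int.cast_ne_zero, sub_ne_zero]
        exact hkk
      rw [inv_lin_pow _ ht, lamFun_ofPowerSeries hx, coeff_invPow, if_neg hkk, hh]
      simp only [zpow_sub₀ hx0, Int.cast_sub]
      field_simp
      simp [mul_comm]
  rw [Finset.sum_congr rfl hgerm, Finset.sum_sub_distrib, Finset.sum_ite_eq' K k₀, if_pos hk₀]
  have h1 := ((tendsto_sum_Icc_shift (tendsto_sign_zpow_div hx he)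
    (tendsto_sum_sign_zpow_div hx he) k₀).const_mul (x ^ k₀)).sub_const
      (∑ k ∈ K, x ^ k₀ * h (k - k₀))
  refine h1.congr' ?_
  have h2 := Finset.tendsto_Icc_neg (R := ℤ) |>.eventually (eventually_ge_atTop K)
  filter_upwards [h2] with M hM
  have hz : ∑ l ∈ K, poleTerm x K e l = 0 :=
    Finset.sum_eq_zero fun l hl => by rw [hterm, if_pos hl]
  rw [Finset.mul_sum, ← Finset.sum_sdiff hM, ← Finset.sum_sdiff (f := poleTerm x K e) hM, hz,
    add_sub_cancel_right, add_zero]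
  refine Finset.sum_congr rfl fun l hl => ?_
  rw [hterm, if_neg (Finset.mem_sdiff.mp hl).2]

/-- Symmetric summation of a rational function over the integers that are not poles. -/
theorem tendsto_sum_poleTerm {x : ℂ} (hx : x = 1 ∨ x = -1) (K : Finset ℤ) {D : ℕ} (e : ℤ → ℕ)
    (he : 1 ≤ ∑ k ∈ K, e k) (hD : ∀ k ∈ K, e k ≤ D) :
    Tendsto (fun M : ℕ => ∑ l ∈ Finset.Icc (-(M : ℤ)) M, poleTerm x K e l) atTop
      (𝓝 (∑ k ∈ K, x ^ k * lamFun x D (germ K e k))) := by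
  induction hN : ∑ k ∈ K, e k generalizing e with
  | zero => omega
  | succ N ih =>
    by_cases hex : ∃ k₁ ∈ K, ∃ k₂ ∈ K, k₁ ≠ k₂ ∧ 1 ≤ e k₁ ∧ 1 ≤ e k₂
    · obtain ⟨k₁, h₁, k₂, h₂, hne, e₁, e₂⟩ := hex
      have hstep : ∀ k ∈ K, ∀ k' ∈ K, k ≠ k' → 1 ≤ e k → 1 ≤ e k' →
          Tendsto (fun M : ℕ => ∑ l ∈ Finset.Icc (-(M : ℤ)) M,
            poleTerm x K (Function.update e k (e k - 1)) l) atTop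
          (𝓝 (∑ j ∈ K, x ^ j * lamFun x D (germ K (Function.update e k (e k - 1)) j))) := by
        intro k hk k' hk' hkk ek ek'
        refine ih _ ?_ ?_ ?_
        · refine le_trans ?_ (Finset.single_le_sum (fun _ _ => Nat.zero_le _) hk')
          rwa [Function.update_of_ne hkk.symm]
        · intro j hj
          rw [Function.update_apply]
          split_ifs with hjk
          · have := hD k hk; omega
          · exact hD j hj
        · have := sum_update_pred hk ek; omega
      have hsub := (hstep k₁ h₁ k₂ h₂ hne e₁ e₂).sub (hstep k₂ h₂ k₁ h₁ hne.symm e₂ e₁)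
      have hc : (k₂ : ℂ) - k₁ ≠ 0 := by
        rw [← Int.cast_sub, Int.cast_ne_zero, sub_ne_zero]
        exact hne.symm
      have := hsub.const_mul ((k₂ : ℂ) - k₁)⁻¹
      have hlim : ((k₂ : ℂ) - k₁)⁻¹ *
          (∑ j ∈ K, x ^ j * lamFun x D (germ K (Function.update e k₁ (e k₁ - 1)) j) -
            ∑ j ∈ K, x ^ j * lamFun x D (germ K (Function.update e k₂ (e k₂ - 1)) j)) =
          ∑ k ∈ K, x ^ k * lamFun x D (germ K e k) := by
        rw [inv_mul_eq_iff_eq_mul₀ hc, ← Finset.sum_sub_distrib, Finset.mul_sum]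
        refine Finset.sum_congr rfl fun j _ => ?_
        rw [← mul_sub, ← lamFun_sub, ← germ_sub h₁ h₂ e₁ e₂, lamFun_C_mul]
        ring
      rw [hlim] at this
      refine this.congr fun M => ?_
      rw [inv_mul_eq_iff_eq_mul₀ hc, ← Finset.sum_sub_distrib, Finset.mul_sum]
      exact Finset.sum_congr rfl fun l _ => (poleTerm_sub x h₁ h₂ e₁ e₂ l).symm
    · push Not at hex
      obtain ⟨k₀, hk₀, hpos⟩ : ∃ k ∈ K, 1 ≤ e k := by
        by_contra! hcon
        have : ∑ k ∈ K, e k = 0 := Finset.sum_eq_zero fun k hk => by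
          have := hcon k hk; omega
        omega
      refine tendsto_sum_poleTerm_of_single hx hk₀ hpos (hD k₀ hk₀) fun k hk hne => ?_
      have := hex k₀ hk₀ k hk hne.symm hpos
      omega

theorem tsum_poleTerm {x : ℂ} (hx : x = 1 ∨ x = -1) (K : Finset ℤ) {D : ℕ} (e : ℤ → ℕ)
    (he : 1 ≤ ∑ k ∈ K, e k) (hD : ∀ k ∈ K, e k ≤ D) (hs : Summable (poleTerm x K e)) :
    ∑' l, poleTerm x K e l = ∑ k ∈ K, x ^ k * lamFun x D (germ K e k) :=
  tendsto_nhds_unique (hs.hasSum.comp (Finset.tendsto_Icc_neg (R := ℤ)))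
    (tendsto_sum_poleTerm hx K e he hD)


theorem coeff_inv_lin_zero_pow_mul (P : ℕ) (φ : PowerSeries ℂ) (j : ℕ) :
    ((lin 0 ^ P)⁻¹ * HahnSeries.ofPowerSeries ℤ ℂ φ).coeff (-(j : ℤ)) =
      if j ≤ P then PowerSeries.coeff (P - j) φ else 0 := by
  rw [inv_lin_zero_pow, HahnSeries.coeff_single_mul, one_mul, sub_neg_eq_add]
  split_ifs with h
  · rw [show -(j : ℤ) + P = ((P - j : ℕ) : ℤ) by omega]
    exact HahnSeries.ofPowerSeries_apply_coeff (Γ := ℤ) φ (P - j)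
  · rw [HahnSeries.ofPowerSeries_apply]
    refine HahnSeries.embDomain_of_notMem_range ?_
    rintro ⟨n, hn⟩
    simp at hn
    omega

theorem lamFun_inv_lin_zero_pow_mul (x : ℂ) {P D : ℕ} (hP : P ≤ D) (φ : PowerSeries ℂ) :
    lamFun x D ((lin 0 ^ P)⁻¹ * HahnSeries.ofPowerSeries ℤ ℂ φ) =
      2 * ∑ k ∈ Finset.range (P / 2 + 1),
        signZeta x (2 * k) * PowerSeries.coeff (P - 2 * k) φ := by
  simp only [lamFun, coeff_inv_lin_zero_pow_mul, lam]
  rw [Finset.mul_sum]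
  symm
  refine Finset.sum_of_injOn (fun k => 2 * k) (fun a _ b _ h => by simpa using h) ?_ ?_ ?_
  · intro k hk
    simp only [Finset.coe_range, Set.mem_Iio] at hk ⊢
    omega
  · intro j _ hj
    by_cases he : Even j
    · rcases he with ⟨r, hr⟩
      have : ¬ j ≤ P := fun hjP => hj ⟨r, by simp; omega, by simp only; omega⟩
      rw [if_neg this, mul_zero]
    · rw [if_neg he, zero_mul]
  · intro k hk
    rw [Finset.mem_range] at hk
    rw [if_pos (even_two_mul k), if_pos (by omega : 2 * k ≤ P)]
    push_cast
    ring

/-- The multiplicities of the poles `0` and `-m`. -/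
def twoPoles (P Q : ℕ) (k : ℤ) : ℕ := if k = 0 then P else Q

theorem tsum_poleTerm_two {x : ℂ} (hx : x = 1 ∨ x = -1) {P Q : ℕ} (hP : 0 < P) (hQ : 0 < Q)
    {m : ℕ} (hm : 0 < m) (hs : Summable (poleTerm x {0, -(m : ℤ)} (twoPoles P Q))) :
    ∑' l, poleTerm x {0, -(m : ℤ)} (twoPoles P Q) l =
      2 * (-1) ^ P * ∑ k ∈ Finset.range (P / 2 + 1), signZeta x (2 * k) *
          ((P + Q - 1 - 2 * k).choose (Q - 1) : ℂ) / (m : ℂ) ^ (P + Q - 2 * k) +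
      x ^ m * (2 * (-1) ^ P * ∑ k ∈ Finset.range (Q / 2 + 1), signZeta x (2 * k) *
          ((P + Q - 1 - 2 * k).choose (P - 1) : ℂ) / (m : ℂ) ^ (P + Q - 2 * k)) := by
  have h0 : (0 : ℤ) ≠ -(m : ℤ) := by omega
  have hm0 : (m : ℂ) ≠ 0 := by exact_mod_cast hm.ne'
  have hm0' : -(m : ℂ) ≠ 0 := neg_ne_zero.mpr hm0
  have e0 : twoPoles P Q 0 = P := if_pos rfl
  have e1 : twoPoles P Q (-(m : ℤ)) = Q := if_neg h0.symm
  rw [tsum_poleTerm hx {0, -(m : ℤ)} (D := P + Q) (twoPoles P Q)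
    (by rw [Finset.sum_pair h0, e0, e1]; omega)
    (by intro k _; unfold twoPoles; split_ifs <;> omega) hs, Finset.sum_pair h0]
  have g0 : germ {0, -(m : ℤ)} (twoPoles P Q) 0 =
      (lin 0 ^ P)⁻¹ * HahnSeries.ofPowerSeries ℤ ℂ (invPow Q m) := by
    rw [germ, Finset.prod_pair h0, e0, e1, mul_inv, ← inv_lin_pow Q hm0]
    simp
  have g1 : germ {0, -(m : ℤ)} (twoPoles P Q) (-(m : ℤ)) =
      (lin 0 ^ Q)⁻¹ * HahnSeries.ofPowerSeries ℤ ℂ (invPow P (-m)) := by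
    rw [germ, Finset.prod_pair h0, e0, e1, mul_inv, ← inv_lin_pow P hm0', mul_comm]
    simp
  rw [g0, g1, lamFun_inv_lin_zero_pow_mul x (by omega), lamFun_inv_lin_zero_pow_mul x (by omega),
    zpow_zero, one_mul, sign_zpow_neg hx, zpow_natCast]
  congr 1
  · simp only [Finset.mul_sum]
    refine Finset.sum_congr rfl fun k hk => ?_
    rw [Finset.mem_range] at hk
    rw [coeff_invPow, show P - 2 * k + Q - 1 = P + Q - 1 - 2 * k by omega,
      show Q + (P - 2 * k) = P + Q - 2 * k by omega,
      ← Nat.choose_symm_of_eq_add (show P + Q - 1 - 2 * k = (Q - 1) + (P - 2 * k) by omega)]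
    have : (-1 : ℂ) ^ P = (-1) ^ (P - 2 * k) := by
      conv_lhs => rw [show P = P - 2 * k + 2 * k by omega, pow_add, pow_mul]
      simp
    rw [this]
    ring
  · congr 1
    simp only [Finset.mul_sum]
    refine Finset.sum_congr rfl fun k hk => ?_
    rw [Finset.mem_range] at hk
    rw [coeff_invPow, show Q - 2 * k + P - 1 = P + Q - 1 - 2 * k by omega,
      show P + (Q - 2 * k) = P + Q - 2 * k by omega,
      ← Nat.choose_symm_of_eq_add (show P + Q - 1 - 2 * k = (P - 1) + (Q - 2 * k) by omega),
      neg_pow (m : ℂ)]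
    have : (-1 : ℂ) ^ (P + Q - 2 * k) = (-1) ^ P * (-1) ^ (Q - 2 * k) := by
      rw [← pow_add]; congr 1; omega
    rw [this]
    have h1 : ((-1 : ℂ) ^ P) ≠ 0 := by simp
    have h2 : ((-1 : ℂ) ^ (Q - 2 * k)) ≠ 0 := by simp
    have h3 : ((-1 : ℂ) ^ P) * (-1) ^ P = 1 := by rw [← mul_pow]; simp
    field_simp
    linear_combination (-(signZeta x (2 * k)) * ((P + Q - 1 - 2 * k).choose (P - 1) : ℂ)) * h3

/-- The series for `𝔗`, extended by zero. -/
noncomputable def tExt (P : ℕ) (s : ℂ) (Q : ℕ) (x y : ℂ) (i : ℕ+ × ℤ) : ℂ :=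
  y ^ (i.1 : ℕ) / ((i.1 : ℕ) : ℂ) ^ s * poleTerm x {0, -((i.1 : ℕ) : ℤ)} (twoPoles P Q) i.2

theorem tExt_of_mem (P : ℕ) (s : ℂ) (Q : ℕ) (x y : ℂ) (i : TIndex) :
    tTerm P s Q x y i = tExt P s Q x y (i.1.2, i.1.1) := by
  obtain ⟨⟨l, m⟩, h1, h2⟩ := i
  simp only at h1 h2
  have hl : l ∉ ({0, -((m : ℕ) : ℤ)} : Finset ℤ) := by
    simp only [Finset.mem_insert, Finset.mem_singleton, not_or]
    exact ⟨h1, fun h => h2 (by rw [h]; simp)⟩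
  have h0 : (0 : ℤ) ≠ -((m : ℕ) : ℤ) := by have := m.pos; omega
  simp only [tTerm, tExt, poleTerm, if_neg hl, Finset.prod_pair h0, twoPoles, if_neg h0.symm]
  simp only [if_true, Int.cast_zero, sub_zero, Int.cast_neg, sub_neg_eq_add, Int.cast_add,
    Int.cast_natCast]
  rw [div_mul_div_comm]
  congr 1 <;> ring

theorem tExt_eq_zero (P : ℕ) (s : ℂ) (Q : ℕ) (x y : ℂ) (i : ℕ+ × ℤ)
    (h : ¬ (i.2 ≠ 0 ∧ i.2 + (i.1 : ℤ) ≠ 0)) : tExt P s Q x y i = 0 := by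
  rw [tExt, poleTerm, if_pos, mul_zero]
  simp only [Finset.mem_insert, Finset.mem_singleton]
  by_contra hcon
  push Not at hcon
  exact h ⟨hcon.1, fun h2 => hcon.2 (by omega)⟩

theorem summable_pnat_rpow {σ : ℝ} (hσ : 1 < σ) : Summable fun m : ℕ+ => 1 / ((m : ℕ) : ℝ) ^ σ :=
  (Real.summable_one_div_nat_rpow.mpr hσ).comp_injective PNat.coe_injective

theorem summable_pnat_int_majorant {σ : ℝ} (hσ : 1 < σ) :
    Summable fun i : ℕ+ × ℤ => 1 / ((i.1 : ℕ) : ℝ) ^ σ *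
      (1 / (i.2 : ℝ) ^ 2 + 1 / ((i.2 : ℝ) + (i.1 : ℕ)) ^ 2) := by
  have h1 : Summable fun i : ℕ+ × ℤ => 1 / ((i.1 : ℕ) : ℝ) ^ σ * (1 / (i.2 : ℝ) ^ 2) :=
    Summable.mul_of_nonneg (f := fun m : ℕ+ => 1 / ((m : ℕ) : ℝ) ^ σ)
      (g := fun l : ℤ => 1 / (l : ℝ) ^ 2) (summable_pnat_rpow hσ)
      (Real.summable_one_div_int_pow.mpr one_lt_two)
      (fun m => one_div_nonneg.mpr (Real.rpow_nonneg (Nat.cast_nonneg _) _))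
      (fun l => one_div_nonneg.mpr (sq_nonneg _))
  let E : ℕ+ × ℤ ≃ ℕ+ × ℤ :=
    { toFun := fun i => (i.1, i.2 + (i.1 : ℕ))
      invFun := fun i => (i.1, i.2 - (i.1 : ℕ))
      left_inv := fun i => by simp
      right_inv := fun i => by simp }
  have h2 := E.summable_iff.mpr h1
  refine (h1.add h2).congr fun i => ?_
  simp only [Function.comp_apply, E, Equiv.coe_fn_mk]
  push_cast
  ring

theorem inv_abs_mul_inv_abs_le {u v : ℝ} : 1 / (|u| * |v|) ≤ 1 / u ^ 2 + 1 / v ^ 2 := by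
  have := two_mul_le_add_sq (1 / |u|) (1 / |v|)
  have h3 : 0 ≤ 1 / |u| * (1 / |v|) := by positivity
  simp only [div_pow, one_pow, sq_abs] at this
  rw [← one_div_mul_one_div]
  linarith

theorem norm_tExt_le {P Q : ℕ} (hP : 0 < P) (hQ : 0 < Q) {x y : ℂ} (hx : x = 1 ∨ x = -1)
    (hy : y = 1 ∨ y = -1) (s : ℂ) (i : ℕ+ × ℤ) :
    ‖tExt P s Q x y i‖ ≤ 1 / ((i.1 : ℕ) : ℝ) ^ s.re *
      (1 / (i.2 : ℝ) ^ 2 + 1 / ((i.2 : ℝ) + (i.1 : ℕ)) ^ 2) := by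
  by_cases h : i.2 ≠ 0 ∧ i.2 + (i.1 : ℤ) ≠ 0
  swap
  · rw [tExt_eq_zero _ _ _ _ _ _ h, norm_zero]
    positivity
  have hm : (0 : ℝ) < ((i.1 : ℕ) : ℝ) := by exact_mod_cast i.1.pos
  have key := tExt_of_mem P s Q x y ⟨(i.2, i.1), h⟩
  simp only [Prod.mk.eta] at key
  rw [← key]
  simp only [tTerm, norm_div, norm_mul, norm_pow, norm_sign_zpow hx]
  have hy1 : ‖y‖ = 1 := by rcases hy with rfl | rfl <;> simp
  rw [hy1, one_pow, one_mul, Complex.norm_intCast, Complex.norm_intCast,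
    norm_natCast_cpow_of_pos i.1.pos]
  have hu : (1 : ℝ) ≤ |(i.2 : ℝ)| := by exact_mod_cast Int.one_le_abs h.1
  have hv : (1 : ℝ) ≤ |((i.2 + ((i.1 : ℕ) : ℤ) : ℤ) : ℝ)| := by
    exact_mod_cast Int.one_le_abs h.2
  have hup : |(i.2 : ℝ)| ≤ |(i.2 : ℝ)| ^ P := le_self_pow₀ hu hP.ne'
  have hvp := le_self_pow₀ hv hQ.ne'
  have hms : (0 : ℝ) < ((i.1 : ℕ) : ℝ) ^ s.re := Real.rpow_pos_of_pos hm _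
  calc 1 / (|(i.2 : ℝ)| ^ P * ((i.1 : ℕ) : ℝ) ^ s.re *
        |((i.2 + ((i.1 : ℕ) : ℤ) : ℤ) : ℝ)| ^ Q)
      ≤ 1 / (|(i.2 : ℝ)| * ((i.1 : ℕ) : ℝ) ^ s.re * |((i.2 + ((i.1 : ℕ) : ℤ) : ℤ) : ℝ)|) := by
        gcongr
    _ = 1 / ((i.1 : ℕ) : ℝ) ^ s.re *
        (1 / (|(i.2 : ℝ)| * |((i.2 + ((i.1 : ℕ) : ℤ) : ℤ) : ℝ)|)) := by
        rw [one_div_mul_one_div]; ring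
    _ ≤ _ := by
        refine mul_le_mul_of_nonneg_left ?_ (by positivity)
        have := @inv_abs_mul_inv_abs_le (i.2 : ℝ) ((i.2 + ((i.1 : ℕ) : ℤ) : ℤ) : ℝ)
        push_cast at this ⊢
        exact this

theorem summable_tExt {P Q : ℕ} (hP : 0 < P) (hQ : 0 < Q) {x y : ℂ} (hx : x = 1 ∨ x = -1)
    (hy : y = 1 ∨ y = -1) {s : ℂ} (hs : 1 < s.re) : Summable (tExt P s Q x y) :=
  Summable.of_norm_bounded (summable_pnat_int_majorant hs) (norm_tExt_le hP hQ hx hy s)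

theorem tIndex_injective : Function.Injective fun i : TIndex => (i.1.2, i.1.1) := by
  rintro ⟨⟨l, m⟩, h⟩ ⟨⟨l', m'⟩, h'⟩ hh
  simp only [Prod.mk.injEq] at hh
  simp [hh.1, hh.2]

theorem summable_tTerm {P Q : ℕ} (hP : 0 < P) (hQ : 0 < Q) {x y : ℂ} (hx : x = 1 ∨ x = -1)
    (hy : y = 1 ∨ y = -1) {s : ℂ} (hs : 1 < s.re) : Summable (tTerm P s Q x y) :=
  ((summable_tExt hP hQ hx hy hs).comp_injective tIndex_injective).congr
    fun i => (tExt_of_mem P s Q x y i).symm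

theorem tsum_tTerm (P : ℕ) (s : ℂ) (Q : ℕ) (x y : ℂ) :
    ∑' i, tTerm P s Q x y i = ∑' i, tExt P s Q x y i := by
  rw [tsum_congr (tExt_of_mem P s Q x y)]
  refine tIndex_injective.tsum_eq fun i hi => ?_
  by_contra hcon
  refine hi (tExt_eq_zero _ _ _ _ _ _ fun h => hcon ?_)
  exact ⟨⟨(i.2, i.1), h⟩, rfl⟩

theorem hasSum_signZeta_pnat {e s : ℂ} (he : e = 1 ∨ e = -1) (hs : 1 < s.re) :
    HasSum (fun n : ℕ+ => e ^ (n : ℕ) / ((n : ℕ) : ℂ) ^ s) (signZeta e s) := by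
  refine (PNat.coe_injective.hasSum_iff (f := fun n : ℕ => e ^ n / (n : ℂ) ^ s) ?_).mpr
    (hasSum_signZeta he hs)
  intro n hn
  have : n = 0 := by
    by_contra h0
    exact hn ⟨⟨n, Nat.pos_of_ne_zero h0⟩, rfl⟩
  subst this
  have hs0 : s ≠ 0 := by rintro rfl; simp at hs; linarith
  simp [zero_cpow hs0]

/-- The right side of the evaluation of `𝔗(P, s, Q; x, y)`. -/
noncomputable def tValue (P Q : ℕ) (x y s : ℂ) : ℂ :=
  2 * (-1) ^ P * ∑ k ∈ Finset.range (P / 2 + 1), signZeta x (2 * k) *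
      ((P + Q - 1 - 2 * k).choose (Q - 1) : ℂ) * signZeta y (s + P + Q - 2 * k) +
    2 * (-1) ^ P * ∑ k ∈ Finset.range (Q / 2 + 1), signZeta x (2 * k) *
      ((P + Q - 1 - 2 * k).choose (P - 1) : ℂ) * signZeta (x * y) (s + P + Q - 2 * k)

theorem sign_mul {x y : ℂ} (hx : x = 1 ∨ x = -1) (hy : y = 1 ∨ y = -1) :
    x * y = 1 ∨ x * y = -1 := by
  rcases hx with rfl | rfl <;> rcases hy with rfl | rfl <;> norm_num

theorem tsum_tTerm_eq_tValue {P Q : ℕ} (hP : 0 < P) (hQ : 0 < Q) {x y : ℂ} (hx : x = 1 ∨ x = -1)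
    (hy : y = 1 ∨ y = -1) {s : ℂ} (hs : 1 < s.re) :
    ∑' i, tTerm P s Q x y i = tValue P Q x y s := by
  have hsum := summable_tExt hP hQ hx hy hs
  rw [tsum_tTerm, hsum.tsum_prod]
  have hin : ∀ m : ℕ+, ∑' l, tExt P s Q x y (m, l) =
      2 * (-1) ^ P * ∑ k ∈ Finset.range (P / 2 + 1), signZeta x (2 * k) *
          ((P + Q - 1 - 2 * k).choose (Q - 1) : ℂ) *
            (y ^ (m : ℕ) / ((m : ℕ) : ℂ) ^ (s + P + Q - 2 * k)) +
      2 * (-1) ^ P * ∑ k ∈ Finset.range (Q / 2 + 1), signZeta x (2 * k) *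
          ((P + Q - 1 - 2 * k).choose (P - 1) : ℂ) *
            ((x * y) ^ (m : ℕ) / ((m : ℕ) : ℂ) ^ (s + P + Q - 2 * k)) := by
    intro m
    have hm0 : ((m : ℕ) : ℂ) ≠ 0 := by exact_mod_cast m.ne_zero
    have hms : ((m : ℕ) : ℂ) ^ s ≠ 0 := by rw [Ne, cpow_eq_zero_iff]; tauto
    have hfib : Summable (poleTerm x {0, -((m : ℕ) : ℤ)} (twoPoles P Q)) := by
      refine (summable_mul_left_iff (a := y ^ (m : ℕ) / ((m : ℕ) : ℂ) ^ s) ?_).mp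
        (hsum.prod_factor m)
      exact div_ne_zero (pow_ne_zero _ (sign_ne_zero hy)) hms
    have hpow : ∀ k : ℕ, 2 * k ≤ P + Q → ((m : ℕ) : ℂ) ^ (s + P + Q - 2 * k) =
        ((m : ℕ) : ℂ) ^ s * ((m : ℕ) : ℂ) ^ (P + Q - 2 * k) := by
      intro k hk
      rw [← cpow_natCast, ← cpow_add _ _ hm0]
      congr 1
      push_cast [Nat.cast_sub hk]
      ring
    simp only [tExt]
    rw [tsum_mul_left, tsum_poleTerm_two hx hP hQ m.pos hfib, mul_add]
    congr 1
    · simp only [Finset.mul_sum]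
      refine Finset.sum_congr rfl fun k hk => ?_
      rw [Finset.mem_range] at hk
      rw [hpow k (by omega)]
      field_simp
    · simp only [Finset.mul_sum]
      refine Finset.sum_congr rfl fun k hk => ?_
      rw [Finset.mem_range] at hk
      rw [hpow k (by omega), mul_pow]
      field_simp
  simp only [hin]
  have hre : ∀ k : ℕ, 2 * k + 1 ≤ P + Q → 1 < (s + P + Q - 2 * k).re := by
    intro k hk
    have : ((2 * k + 1 : ℕ) : ℝ) ≤ ((P + Q : ℕ) : ℝ) := by exact_mod_cast hk
    push_cast at this
    simp
    linarith
  refine HasSum.tsum_eq (HasSum.add (HasSum.mul_left _ ?_) (HasSum.mul_left _ ?_))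
  · refine hasSum_sum fun k hk => HasSum.mul_left _ (hasSum_signZeta_pnat hy (hre k ?_))
    rw [Finset.mem_range] at hk
    omega
  · refine hasSum_sum fun k hk => HasSum.mul_left _ (hasSum_signZeta_pnat (sign_mul hx hy) (hre k ?_))
    rw [Finset.mem_range] at hk
    omega

theorem meromorphicAt_signZeta_shift {e : ℂ} (he : e = 1 ∨ e = -1) (t s : ℂ) :
    MeromorphicAt (fun z => signZeta e (z + t)) s :=
  meromorphicAt_comp_add_const t (meromorphicAt_signZeta he (s + t))

theorem analyticAt_tValue {P Q : ℕ} {x y s : ℂ}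
    (h1 : ∀ k ∈ Finset.range (P / 2 + 1), AnalyticAt ℂ (signZeta y) (s + P + Q - 2 * k))
    (h2 : ∀ k ∈ Finset.range (Q / 2 + 1), AnalyticAt ℂ (signZeta (x * y)) (s + P + Q - 2 * k)) :
    AnalyticAt ℂ (tValue P Q x y) s := by
  have hc : ∀ k : ℕ, AnalyticAt ℂ (fun z : ℂ => z + P + Q - 2 * k) s := fun k => by fun_prop
  unfold tValue
  refine (analyticAt_const.mul ?_).add (analyticAt_const.mul ?_)
  · refine Finset.analyticAt_fun_sum _ fun k hk => analyticAt_const.mul ?_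
    exact (h1 k hk).comp_of_eq (f := fun z : ℂ => z + P + Q - 2 * k) (hc k) rfl
  · refine Finset.analyticAt_fun_sum _ fun k hk => analyticAt_const.mul ?_
    exact (h2 k hk).comp_of_eq (f := fun z : ℂ => z + P + Q - 2 * k) (hc k) rfl

theorem meromorphicAt_tValue (P Q : ℕ) {x y : ℂ} (hx : x = 1 ∨ x = -1) (hy : y = 1 ∨ y = -1)
    (s : ℂ) : MeromorphicAt (tValue P Q x y) s := by
  have hc : ∀ k : ℕ, AnalyticAt ℂ (fun z : ℂ => z + P + Q - 2 * k) s := fun k => by fun_prop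
  have hm : ∀ (e : ℂ), (e = 1 ∨ e = -1) → ∀ k : ℕ,
      MeromorphicAt (fun z : ℂ => signZeta e (z + P + Q - 2 * k)) s := by
    intro e he k
    have := meromorphicAt_signZeta_shift he (P + Q - 2 * k) s
    refine this.congr (Filter.Eventually.of_forall fun z => ?_)
    simp only
    congr 1
    ring
  unfold tValue
  refine MeromorphicAt.fun_add ?_ ?_
  · refine MeromorphicAt.fun_mul (MeromorphicAt.const _ _) ?_
    refine MeromorphicAt.fun_sum fun k _ => ?_
    exact MeromorphicAt.fun_mul (MeromorphicAt.const _ _) (hm _ hy k)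
  · refine MeromorphicAt.fun_mul (MeromorphicAt.const _ _) ?_
    refine MeromorphicAt.fun_sum fun k _ => ?_
    exact MeromorphicAt.fun_mul (MeromorphicAt.const _ _) (hm _ (sign_mul hx hy) k)

theorem isMeroContinuation_T {P Q : ℕ} (hP : 0 < P) (hQ : 0 < Q) {x y : ℂ} (hx : x = 1 ∨ x = -1)
    (hy : y = 1 ∨ y = -1) :
    IsMeroContinuation (fun s => ∑' i, tTerm P s Q x y i) (fun s => T P s Q x y) ∧
      ∀ s, AnalyticAt ℂ (tValue P Q x y) s → T P s Q x y = tValue P Q x y s := by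
  have hne : ∀ s : ℂ, 1 < s.re → ∀ k : ℕ, 2 * k + 1 ≤ P + Q → s + P + Q - 2 * k ≠ 1 := by
    intro s hs k hk h
    have : ((2 * k + 1 : ℕ) : ℝ) ≤ ((P + Q : ℕ) : ℝ) := by exact_mod_cast hk
    have h2 := congrArg re h
    push_cast at this
    simp at h2
    linarith
  refine isMeroContinuation_of_meromorphic (f := fun s => ∑' i, tTerm P s Q x y i)
    (meromorphicAt_tValue P Q hx hy) (fun s hs => ?_)
    fun s hs => (tsum_tTerm_eq_tValue hP hQ hx hy hs).symm
  refine analyticAt_tValue (fun k hk => ?_) fun k hk => ?_ <;> rw [Finset.mem_range] at hk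
  · exact analyticAt_signZeta hy (hne s hs k (by omega))
  · exact analyticAt_signZeta (sign_mul hx hy) (hne s hs k (by omega))

theorem T_one_neg_one {P Q : ℕ} (hP : 0 < P) (hQ : 0 < Q) (s : ℂ) :
    T P s Q 1 (-1) =
      2 * (-1) ^ P * ∑ k ∈ Finset.range (P / 2 + 1),
        riemannZeta (2 * k) * ((P + Q - 1 - 2 * k).choose (Q - 1) : ℂ) *
          phi (s + P + Q - 2 * k) +
      2 * (-1) ^ P * ∑ k ∈ Finset.range (Q / 2 + 1),
        riemannZeta (2 * k) * ((P + Q - 1 - 2 * k).choose (P - 1) : ℂ) *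
          phi (s + P + Q - 2 * k) := by
  rw [(isMeroContinuation_T hP hQ (Or.inl rfl) (Or.inr rfl)).2 s]
  · simp [tValue]
  · exact analyticAt_tValue (fun k _ => by simpa using analyticAt_phi _)
      fun k _ => by simpa using analyticAt_phi _

theorem T_neg_one_one {P Q : ℕ} (hP : 0 < P) (hQ : 0 < Q) {s : ℂ}
    (hs : ∀ k ∈ Finset.range (P / 2 + 1), s + P + Q - 2 * k ≠ 1) :
    T P s Q (-1) 1 =
      2 * (-1) ^ P * ∑ k ∈ Finset.range (P / 2 + 1),
        phi (2 * k) * ((P + Q - 1 - 2 * k).choose (Q - 1) : ℂ) *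
          riemannZeta (s + P + Q - 2 * k) +
      2 * (-1) ^ P * ∑ k ∈ Finset.range (Q / 2 + 1),
        phi (2 * k) * ((P + Q - 1 - 2 * k).choose (P - 1) : ℂ) *
          phi (s + P + Q - 2 * k) := by
  rw [(isMeroContinuation_T hP hQ (Or.inr rfl) (Or.inl rfl)).2 s]
  · simp [tValue]
  · exact analyticAt_tValue (fun k hk => by simpa using analyticAt_riemannZeta (hs k hk))
      fun k _ => by simpa using analyticAt_phi _

theorem T_neg_one_neg_one {P Q : ℕ} (hP : 0 < P) (hQ : 0 < Q) {s : ℂ}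
    (hs : ∀ k ∈ Finset.range (Q / 2 + 1), s + P + Q - 2 * k ≠ 1) :
    T P s Q (-1) (-1) =
      2 * (-1) ^ P * ∑ k ∈ Finset.range (P / 2 + 1),
        phi (2 * k) * ((P + Q - 1 - 2 * k).choose (Q - 1) : ℂ) *
          phi (s + P + Q - 2 * k) +
      2 * (-1) ^ P * ∑ k ∈ Finset.range (Q / 2 + 1),
        phi (2 * k) * ((P + Q - 1 - 2 * k).choose (P - 1) : ℂ) *
          riemannZeta (s + P + Q - 2 * k) := by
  rw [(isMeroContinuation_T hP hQ (Or.inr rfl) (Or.inr rfl)).2 s]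
  · simp [tValue]
  · exact analyticAt_tValue (fun k _ => by simpa using analyticAt_phi _)
      fun k hk => by simpa using analyticAt_riemannZeta (hs k hk)


theorem X_add_C_ne_zero (t : ℂ) : (PowerSeries.X + PowerSeries.C t : PowerSeries ℂ) ≠ 0 := by
  intro h
  have := congrArg (PowerSeries.coeff 1) h
  simp at this

theorem invPow_eq_pow (i : ℕ) {t : ℂ} (ht : t ≠ 0) : invPow i t = invPow 1 t ^ i := by
  induction i with
  | zero => simp [invPow_zero]
  | succ i ih =>
    apply mul_left_cancel₀ (X_add_C_ne_zero t)
    have h1 := X_add_C_mul_invPow 0 ht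
    rw [zero_add, invPow_zero] at h1
    rw [X_add_C_mul_invPow i ht, ih, pow_succ]
    linear_combination (-(invPow 1 t ^ i)) * h1

theorem invPow_one_mul_invPow_one {s t : ℂ} (hs : s ≠ 0) (ht : t ≠ 0) (hst : t - s ≠ 0) :
    invPow 1 s * invPow 1 t = PowerSeries.C (t - s)⁻¹ * (invPow 1 s - invPow 1 t) := by
  have h1 := X_add_C_mul_invPow 0 hs
  have h2 := X_add_C_mul_invPow 0 ht
  rw [zero_add, invPow_zero] at h1 h2
  have h3 : PowerSeries.C (t - s)⁻¹ * (PowerSeries.C t - PowerSeries.C s) =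
      (1 : PowerSeries ℂ) := by
    rw [← map_sub, ← map_mul, inv_mul_cancel₀ hst, map_one]
  linear_combination (-(invPow 1 s * invPow 1 t)) * h3 +
    PowerSeries.C (t - s)⁻¹ * invPow 1 s * h2 - PowerSeries.C (t - s)⁻¹ * invPow 1 t * h1

/-- Partial fractions for a product of powers of `u` and `v`, when `u v = d (u - v)`. -/
theorem pow_mul_pow_eq_sum {R : Type*} [CommRing R] {u v d : R} (h : u * v = d * (u - v))
    (p c : ℕ) :
    u ^ (p + 1) * v ^ (c + 1) =
      ∑ i ∈ Finset.range (p + 1),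
        (-1) ^ (p - i) * ((p + c - i).choose c : R) * d ^ (p + c + 1 - i) * u ^ (i + 1) +
      (-1) ^ (p + 1) * ∑ i ∈ Finset.range (c + 1),
        ((p + c - i).choose p : R) * d ^ (p + c + 1 - i) * v ^ (i + 1) := by
  induction p generalizing c with
  | zero =>
    induction c with
    | zero => simp; linear_combination h
    | succ c ih =>
      rw [show u ^ (0 + 1) * v ^ (c + 1 + 1) = d * (u ^ (0 + 1) * v ^ (c + 1)) - d * v ^ (c + 1 + 1)
        by linear_combination (v ^ (c + 1)) * h, ih, Finset.sum_range_succ _ (c + 1)]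
      simp only [zero_add, Finset.sum_range_one, Nat.choose_zero_right, Nat.choose_self,
        Nat.sub_zero, Nat.cast_one]
      have : ∀ i ∈ Finset.range (c + 1), (1 : R) * d ^ (c + 1 + 1 - i) * v ^ (i + 1) =
          d * (1 * d ^ (c + 1 - i) * v ^ (i + 1)) := by
        intro i hi
        rw [Finset.mem_range] at hi
        rw [show c + 1 + 1 - i = c + 1 - i + 1 by omega]
        ring
      rw [Finset.sum_congr rfl this, ← Finset.mul_sum, show c + 1 + 1 - (c + 1) = 1 by omega]
      ring
  | succ p ihp =>
    have hsign : ∀ i ∈ Finset.range (p + 1), ∀ X : R,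
        (-1) ^ (p + 1 - i) * X = -((-1) ^ (p - i) * X) := by
      intro i hi X
      rw [Finset.mem_range] at hi
      rw [show p + 1 - i = p - i + 1 by omega]
      ring
    induction c with
    | zero =>
      rw [show u ^ (p + 1 + 1) * v ^ (0 + 1) = d * u ^ (p + 1 + 1) - d * (u ^ (p + 1) * v ^ (0 + 1))
        by linear_combination (u ^ (p + 1)) * h, ihp 0, Finset.sum_range_succ _ (p + 1)]
      simp only [add_zero, Nat.choose_zero_right, zero_add, Finset.sum_range_one, Nat.sub_zero,
        Nat.choose_self, Nat.cast_one]
      have : ∀ i ∈ Finset.range (p + 1),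
          (-1 : R) ^ (p + 1 - i) * 1 * d ^ (p + 1 + 1 - i) * u ^ (i + 1) =
          -d * ((-1 : R) ^ (p - i) * 1 * d ^ (p + 1 - i) * u ^ (i + 1)) := by
        intro i hi
        rw [hsign i hi]
        rw [Finset.mem_range] at hi
        rw [show p + 1 + 1 - i = p + 1 - i + 1 by omega]
        ring
      rw [Finset.sum_congr rfl this, ← Finset.mul_sum, Nat.sub_self,
        show p + 1 + 1 - (p + 1) = 1 by omega]
      ring
    | succ c ihc =>
      rw [show u ^ (p + 1 + 1) * v ^ (c + 1 + 1) = d * (u ^ (p + 1 + 1) * v ^ (c + 1)) -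
        d * (u ^ (p + 1) * v ^ (c + 1 + 1)) by linear_combination (u ^ (p + 1) * v ^ (c + 1)) * h,
        ihp (c + 1), ihc]
      rw [Finset.sum_range_succ _ (p + 1), Finset.sum_range_succ _ (p + 1),
        Finset.sum_range_succ _ (c + 1), Finset.sum_range_succ _ (c + 1)]
      have h1 : ∀ i ∈ Finset.range (p + 1), (-1 : R) ^ (p + 1 - i) *
          ((p + 1 + (c + 1) - i).choose (c + 1) : R) * d ^ (p + 1 + (c + 1) + 1 - i) *
            u ^ (i + 1) =
          d * ((-1 : R) ^ (p + 1 - i) * ((p + 1 + c - i).choose c : R) *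
            d ^ (p + 1 + c + 1 - i) * u ^ (i + 1)) -
          d * ((-1 : R) ^ (p - i) * ((p + (c + 1) - i).choose (c + 1) : R) *
            d ^ (p + (c + 1) + 1 - i) * u ^ (i + 1)) := by
        intro i hi
        rw [hsign i hi 
          ((p + 1 + (c + 1) - i).choose (c + 1) : R), hsign i hi ((p + 1 + c - i).choose c : R)]
        rw [Finset.mem_range] at hi
        rw [show p + 1 + (c + 1) - i = p + c + 1 - i + 1 by omega,
          show p + 1 + (c + 1) + 1 - i = p + c + 2 - i + 1 by omega,
          show p + 1 + c - i = p + c + 1 - i by omega,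
          show p + (c + 1) - i = p + c + 1 - i by omega,
          show p + 1 + c + 1 - i = p + c + 2 - i by omega,
          show p + (c + 1) + 1 - i = p + c + 2 - i by omega, Nat.choose_succ_succ]
        push_cast
        ring
      have h2 : ∀ i ∈ Finset.range (c + 1),
          ((p + 1 + (c + 1) - i).choose (p + 1) : R) * d ^ (p + 1 + (c + 1) + 1 - i) *
            v ^ (i + 1) =
          d * (((p + 1 + c - i).choose (p + 1) : R) * d ^ (p + 1 + c + 1 - i) * v ^ (i + 1)) +
          d * (((p + (c + 1) - i).choose p : R) * d ^ (p + (c + 1) + 1 - i) * v ^ (i + 1)) := by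
        intro i hi
        rw [Finset.mem_range] at hi
        rw [show p + 1 + (c + 1) - i = p + c + 1 - i + 1 by omega,
          show p + 1 + (c + 1) + 1 - i = p + c + 2 - i + 1 by omega,
          show p + 1 + c - i = p + c + 1 - i by omega,
          show p + (c + 1) - i = p + c + 1 - i by omega,
          show p + 1 + c + 1 - i = p + c + 2 - i by omega,
          show p + (c + 1) + 1 - i = p + c + 2 - i by omega, Nat.choose_succ_succ]
        push_cast
        ring
      rw [Finset.sum_congr rfl h1, Finset.sum_congr rfl h2, Finset.sum_sub_distrib,
        Finset.sum_add_distrib]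
      simp only [← Finset.mul_sum]
      rw [show p + 1 + (c + 1) - (p + 1) = c + 1 by omega,
        show p + 1 + c - (p + 1) = c by omega,
        show p + 1 + (c + 1) + 1 - (p + 1) = c + 1 + 1 by omega,
        show p + 1 + c + 1 - (p + 1) = c + 1 by omega,
        show p + 1 + (c + 1) - (c + 1) = p + 1 by omega,
        show p + (c + 1) - (c + 1) = p by omega,
        show p + 1 + (c + 1) + 1 - (c + 1) = p + 1 + 1 by omega,
        show p + (c + 1) + 1 - (c + 1) = p + 1 by omega]
      simp only [Nat.choose_self, Nat.sub_self, Nat.cast_one]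
      ring

theorem coeff_invPow_mul_invPow (a c N : ℕ) (hc : 0 < c) (u v : ℂ) :
    PowerSeries.coeff N (invPow a u * invPow c v) =
      (-1) ^ N * ∑ w ∈ Finset.range (N + 1), ((w + a - 1).choose w : ℂ) *
        ((N - w + c - 1).choose (c - 1) : ℂ) / (u ^ (a + w) * v ^ (c + N - w)) := by
  rw [PowerSeries.coeff_mul, Finset.Nat.sum_antidiagonal_eq_sum_range_succ
    (fun i j => PowerSeries.coeff i (invPow a u) * PowerSeries.coeff j (invPow c v)), Finset.mul_sum]
  refine Finset.sum_congr rfl fun w hw => ?_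
  rw [Finset.mem_range] at hw
  rw [coeff_invPow, coeff_invPow, show c + (N - w) = c + N - w by omega,
    ← Nat.choose_symm_of_eq_add (show N - w + c - 1 = (c - 1) + (N - w) by omega),
    div_mul_div_comm]
  have : (-1 : ℂ) ^ N = (-1) ^ w * (-1) ^ (N - w) := by
    rw [← pow_add]; congr 1; omega
  rw [this]
  ring

theorem coeff_invPow_mul_invPow_neg {p c : ℕ} (hp : 0 < p) (hc : 0 < c) (N : ℕ) {m n : ℂ}
    (hm : m ≠ 0) (hn : n ≠ 0) (hmn : m + n ≠ 0) :
    PowerSeries.coeff N (invPow p (-m) * invPow c n) =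
      (-1) ^ p * ∑ w ∈ Finset.range p, ((w + N).choose w : ℂ) *
        ((p + c - 2 - w).choose (c - 1) : ℂ) / (m ^ (N + w + 1) * (m + n) ^ (p + c - 1 - w)) +
      (-1) ^ (p + N) * ∑ w ∈ Finset.range c, ((w + N).choose w : ℂ) *
        ((p + c - 2 - w).choose (p - 1) : ℂ) / (n ^ (N + w + 1) * (m + n) ^ (p + c - 1 - w)) := by
  obtain ⟨p, rfl⟩ := Nat.exists_eq_succ_of_ne_zero hp.ne'
  obtain ⟨c, rfl⟩ := Nat.exists_eq_succ_of_ne_zero hc.ne'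
  have hm' : -m ≠ 0 := neg_ne_zero.mpr hm
  have hmn' : n - -m ≠ 0 := by rwa [sub_neg_eq_add, add_comm]
  rw [Nat.succ_eq_add_one, Nat.succ_eq_add_one, invPow_eq_pow _ hm', invPow_eq_pow _ hn,
    pow_mul_pow_eq_sum (invPow_one_mul_invPow_one hm' hn hmn') p c]
  simp only [← invPow_eq_pow _ hm', ← invPow_eq_pow _ hn]
  have hcoe : ∀ (k : ℕ) (x : ℂ) (f : PowerSeries ℂ) (A : ℂ) (j : ℕ),
      A * (k : ℂ) * x ^ j * PowerSeries.coeff N f =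
      PowerSeries.coeff N (PowerSeries.C A * (k : PowerSeries ℂ) * PowerSeries.C x ^ j * f) := by
    intro k x f A j
    rw [← map_natCast PowerSeries.C k, ← map_pow, ← map_mul, ← map_mul, PowerSeries.coeff_C_mul]
  have hC : (-1 : PowerSeries ℂ) = PowerSeries.C (-1) := by simp
  rw [map_add, map_sum, hC, ← map_pow PowerSeries.C, PowerSeries.coeff_C_mul, map_sum]
  congr 1
  · rw [Finset.mul_sum]
    refine Finset.sum_congr rfl fun w hw => ?_
    rw [Finset.mem_range] at hw
    rw [← map_pow PowerSeries.C (-1), ← hcoe, coeff_invPow,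
      show N + (w + 1) - 1 = w + N by omega,
      show p + 1 + (c + 1) - 2 - w = p + c - w by omega, Nat.add_sub_cancel,
      show p + 1 + (c + 1) - 1 - w = p + c + 1 - w by omega, ← Nat.choose_symm_add,
      show w + 1 + N = N + w + 1 by omega, neg_pow m, inv_pow, show n - -m = m + n by ring]
    have h1 : (-1 : ℂ) ^ (p + 1) = (-1) ^ (p - w) * (-1) ^ (w + 1) := by
      rw [← pow_add]; congr 1; omega
    have h2 : (-1 : ℂ) ^ (N + w + 1) = (-1) ^ N * (-1) ^ (w + 1) := by rw [← pow_add]; rfl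
    have h3 : (-1 : ℂ) ^ (w + 1) * (-1) ^ (w + 1) = 1 := by rw [← mul_pow]; simp
    have h4 : (-1 : ℂ) ^ (w + 1) ≠ 0 := by simp
    have h5 : (-1 : ℂ) ^ N ≠ 0 := by simp
    rw [h1, h2]
    field_simp
    rw [pow_two, h3]
    ring
  · rw [Finset.mul_sum, Finset.mul_sum]
    refine Finset.sum_congr rfl fun w hw => ?_
    rw [Finset.mem_range] at hw
    have := hcoe ((p + c - w).choose p) (n - -m)⁻¹ (invPow (w + 1) n) 1 (p + c + 1 - w)
    rw [map_one, one_mul, one_mul] at this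
    rw [← this, coeff_invPow,
      show N + (w + 1) - 1 = w + N by omega,
      show p + 1 + (c + 1) - 2 - w = p + c - w by omega, Nat.add_sub_cancel,
      show p + 1 + (c + 1) - 1 - w = p + c + 1 - w by omega, ← Nat.choose_symm_add,
      show w + 1 + N = N + w + 1 by omega, inv_pow, show n - -m = m + n by ring,
      show p + 1 + N = p + N + 1 by ring]
    field_simp
    ring


/-- The multiplicities of the poles `0`, `-m` and `-(m + n)`. -/
def threePoles (p a c : ℕ) (m k : ℤ) : ℕ := if k = 0 then p else if k = -m then a else c

theorem neg_one_pow_sub_two_mul {p j : ℕ} (h : 2 * j ≤ p) : (-1 : ℂ) ^ (p - 2 * j) = (-1) ^ p := by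
  conv_rhs => rw [show p = p - 2 * j + 2 * j by omega, pow_add, pow_mul]
  simp

theorem tsum_poleTerm_three {p a c : ℕ} (hp : 0 < p) (ha : 0 < a) (hc : 0 < c) {m n : ℤ}
    (hm : m ≠ 0) (hn : n ≠ 0) (hmn : m + n ≠ 0)
    (hs : Summable (poleTerm (-1) {0, -m, -(m + n)} (threePoles p a c m))) :
    ∑' l, poleTerm (-1) {0, -m, -(m + n)} (threePoles p a c m) l =
      2 * (-1) ^ p * ∑ j ∈ Finset.range (p / 2 + 1), phi (2 * j) *
        ∑ w ∈ Finset.range (p - 2 * j + 1),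
          ((w + a - 1).choose w : ℂ) * ((p + c - 2 * j - w - 1).choose (c - 1) : ℂ) *
            (1 / ((m : ℂ) ^ (a + w) * ((m : ℂ) + n) ^ (p + c - 2 * j - w))) +
      2 * (-1) ^ (p + a) * ∑ j ∈ Finset.range (c / 2 + 1), phi (2 * j) *
        ∑ w ∈ Finset.range (c - 2 * j + 1),
          ((w + a - 1).choose w : ℂ) * ((p + c - 2 * j - w - 1).choose (p - 1) : ℂ) *
            ((-1) ^ (m + n) / ((n : ℂ) ^ (a + w) * ((m : ℂ) + n) ^ (p + c - 2 * j - w))) +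
      2 * (-1) ^ p * ∑ j ∈ Finset.range (a / 2 + 1), phi (2 * j) *
        ∑ w ∈ Finset.range p,
          ((w + a - 2 * j).choose w : ℂ) * ((p + c - 2 - w).choose (c - 1) : ℂ) *
            ((-1) ^ m / ((m : ℂ) ^ (a - 2 * j + w + 1) * ((m : ℂ) + n) ^ (p + c - 1 - w))) +
      2 * (-1) ^ (p + a) * ∑ j ∈ Finset.range (a / 2 + 1), phi (2 * j) *
        ∑ w ∈ Finset.range c,
          ((w + a - 2 * j).choose w : ℂ) * ((p + c - 2 - w).choose (p - 1) : ℂ) *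
            ((-1) ^ m / ((n : ℂ) ^ (a - 2 * j + w + 1) * ((m : ℂ) + n) ^ (p + c - 1 - w))) := by
  have hx : (-1 : ℂ) = 1 ∨ (-1 : ℂ) = -1 := Or.inr rfl
  have h01 : (0 : ℤ) ≠ -m := by omega
  have h02 : (0 : ℤ) ≠ -(m + n) := by omega
  have h12 : -m ≠ -(m + n) := by omega
  have hnot : (0 : ℤ) ∉ ({-m, -(m + n)} : Finset ℤ) := by simp; omega
  have hm0 : (m : ℂ) ≠ 0 := by exact_mod_cast hm
  have hn0 : (n : ℂ) ≠ 0 := by exact_mod_cast hn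
  have hmn0 : (m : ℂ) + n ≠ 0 := by exact_mod_cast hmn
  have e0 : threePoles p a c m 0 = p := if_pos rfl
  have e1 : threePoles p a c m (-m) = a := by rw [threePoles, if_neg h01.symm, if_pos rfl]
  have e2 : threePoles p a c m (-(m + n)) = c := by
    rw [threePoles, if_neg h02.symm, if_neg h12.symm]
  rw [tsum_poleTerm hx {0, -m, -(m + n)} (D := p + a + c) (threePoles p a c m)
    (by rw [Finset.sum_insert hnot, e0]; omega)
    (by intro k _; unfold threePoles; split_ifs <;> omega) hs, Finset.sum_insert hnot,
    Finset.sum_pair h12]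
  have hgerm : ∀ k : ℤ, germ {0, -m, -(m + n)} (threePoles p a c m) k =
      (lin k ^ p)⁻¹ * (lin ((k : ℂ) + m) ^ a)⁻¹ * (lin ((k : ℂ) + (m + n)) ^ c)⁻¹ := by
    intro k
    rw [germ, Finset.prod_insert hnot, Finset.prod_pair h12, e0, e1, e2, mul_inv, mul_inv,
      ← mul_assoc]
    push_cast
    simp only [sub_zero, sub_neg_eq_add]
  have g0 : germ {0, -m, -(m + n)} (threePoles p a c m) 0 =
      (lin 0 ^ p)⁻¹ * HahnSeries.ofPowerSeries ℤ ℂ (invPow a m * invPow c (m + n)) := by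
    rw [hgerm, map_mul, ← inv_lin_pow a hm0, ← inv_lin_pow c hmn0, ← mul_assoc]
    simp
  have g1 : germ {0, -m, -(m + n)} (threePoles p a c m) (-m) =
      (lin 0 ^ a)⁻¹ * HahnSeries.ofPowerSeries ℤ ℂ (invPow p (-m) * invPow c n) := by
    rw [hgerm, map_mul, ← inv_lin_pow p (neg_ne_zero.mpr hm0), ← inv_lin_pow c hn0, ← mul_assoc,
      mul_comm (lin 0 ^ a)⁻¹]
    push_cast
    rw [neg_add_cancel, show -(m : ℂ) + (m + n) = n by ring]
  have g2 : germ {0, -m, -(m + n)} (threePoles p a c m) (-(m + n)) =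
      (lin 0 ^ c)⁻¹ * HahnSeries.ofPowerSeries ℤ ℂ (invPow a (-n) * invPow p (-(m + n))) := by
    rw [hgerm, map_mul, ← inv_lin_pow a (neg_ne_zero.mpr hn0),
      ← inv_lin_pow p (neg_ne_zero.mpr hmn0)]
    push_cast
    rw [neg_add_cancel, show -((m : ℂ) + n) + m = -n by ring]
    ring
  rw [g0, g1, g2, lamFun_inv_lin_zero_pow_mul _ (by omega),
    lamFun_inv_lin_zero_pow_mul _ (by omega), lamFun_inv_lin_zero_pow_mul _ (by omega),
    zpow_zero, one_mul, sign_zpow_neg hx, sign_zpow_neg hx, signZeta_neg_one]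
  have A0 : ∀ j ∈ Finset.range (p / 2 + 1),
      PowerSeries.coeff (p - 2 * j) (invPow a m * invPow c (m + n)) = (-1) ^ p *
        ∑ w ∈ Finset.range (p - 2 * j + 1),
          ((w + a - 1).choose w : ℂ) * ((p + c - 2 * j - w - 1).choose (c - 1) : ℂ) *
            (1 / ((m : ℂ) ^ (a + w) * ((m : ℂ) + n) ^ (p + c - 2 * j - w))) := by
    intro j hj
    rw [Finset.mem_range] at hj
    rw [coeff_invPow_mul_invPow _ _ _ hc, neg_one_pow_sub_two_mul (by omega)]
    congr 1
    refine Finset.sum_congr rfl fun w hw => ?_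
    rw [Finset.mem_range] at hw
    rw [show p - 2 * j - w + c - 1 = p + c - 2 * j - w - 1 by omega,
      show c + (p - 2 * j) - w = p + c - 2 * j - w by omega, mul_one_div]
  have A2 : ∀ j ∈ Finset.range (c / 2 + 1),
      PowerSeries.coeff (c - 2 * j) (invPow a (-n) * invPow p (-(m + n))) = (-1) ^ (p + a) *
        ∑ w ∈ Finset.range (c - 2 * j + 1),
          ((w + a - 1).choose w : ℂ) * ((p + c - 2 * j - w - 1).choose (p - 1) : ℂ) *
            (1 / ((n : ℂ) ^ (a + w) * ((m : ℂ) + n) ^ (p + c - 2 * j - w))) := by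
    intro j hj
    rw [Finset.mem_range] at hj
    rw [coeff_invPow_mul_invPow _ _ _ hp, Finset.mul_sum, Finset.mul_sum]
    refine Finset.sum_congr rfl fun w hw => ?_
    rw [Finset.mem_range] at hw
    rw [show c - 2 * j - w + p - 1 = p + c - 2 * j - w - 1 by omega,
      show p + (c - 2 * j) - w = p + c - 2 * j - w by omega, neg_pow (n : ℂ),
      neg_pow ((m : ℂ) + n)]
    have h1 : (-1 : ℂ) ^ (c - 2 * j) = (-1) ^ (p + a) * ((-1) ^ (a + w) *
        (-1) ^ (p + c - 2 * j - w)) := by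
      rw [← pow_add, ← pow_add, show p + a + (a + w + (p + c - 2 * j - w)) =
        c - 2 * j + 2 * (p + a) by omega, pow_add, pow_mul]
      simp
    have h2 : (-1 : ℂ) ^ (a + w) ≠ 0 := by simp
    have h3 : (-1 : ℂ) ^ (p + c - 2 * j - w) ≠ 0 := by simp
    rw [h1]
    field_simp
  have A1 : ∀ j ∈ Finset.range (a / 2 + 1),
      PowerSeries.coeff (a - 2 * j) (invPow p (-m) * invPow c n) =
        (-1) ^ p * ∑ w ∈ Finset.range p,
          ((w + a - 2 * j).choose w : ℂ) * ((p + c - 2 - w).choose (c - 1) : ℂ) *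
            (1 / ((m : ℂ) ^ (a - 2 * j + w + 1) * ((m : ℂ) + n) ^ (p + c - 1 - w))) +
        (-1) ^ (p + a) * ∑ w ∈ Finset.range c,
          ((w + a - 2 * j).choose w : ℂ) * ((p + c - 2 - w).choose (p - 1) : ℂ) *
            (1 / ((n : ℂ) ^ (a - 2 * j + w + 1) * ((m : ℂ) + n) ^ (p + c - 1 - w))) := by
    intro j hj
    rw [Finset.mem_range] at hj
    rw [coeff_invPow_mul_invPow_neg hp hc _ hm0 hn0 hmn0, pow_add _ p (a - 2 * j),
      neg_one_pow_sub_two_mul (by omega), ← pow_add]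
    simp only [mul_one_div, Nat.add_sub_assoc (show 2 * j ≤ a by omega)]
  rw [Finset.sum_congr rfl fun j hj => by rw [A0 j hj],
    Finset.sum_congr (s₁ := Finset.range (c / 2 + 1)) rfl fun j hj => by rw [A2 j hj],
    Finset.sum_congr (s₁ := Finset.range (a / 2 + 1)) rfl fun j hj => by rw [A1 j hj]]
  simp only [← mul_one_div ((-1 : ℂ) ^ (_ : ℤ)), mul_add, Finset.sum_add_distrib, Finset.mul_sum]
  have hr : ∀ x y z w x' y' z' w' : ℂ, x = x' → y = y' → z = z' → w = w' →
      x + (z + w + y) = x' + y' + z' + w' := by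
    rintro x y z w _ _ _ _ rfl rfl rfl rfl
    ring
  apply hr <;> refine Finset.sum_congr rfl fun j _ => Finset.sum_congr rfl fun w _ => ?_ <;> ring


/-- The common term of the twelve series, as a function on `ℤ³`. -/
noncomputable def relTerm (p q a b c : ℕ) (s : ℂ) (l m n : ℤ) : ℂ :=
  (-1) ^ (l + n) / ((l : ℂ) ^ p * (m : ℂ) ^ q * (n : ℂ) ^ s * ((l + m : ℤ) : ℂ) ^ a *
    ((m + n : ℤ) : ℂ) ^ b * ((l + m + n : ℤ) : ℂ) ^ c)

/-- The restriction of `relTerm` to `n > 0`. -/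
noncomputable def relExt (p q a b c : ℕ) (s : ℂ) (y : ℤ × ℤ × ℤ) : ℂ :=
  if 0 < y.2.2 then relTerm p q a b c s y.1 y.2.1 y.2.2 else 0

theorem relExt_eq_zero {p q a b c : ℕ} (hp : 0 < p) (hq : 0 < q) (ha : 0 < a) (hb : 0 < b)
    (hc : 0 < c) (s : ℂ) {l m n : ℤ}
    (h : ¬ (0 < n ∧ l ≠ 0 ∧ m ≠ 0 ∧ l + m ≠ 0 ∧ m + n ≠ 0 ∧ l + m + n ≠ 0)) :
    relExt p q a b c s (l, m, n) = 0 := by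
  by_contra hcon
  have hn : 0 < n := by
    by_contra hn
    exact hcon (if_neg hn)
  rw [relExt, if_pos hn, relTerm] at hcon
  have hden := (div_ne_zero_iff.mp hcon).2
  simp only [ne_eq, mul_eq_zero, not_or, pow_eq_zero_iff hp.ne', pow_eq_zero_iff hq.ne',
    pow_eq_zero_iff ha.ne', pow_eq_zero_iff hb.ne', pow_eq_zero_iff hc.ne', Int.cast_eq_zero]
    at hden
  exact h ⟨hn, hden.1.1.1.1.1, hden.1.1.1.1.2, hden.1.1.2, hden.1.2, hden.2⟩

/-- The twelve chambers of the arrangement in `n > 0`, each parametrised by positive triples. -/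
def chamber (i : Fin 12) (y : ℤ × ℤ × ℤ) : ℤ × ℤ × ℤ :=
  let L := y.1
  let M := y.2.1
  let N := y.2.2
  (![(L, M, N), (-L, L + M, N), (-(L + M), L, M + N), (-(L + M + N), L, M), (L + M, -M, M + N),
    (L + M + N, -(M + N), M), (M, -(L + M), L + M + N), (M + N, -(L + M + N), L + M),
    (N, -(L + M + N), L), (-M, -L, L + M + N), (-(M + N), -L, L + M), (-N, -(L + M), L)] :
      Fin 12 → ℤ × ℤ × ℤ) i

/-- The inverse of `chamber i`. -/
def chamberInv (i : Fin 12) (y : ℤ × ℤ × ℤ) : ℤ × ℤ × ℤ :=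
  let l := y.1
  let m := y.2.1
  let n := y.2.2
  (![(l, m, n), (-l, l + m, n), (m, -(l + m), l + m + n), (m, n, -(l + m + n)),
    (l + m, -m, m + n), (l + m, n, -(m + n)), (-(l + m), l, m + n),
    (-(l + m), l + m + n, -(m + n)), (n, -(l + m + n), l), (-m, -l, l + m + n),
    (-m, m + n, -(l + m + n)), (n, -(m + n), -l)] : Fin 12 → ℤ × ℤ × ℤ) i

/-- The chamber containing a given point. -/
def chamberIndex (y : ℤ × ℤ × ℤ) : Fin 12 :=
  if 0 < y.2.1 then
    if 0 < y.1 then 0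
    else if 0 < y.1 + y.2.1 then 1
    else if 0 < y.1 + y.2.1 + y.2.2 then 2 else 3
  else if 0 < y.1 then
    if 0 < y.1 + y.2.1 then
      if 0 < y.2.1 + y.2.2 then 4 else 5
    else if 0 < y.1 + y.2.1 + y.2.2 then
      if 0 < y.2.1 + y.2.2 then 6 else 7
    else 8
  else if 0 < y.1 + y.2.1 + y.2.2 then 9
  else if 0 < y.2.1 + y.2.2 then 10 else 11

theorem chamberInv_chamber (i : Fin 12) (y : ℤ × ℤ × ℤ) : chamberInv i (chamber i y) = y := by
  obtain ⟨l, m, n⟩ := y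
  fin_cases i <;>
    simp only [Fin.zero_eta, Fin.mk_one, Fin.reduceFinMk, chamber, chamberInv, Matrix.cons_val,
      Prod.mk.injEq, true_and, and_true] <;>
    omega

theorem chamber_chamberInv (i : Fin 12) (y : ℤ × ℤ × ℤ) : chamber i (chamberInv i y) = y := by
  obtain ⟨l, m, n⟩ := y
  fin_cases i <;>
    simp only [Fin.zero_eta, Fin.mk_one, Fin.reduceFinMk, chamber, chamberInv, Matrix.cons_val,
      Prod.mk.injEq, true_and, and_true] <;>
    omega

theorem chamberIndex_chamber (i : Fin 12) {L M N : ℤ} (hL : 0 < L) (hM : 0 < M) (hN : 0 < N) :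
    chamberIndex (chamber i (L, M, N)) = i := by
  obtain ⟨⟨l, m, n⟩, h⟩ : ∃ y, chamber i (L, M, N) = y := ⟨_, rfl⟩
  rw [h]
  fin_cases i <;>
    simp only [Fin.zero_eta, Fin.mk_one, Fin.reduceFinMk, chamber, Matrix.cons_val,
      Prod.mk.injEq] at h <;>
    unfold chamberIndex <;>
    split_ifs <;> first | rfl | (exfalso; simp only at *; omega)

theorem chamberInv_pos {i : Fin 12} {l m n : ℤ} (h : chamberIndex (l, m, n) = i) (hn : 0 < n)
    (h1 : l ≠ 0) (h2 : m ≠ 0) (h4 : l + m ≠ 0) (h5 : m + n ≠ 0) (h6 : l + m + n ≠ 0) :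
    0 < (chamberInv i (l, m, n)).1 ∧ 0 < (chamberInv i (l, m, n)).2.1 ∧
      0 < (chamberInv i (l, m, n)).2.2 := by
  subst h
  unfold chamberIndex
  split_ifs <;> simp only [chamberInv, Matrix.cons_val] at * <;> omega

theorem neg_one_zpow_eq {u : ℤ} {K : ℕ} (h : (u - K) % 2 = 0) : (-1 : ℂ) ^ u = (-1) ^ K := by
  obtain ⟨t, ht⟩ := Int.dvd_of_emod_eq_zero h
  rw [show u = K + 2 * t by omega, zpow_add₀ (by norm_num), zpow_mul]
  simp

theorem relTerm_eq {p q a b c : ℕ} {s : ℂ} {l m n : ℤ} (A₁ A₂ A₃ A₄ A₅ A₆ K d₁ d₂ d₄ d₅ d₆ : ℕ)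
    (h₁ : l = (-1) ^ d₁ * A₁) (h₂ : m = (-1) ^ d₂ * A₂) (h₃ : n = A₃)
    (h₄ : l + m = (-1) ^ d₄ * A₄) (h₅ : m + n = (-1) ^ d₅ * A₅)
    (h₆ : l + m + n = (-1) ^ d₆ * A₆) (hK : (l + n - K) % 2 = 0) :
    relTerm p q a b c s l m n = (-1) ^ (d₁ * p + d₂ * q + d₄ * a + d₅ * b + d₆ * c) *
      ((-1) ^ K / ((A₁ : ℂ) ^ (p : ℂ) * (A₂ : ℂ) ^ (q : ℂ) * (A₃ : ℂ) ^ s * (A₄ : ℂ) ^ (a : ℂ) *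
        (A₅ : ℂ) ^ (b : ℂ) * (A₆ : ℂ) ^ (c : ℂ))) := by
  rw [relTerm, neg_one_zpow_eq hK, h₆, h₅, h₄, h₁, h₂, h₃]
  push_cast
  simp only [cpow_natCast, mul_pow, ← pow_mul]
  rw [pow_add, pow_add, pow_add, pow_add]
  have hsq : ∀ k : ℕ, (-1 : ℂ) ^ k ≠ 0 := fun k => by simp
  have hinv : ∀ k : ℕ, ((-1 : ℂ) ^ k)⁻¹ = (-1) ^ k := fun k => by
    rw [← inv_pow]; norm_num
  simp only [div_eq_mul_inv, mul_inv, hinv]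
  ring

/-- Positive triples as integer triples. -/
def coeTriple (x : ℕ+ × ℕ+ × ℕ+) : ℤ × ℤ × ℤ :=
  (((x.1 : ℕ) : ℤ), ((x.2.1 : ℕ) : ℤ), ((x.2.2 : ℕ) : ℤ))

theorem relExt_chamber (p q a b c : ℕ) (s : ℂ) (i : Fin 12) (x : ℕ+ × ℕ+ × ℕ+) :
    relExt p q a b c s (chamber i (coeTriple x)) =
      (-1) ^ signs p q a b c i * zetaTerm (exponents p q a b c i s) x := by
  obtain ⟨L, M, N⟩ := x
  have hL := L.pos
  have hM := M.pos
  have hN := N.pos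
  have hpos : 0 < (chamber i (coeTriple (L, M, N))).2.2 := by
    fin_cases i <;>
      simp only [Fin.zero_eta, Fin.mk_one, Fin.reduceFinMk, chamber, coeTriple,
        Matrix.cons_val] <;>
      omega
  rw [relExt, if_pos hpos]
  clear hpos
  fin_cases i <;>
    simp only [Fin.zero_eta, Fin.mk_one, Fin.reduceFinMk, chamber, coeTriple, Matrix.cons_val,
      zetaTerm, exponents, signs]
  · rw [relTerm_eq L M N (L + M) (M + N) (L + M + N) (L + N) 0 0 0 0 0 (by push_cast; ring)
      (by push_cast; ring) (by ring) (by push_cast; ring) (by push_cast; ring)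
      (by push_cast; ring) (by push_cast; omega)]
    ring
  · rw [relTerm_eq L (L + M) N M (L + M + N) (M + N) (L + N) 1 0 0 0 0 (by push_cast; ring)
      (by push_cast; ring) (by ring) (by push_cast; ring) (by push_cast; ring)
      (by push_cast; ring) (by push_cast; omega)]
    congr 1 <;> ring
  · rw [relTerm_eq (L + M) L (M + N) M (L + M + N) N (L + N) 1 0 1 0 0 (by push_cast; ring)
      (by push_cast; ring) (by push_cast; ring) (by push_cast; ring) (by push_cast; ring)
      (by push_cast; ring) (by push_cast; omega)]
    congr 1 <;> ring
  · rw [relTerm_eq (L + M + N) L M (M + N) (L + M) N (L + N) 1 0 1 0 1 (by push_cast; ring)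
      (by push_cast; ring) (by ring) (by push_cast; ring) (by push_cast; ring)
      (by push_cast; ring) (by push_cast; omega)]
    congr 1 <;> ring
  · rw [relTerm_eq (L + M) M (M + N) L N (L + M + N) (L + N) 0 1 0 0 0 (by push_cast; ring)
      (by push_cast; ring) (by push_cast; ring) (by push_cast; ring) (by push_cast; ring)
      (by push_cast; ring) (by push_cast; omega)]
    congr 1 <;> ring
  · rw [relTerm_eq (L + M + N) (M + N) M L N (L + M) (L + N) 0 1 0 1 0 (by push_cast; ring)
      (by push_cast; ring) (by ring) (by push_cast; ring) (by push_cast; ring)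
      (by push_cast; ring) (by push_cast; omega)]
    congr 1 <;> ring
  · rw [relTerm_eq M (L + M) (L + M + N) L N (M + N) (L + N) 0 1 1 0 0 (by push_cast; ring)
      (by push_cast; ring) (by push_cast; ring) (by push_cast; ring) (by push_cast; ring)
      (by push_cast; ring) (by push_cast; omega)]
    congr 1 <;> ring
  · rw [relTerm_eq (M + N) (L + M + N) (L + M) L N M (L + N) 0 1 1 1 0 (by push_cast; ring)
      (by push_cast; ring) (by push_cast; ring) (by push_cast; ring) (by push_cast; ring)
      (by push_cast; ring) (by push_cast; omega)]
    congr 1 <;> ring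
  · rw [relTerm_eq N (L + M + N) L (L + M) (M + N) M (L + N) 0 1 1 1 1 (by push_cast; ring)
      (by push_cast; ring) (by ring) (by push_cast; ring) (by push_cast; ring)
      (by push_cast; ring) (by push_cast; omega)]
    congr 1 <;> ring
  · rw [relTerm_eq M L (L + M + N) (L + M) (M + N) N (L + N) 1 1 1 0 0 (by push_cast; ring)
      (by push_cast; ring) (by push_cast; ring) (by push_cast; ring) (by push_cast; ring)
      (by push_cast; ring) (by push_cast; omega)]
    congr 1 <;> ring
  · rw [relTerm_eq (M + N) L (L + M) (L + M + N) M N (L + N) 1 1 1 0 1 (by push_cast; ring)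
      (by push_cast; ring) (by push_cast; ring) (by push_cast; ring) (by push_cast; ring)
      (by push_cast; ring) (by push_cast; omega)]
    congr 1 <;> ring
  · rw [relTerm_eq N (L + M) L (L + M + N) M (M + N) (L + N) 1 1 1 1 1 (by push_cast; ring)
      (by push_cast; ring) (by ring) (by push_cast; ring) (by push_cast; ring)
      (by push_cast; ring) (by push_cast; omega)]
    congr 1 <;> ring

theorem coeTriple_injective : Function.Injective coeTriple := by
  rintro ⟨L, M, N⟩ ⟨L', M', N'⟩ h
  simpa [coeTriple] using h

theorem exists_coeTriple_eq {y : ℤ × ℤ × ℤ} (h1 : 0 < y.1) (h2 : 0 < y.2.1) (h3 : 0 < y.2.2) :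
    ∃ x, coeTriple x = y := by
  refine ⟨(⟨y.1.toNat, by omega⟩, ⟨y.2.1.toNat, by omega⟩, ⟨y.2.2.toNat, by omega⟩), ?_⟩
  obtain ⟨l, m, n⟩ := y
  simp only at h1 h2 h3
  simp only [coeTriple, PNat.mk_coe, Prod.mk.injEq]
  omega

theorem hasSum_relExt {p q a b c : ℕ} (hp : 0 < p) (hq : 0 < q) (ha : 0 < a) (hb : 0 < b)
    (hc : 0 < c) {s : ℂ} (hs : 1 < s.re) :
    HasSum (relExt p q a b c s)
      (∑ i, (-1) ^ signs p q a b c i * ∑' x, zetaTerm (exponents p q a b c i s) x) := by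
  have hpart : relExt p q a b c s =
      fun y => ∑ i, if chamberIndex y = i then relExt p q a b c s y else 0 := by
    funext y
    simp
  rw [hpart]
  refine hasSum_sum fun i _ => ?_
  have hidx : ∀ x, chamberIndex (chamber i (coeTriple x)) = i := fun x =>
    chamberIndex_chamber i (by exact_mod_cast x.1.pos) (by exact_mod_cast x.2.1.pos)
      (by exact_mod_cast x.2.2.pos)
  have hinj : Function.Injective fun x => chamber i (coeTriple x) := fun x x' h =>
    coeTriple_injective (by simpa [chamberInv_chamber] using congrArg (chamberInv i) h)
  refine (hinj.hasSum_iff ?_).mp ?_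
  · rintro ⟨l, m, n⟩ hy
    split_ifs with h
    · refine relExt_eq_zero hp hq ha hb hc s fun hcon => hy ?_
      obtain ⟨hn, h1, h2, h4, h5, h6⟩ := hcon
      obtain ⟨k1, k2, k3⟩ := chamberInv_pos h hn h1 h2 h4 h5 h6
      obtain ⟨x, hx⟩ := exists_coeTriple_eq k1 k2 k3
      exact ⟨x, by simp only [hx, chamber_chamberInv]⟩
    · rfl
  · have := (summable_zetaTerm_exponents hp hq ha hb hc i hs).hasSum.mul_left
      ((-1) ^ signs p q a b c i)
    refine this.congr_fun fun x => ?_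
    simp only [Function.comp_apply]
    rw [if_pos (hidx x), relExt_chamber]


/-- The shape of the right side of the functional relation. -/
noncomputable def relRhs (p a c : ℕ) (t₁ t₂ t₃ t₄ : ℕ → ℕ → ℂ) : ℂ :=
  2 * (-1) ^ p * ∑ j ∈ Finset.range (p / 2 + 1), phi (2 * j) *
    ∑ w ∈ Finset.range (p - 2 * j + 1),
      ((w + a - 1).choose w : ℂ) * ((p + c - 2 * j - w - 1).choose (c - 1) : ℂ) * t₁ j w +
  2 * (-1) ^ (p + a) * ∑ j ∈ Finset.range (c / 2 + 1), phi (2 * j) *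
    ∑ w ∈ Finset.range (c - 2 * j + 1),
      ((w + a - 1).choose w : ℂ) * ((p + c - 2 * j - w - 1).choose (p - 1) : ℂ) * t₂ j w +
  2 * (-1) ^ p * ∑ j ∈ Finset.range (a / 2 + 1), phi (2 * j) *
    ∑ w ∈ Finset.range p,
      ((w + a - 2 * j).choose w : ℂ) * ((p + c - 2 - w).choose (c - 1) : ℂ) * t₃ j w +
  2 * (-1) ^ (p + a) * ∑ j ∈ Finset.range (a / 2 + 1), phi (2 * j) *
    ∑ w ∈ Finset.range c,
      ((w + a - 2 * j).choose w : ℂ) * ((p + c - 2 - w).choose (p - 1) : ℂ) * t₄ j w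

theorem relRhs_congr {p a c : ℕ} {t₁ t₂ t₃ t₄ u₁ u₂ u₃ u₄ : ℕ → ℕ → ℂ}
    (h₁ : ∀ j ∈ Finset.range (p / 2 + 1), ∀ w ∈ Finset.range (p - 2 * j + 1), t₁ j w = u₁ j w)
    (h₂ : ∀ j ∈ Finset.range (c / 2 + 1), ∀ w ∈ Finset.range (c - 2 * j + 1), t₂ j w = u₂ j w)
    (h₃ : ∀ j ∈ Finset.range (a / 2 + 1), ∀ w ∈ Finset.range p, t₃ j w = u₃ j w)
    (h₄ : ∀ j ∈ Finset.range (a / 2 + 1), ∀ w ∈ Finset.range c, t₄ j w = u₄ j w) :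
    relRhs p a c t₁ t₂ t₃ t₄ = relRhs p a c u₁ u₂ u₃ u₄ := by
  have key : ∀ {S : Finset ℕ} {R : ℕ → Finset ℕ} {f : ℕ → ℂ} {g : ℕ → ℕ → ℂ} {t u : ℕ → ℕ → ℂ},
      (∀ j ∈ S, ∀ w ∈ R j, t j w = u j w) →
      ∑ j ∈ S, f j * ∑ w ∈ R j, g j w * t j w = ∑ j ∈ S, f j * ∑ w ∈ R j, g j w * u j w :=
    fun h => Finset.sum_congr rfl fun j hj => congrArg _ <| Finset.sum_congr rfl fun w hw => by
      rw [h j hj w hw]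
  unfold relRhs
  rw [key h₁, key h₂, key h₃, key h₄]

theorem mul_relRhs (x : ℂ) (p a c : ℕ) (t₁ t₂ t₃ t₄ : ℕ → ℕ → ℂ) :
    x * relRhs p a c t₁ t₂ t₃ t₄ = relRhs p a c (fun j w => x * t₁ j w) (fun j w => x * t₂ j w)
      (fun j w => x * t₃ j w) (fun j w => x * t₄ j w) := by
  have key : ∀ {S : Finset ℕ} {R : ℕ → Finset ℕ} {f : ℕ → ℂ} {g : ℕ → ℕ → ℂ} {t : ℕ → ℕ → ℂ},
      ∑ j ∈ S, f j * ∑ w ∈ R j, g j w * (x * t j w) =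
        x * ∑ j ∈ S, f j * ∑ w ∈ R j, g j w * t j w := by
    intro S R f g t
    simp only [Finset.mul_sum]
    exact Finset.sum_congr rfl fun j _ => Finset.sum_congr rfl fun w _ => by ring
  simp only [relRhs, key]
  ring

theorem hasSum_relRhs {ι : Type*} {p a c : ℕ} {u₁ u₂ u₃ u₄ : ι → ℕ → ℕ → ℂ}
    {t₁ t₂ t₃ t₄ : ℕ → ℕ → ℂ}
    (h₁ : ∀ j ∈ Finset.range (p / 2 + 1), ∀ w ∈ Finset.range (p - 2 * j + 1),
      HasSum (fun i => u₁ i j w) (t₁ j w))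
    (h₂ : ∀ j ∈ Finset.range (c / 2 + 1), ∀ w ∈ Finset.range (c - 2 * j + 1),
      HasSum (fun i => u₂ i j w) (t₂ j w))
    (h₃ : ∀ j ∈ Finset.range (a / 2 + 1), ∀ w ∈ Finset.range p, HasSum (fun i => u₃ i j w) (t₃ j w))
    (h₄ : ∀ j ∈ Finset.range (a / 2 + 1), ∀ w ∈ Finset.range c,
      HasSum (fun i => u₄ i j w) (t₄ j w)) :
    HasSum (fun i => relRhs p a c (u₁ i) (u₂ i) (u₃ i) (u₄ i)) (relRhs p a c t₁ t₂ t₃ t₄) := by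
  have key : ∀ {S : Finset ℕ} {R : ℕ → Finset ℕ} {f : ℕ → ℂ} {g : ℕ → ℕ → ℂ}
      {u : ι → ℕ → ℕ → ℂ} {t : ℕ → ℕ → ℂ},
      (∀ j ∈ S, ∀ w ∈ R j, HasSum (fun i => u i j w) (t j w)) →
      HasSum (fun i => ∑ j ∈ S, f j * ∑ w ∈ R j, g j w * u i j w)
        (∑ j ∈ S, f j * ∑ w ∈ R j, g j w * t j w) :=
    fun h => hasSum_sum fun j hj => HasSum.mul_left _ <| hasSum_sum fun w hw =>
      HasSum.mul_left _ (h j hj w hw)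
  exact ((((key h₁).mul_left _).add ((key h₂).mul_left _)).add ((key h₃).mul_left _)).add
    ((key h₄).mul_left _)

theorem analyticAt_relRhs {p a c : ℕ} {s : ℂ} {t₁ t₂ t₃ t₄ : ℕ → ℕ → ℂ → ℂ}
    (h₁ : ∀ j ∈ Finset.range (p / 2 + 1), ∀ w ∈ Finset.range (p - 2 * j + 1),
      AnalyticAt ℂ (t₁ j w) s)
    (h₂ : ∀ j ∈ Finset.range (c / 2 + 1), ∀ w ∈ Finset.range (c - 2 * j + 1),
      AnalyticAt ℂ (t₂ j w) s)
    (h₃ : ∀ j ∈ Finset.range (a / 2 + 1), ∀ w ∈ Finset.range p, AnalyticAt ℂ (t₃ j w) s)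
    (h₄ : ∀ j ∈ Finset.range (a / 2 + 1), ∀ w ∈ Finset.range c, AnalyticAt ℂ (t₄ j w) s) :
    AnalyticAt ℂ (fun z => relRhs p a c (fun j w => t₁ j w z) (fun j w => t₂ j w z)
      (fun j w => t₃ j w z) (fun j w => t₄ j w z)) s := by
  have key : ∀ {S : Finset ℕ} {R : ℕ → Finset ℕ} {f : ℕ → ℂ} {g : ℕ → ℕ → ℂ}
      {t : ℕ → ℕ → ℂ → ℂ}, (∀ j ∈ S, ∀ w ∈ R j, AnalyticAt ℂ (t j w) s) →
      AnalyticAt ℂ (fun z => ∑ j ∈ S, f j * ∑ w ∈ R j, g j w * t j w z) s :=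
    fun h => Finset.analyticAt_fun_sum _ fun j hj => analyticAt_const.mul <|
      Finset.analyticAt_fun_sum _ fun w hw => analyticAt_const.mul (h j hj w hw)
  exact (((analyticAt_const.mul (key h₁)).add (analyticAt_const.mul (key h₂))).add
    (analyticAt_const.mul (key h₃))).add (analyticAt_const.mul (key h₄))

theorem meromorphicAt_relRhs {p a c : ℕ} {s : ℂ} {t₁ t₂ t₃ t₄ : ℕ → ℕ → ℂ → ℂ}
    (h₁ : ∀ j ∈ Finset.range (p / 2 + 1), ∀ w ∈ Finset.range (p - 2 * j + 1),
      MeromorphicAt (t₁ j w) s)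
    (h₂ : ∀ j ∈ Finset.range (c / 2 + 1), ∀ w ∈ Finset.range (c - 2 * j + 1),
      MeromorphicAt (t₂ j w) s)
    (h₃ : ∀ j ∈ Finset.range (a / 2 + 1), ∀ w ∈ Finset.range p, MeromorphicAt (t₃ j w) s)
    (h₄ : ∀ j ∈ Finset.range (a / 2 + 1), ∀ w ∈ Finset.range c, MeromorphicAt (t₄ j w) s) :
    MeromorphicAt (fun z => relRhs p a c (fun j w => t₁ j w z) (fun j w => t₂ j w z)
      (fun j w => t₃ j w z) (fun j w => t₄ j w z)) s := by
  have key : ∀ {S : Finset ℕ} {R : ℕ → Finset ℕ} {f : ℕ → ℂ} {g : ℕ → ℕ → ℂ}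
      {t : ℕ → ℕ → ℂ → ℂ}, (∀ j ∈ S, ∀ w ∈ R j, MeromorphicAt (t j w) s) →
      MeromorphicAt (fun z => ∑ j ∈ S, f j * ∑ w ∈ R j, g j w * t j w z) s :=
    fun h => MeromorphicAt.fun_sum fun j hj => (MeromorphicAt.const _ _).fun_mul <|
      MeromorphicAt.fun_sum fun w hw => (MeromorphicAt.const _ _).fun_mul (h j hj w hw)
  exact ((((MeromorphicAt.const _ _).fun_mul (key h₁)).fun_add
    ((MeromorphicAt.const _ _).fun_mul (key h₂))).fun_add
    ((MeromorphicAt.const _ _).fun_mul (key h₃))).fun_add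
    ((MeromorphicAt.const _ _).fun_mul (key h₄))

/-- The factor of `relTerm` that does not depend on `l`. -/
noncomputable def relCoeff (q b : ℕ) (s : ℂ) (i : TIndex) : ℂ :=
  (-1) ^ (i.1.2 : ℕ) / ((i.1.1 : ℂ) ^ q * ((i.1.2 : ℕ) : ℂ) ^ s *
    ((i.1.1 : ℂ) + (i.1.2 : ℕ)) ^ b)

theorem relCoeff_ne_zero (q b : ℕ) (s : ℂ) (i : TIndex) : relCoeff q b s i ≠ 0 := by
  have hn : ((i.1.2 : ℕ) : ℂ) ≠ 0 := by exact_mod_cast i.1.2.ne_zero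
  have hm : (i.1.1 : ℂ) ≠ 0 := by exact_mod_cast i.2.1
  have hmn : (i.1.1 : ℂ) + (i.1.2 : ℕ) ≠ 0 := by exact_mod_cast i.2.2
  have hs : ((i.1.2 : ℕ) : ℂ) ^ s ≠ 0 := by rw [Ne, cpow_eq_zero_iff]; tauto
  exact div_ne_zero (by simp) (mul_ne_zero (mul_ne_zero (pow_ne_zero _ hm) hs) (pow_ne_zero _ hmn))

theorem relExt_eq_relCoeff_mul {p q a b c : ℕ} (hp : 0 < p) (hq : 0 < q) (ha : 0 < a) (hb : 0 < b)
    (hc : 0 < c) (s : ℂ) (i : TIndex) (l : ℤ) :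
    relExt p q a b c s (l, i.1.1, ((i.1.2 : ℕ) : ℤ)) =
      relCoeff q b s i * poleTerm (-1) {0, -i.1.1, -(i.1.1 + ((i.1.2 : ℕ) : ℤ))}
        (threePoles p a c i.1.1) l := by
  obtain ⟨⟨m, n⟩, hm, hmn⟩ := i
  simp only at hm hmn ⊢
  have hn := n.pos
  by_cases h : l ∈ ({0, -m, -(m + ((n : ℕ) : ℤ))} : Finset ℤ)
  · rw [poleTerm, if_pos h, mul_zero, relExt_eq_zero hp hq ha hb hc]
    simp only [Finset.mem_insert, Finset.mem_singleton] at h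
    omega
  · have h12 : -m ≠ -(m + ((n : ℕ) : ℤ)) := by omega
    have h02 : (0 : ℤ) ≠ -(m + ((n : ℕ) : ℤ)) := fun h => hmn (by omega)
    have hnot : (0 : ℤ) ∉ ({-m, -(m + ((n : ℕ) : ℤ))} : Finset ℤ) := by
      simp only [Finset.mem_insert, Finset.mem_singleton]
      omega
    have e0 : threePoles p a c m 0 = p := if_pos rfl
    have e1 : threePoles p a c m (-m) = a := by
      rw [threePoles, if_neg (by omega), if_pos rfl]
    have e2 : threePoles p a c m (-(m + ((n : ℕ) : ℤ))) = c := by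
      rw [threePoles, if_neg h02.symm, if_neg h12.symm]
    rw [poleTerm, if_neg h, Finset.prod_insert hnot, Finset.prod_pair h12, e0, e1, e2, relExt,
      if_pos (by simp), relTerm, relCoeff, zpow_add₀ (by norm_num), zpow_natCast]
    push_cast
    simp only [div_eq_mul_inv, mul_inv, sub_zero, sub_neg_eq_add, add_assoc]
    ring

theorem relCoeff_mul_tsum_poleTerm {p q a b c : ℕ} (hp : 0 < p) (ha : 0 < a)
    (hc : 0 < c) (s : ℂ) (i : TIndex)
    (hs : Summable (poleTerm (-1) {0, -i.1.1, -(i.1.1 + ((i.1.2 : ℕ) : ℤ))}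
        (threePoles p a c i.1.1))) :
    relCoeff q b s i * ∑' l, poleTerm (-1) {0, -i.1.1, -(i.1.1 + ((i.1.2 : ℕ) : ℤ))}
        (threePoles p a c i.1.1) l =
      relRhs p a c
        (fun j w => tTerm (q + a + w) s (p + b + c - 2 * j - w) 1 (-1) i)
        (fun j w => tTerm q (s + a + w) (p + b + c - 2 * j - w) (-1) 1 i)
        (fun j w => tTerm (q + a - 2 * j + w + 1) s (p + b + c - 1 - w) (-1) (-1) i)
        (fun j w => tTerm q (s + a - 2 * j + w + 1) (p + b + c - 1 - w) (-1) (-1) i) := by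
  obtain ⟨⟨m, n⟩, hm, hmn⟩ := i
  simp only at hm hmn hs ⊢
  have hn : ((n : ℕ) : ℤ) ≠ 0 := by exact_mod_cast n.ne_zero
  have hmn' : m + ((n : ℕ) : ℤ) ≠ 0 := fun h => hmn (by omega)
  have hn0 : ((n : ℕ) : ℂ) ≠ 0 := by exact_mod_cast hn
  rw [tsum_poleTerm_three hp ha hc hm hn hmn' hs]
  refine (mul_relRhs (relCoeff q b s ⟨(m, n), hm, hmn⟩) p a c
    (fun j w => 1 / ((m : ℂ) ^ (a + w) * ((m : ℂ) + ((n : ℕ) : ℤ)) ^ (p + c - 2 * j - w)))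
    (fun j w => (-1) ^ (m + ((n : ℕ) : ℤ)) / ((((n : ℕ) : ℤ) : ℂ) ^ (a + w) *
      ((m : ℂ) + ((n : ℕ) : ℤ)) ^ (p + c - 2 * j - w)))
    (fun j w => (-1) ^ m / ((m : ℂ) ^ (a - 2 * j + w + 1) *
      ((m : ℂ) + ((n : ℕ) : ℤ)) ^ (p + c - 1 - w)))
    (fun j w => (-1) ^ m / ((((n : ℕ) : ℤ) : ℂ) ^ (a - 2 * j + w + 1) *
      ((m : ℂ) + ((n : ℕ) : ℤ)) ^ (p + c - 1 - w)))).trans ?_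
  have hsq : (-1 : ℂ) ^ (n : ℕ) * (-1) ^ (n : ℕ) = 1 := by rw [← mul_pow]; simp
  have hinv : ((-1 : ℂ) ^ (n : ℕ))⁻¹ = (-1) ^ (n : ℕ) := by rw [← inv_pow]; norm_num
  refine relRhs_congr (fun j hj w hw => ?_) (fun j hj w hw => ?_) (fun j hj w hw => ?_)
    fun j hj w hw => ?_ <;> rw [Finset.mem_range] at hj hw <;>
    simp only [relCoeff, tTerm, Int.cast_add, Int.cast_natCast]
  · rw [show p + b + c - 2 * j - w = b + (p + c - 2 * j - w) by omega, add_assoc q a w,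
      pow_add _ q, pow_add _ b, one_zpow]
    simp only [div_eq_mul_inv, mul_inv]
    ring
  · rw [show p + b + c - 2 * j - w = b + (p + c - 2 * j - w) by omega, pow_add _ b,
      show s + a + w = s + ((a + w : ℕ) : ℂ) by push_cast; ring, cpow_add _ _ hn0, cpow_natCast,
      zpow_add₀ (by norm_num), zpow_natCast, one_pow]
    simp only [div_eq_mul_inv, mul_inv]
    linear_combination ((-1) ^ m * ((m : ℂ) ^ q)⁻¹ * (((n : ℕ) : ℂ) ^ s)⁻¹ *
      (((m : ℂ) + (n : ℕ)) ^ b)⁻¹ * (((n : ℕ) : ℂ) ^ (a + w))⁻¹ *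
      (((m : ℂ) + (n : ℕ)) ^ (p + c - 2 * j - w))⁻¹) * hsq
  · rw [show p + b + c - 1 - w = b + (p + c - 1 - w) by omega,
      show q + a - 2 * j + w + 1 = q + (a - 2 * j + w + 1) by omega,
      pow_add _ q, pow_add _ b]
    simp only [div_eq_mul_inv, mul_inv]
    ring
  · rw [show p + b + c - 1 - w = b + (p + c - 1 - w) by omega, pow_add _ b,
      show s + a - 2 * j + w + 1 = s + ((a - 2 * j + w + 1 : ℕ) : ℂ) by
        push_cast [Nat.cast_sub (show 2 * j ≤ a by omega)]; ring, cpow_add _ _ hn0, cpow_natCast]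
    simp only [div_eq_mul_inv, mul_inv]
    ring

theorem functional_relation_of_one_lt_re {p q a b c : ℕ} (hp : 0 < p) (hq : 0 < q) (ha : 0 < a)
    (hb : 0 < b) (hc : 0 < c) {s : ℂ} (hs : 1 < s.re) :
    ∑ i, (-1) ^ signs p q a b c i * ∑' x, zetaTerm (exponents p q a b c i s) x =
      relRhs p a c
        (fun j w => ∑' i, tTerm (q + a + w) s (p + b + c - 2 * j - w) 1 (-1) i)
        (fun j w => ∑' i, tTerm q (s + a + w) (p + b + c - 2 * j - w) (-1) 1 i)
        (fun j w => ∑' i, tTerm (q + a - 2 * j + w + 1) s (p + b + c - 1 - w) (-1) (-1) i)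
        (fun j w => ∑' i, tTerm q (s + a - 2 * j + w + 1) (p + b + c - 1 - w) (-1) (-1) i) := by
  let G : TIndex × ℤ → ℤ × ℤ × ℤ := fun x => (x.2, x.1.1.1, ((x.1.1.2 : ℕ) : ℤ))
  have hG : Function.Injective G := by
    rintro ⟨⟨⟨m, n⟩, h⟩, l⟩ ⟨⟨⟨m', n'⟩, h'⟩, l'⟩ hh
    simp only [G, Prod.mk.injEq, Nat.cast_inj, PNat.coe_inj] at hh
    simp only [Prod.mk.injEq, Subtype.mk.injEq]
    tauto
  have hsum : HasSum (relExt p q a b c s ∘ G)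
      (∑ i, (-1) ^ signs p q a b c i * ∑' x, zetaTerm (exponents p q a b c i s) x) := by
    refine (hG.hasSum_iff ?_).mpr (hasSum_relExt hp hq ha hb hc hs)
    rintro ⟨l, m, n⟩ hy
    refine relExt_eq_zero hp hq ha hb hc s fun ⟨hn, _, h2, _, h5, _⟩ => hy ?_
    obtain ⟨n, rfl⟩ := Int.eq_ofNat_of_zero_le hn.le
    exact ⟨(⟨(m, ⟨n, by omega⟩), h2, by simpa using h5⟩, l), rfl⟩
  have hterm : ∀ i l, (relExt p q a b c s ∘ G) (i, l) = relCoeff q b s i *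
      poleTerm (-1) {0, -i.1.1, -(i.1.1 + ((i.1.2 : ℕ) : ℤ))} (threePoles p a c i.1.1) l :=
    fun i l => relExt_eq_relCoeff_mul hp hq ha hb hc s i l
  rw [← hsum.tsum_eq, hsum.summable.tsum_prod]
  have hin : ∀ i : TIndex, ∑' l, (relExt p q a b c s ∘ G) (i, l) = relRhs p a c
        (fun j w => tTerm (q + a + w) s (p + b + c - 2 * j - w) 1 (-1) i)
        (fun j w => tTerm q (s + a + w) (p + b + c - 2 * j - w) (-1) 1 i)
        (fun j w => tTerm (q + a - 2 * j + w + 1) s (p + b + c - 1 - w) (-1) (-1) i)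
        (fun j w => tTerm q (s + a - 2 * j + w + 1) (p + b + c - 1 - w) (-1) (-1) i) := by
    intro i
    have hfib := hsum.summable.prod_factor i
    simp only [hterm] at hfib ⊢
    rw [tsum_mul_left]
    exact relCoeff_mul_tsum_poleTerm hp ha hc s i
      ((summable_mul_left_iff (relCoeff_ne_zero q b s i)).mp hfib)
  rw [tsum_congr hin]
  have hre : ∀ k : ℕ, 1 < (s + k).re := fun k => by
    have : (0 : ℝ) ≤ k := Nat.cast_nonneg k
    simp only [add_re, natCast_re]
    linarith
  refine (hasSum_relRhs (fun j hj w hw => ?_) (fun j hj w hw => ?_) (fun j hj w hw => ?_)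
    fun j hj w hw => ?_).tsum_eq <;> rw [Finset.mem_range] at hj hw
  · exact (summable_tTerm (by omega) (by omega) (Or.inl rfl) (Or.inr rfl) hs).hasSum
  · refine (summable_tTerm (by omega) (by omega) (Or.inr rfl) (Or.inl rfl) ?_).hasSum
    have := hre (a + w)
    push_cast at this
    rwa [← add_assoc] at this
  · exact (summable_tTerm (by omega) (by omega) (Or.inr rfl) (Or.inr rfl) hs).hasSum
  · refine (summable_tTerm (by omega) (by omega) (Or.inr rfl) (Or.inr rfl) ?_).hasSum
    have := hre (a - 2 * j + w + 1)
    push_cast [Nat.cast_sub (show 2 * j ≤ a by omega)] at this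
    rwa [show s + a - 2 * j + w + 1 = s + (a - 2 * j + w + 1) by ring]

theorem functional_relation {p q a b c : ℕ} (hp : 0 < p) (hq : 0 < q) (ha : 0 < a)
    (hb : 0 < b) (hc : 0 < c) {s : ℂ}
    (h0 : ∀ i : Fin 12, AnalyticAt ℂ (zeta (exponents p q a b c i)) s)
    (h₁ : ∀ j ∈ Finset.range (p / 2 + 1), ∀ w ∈ Finset.range (p - 2 * j + 1),
      AnalyticAt ℂ (fun z => T (q + a + w) z (p + b + c - 2 * j - w) 1 (-1)) s)
    (h₂ : ∀ j ∈ Finset.range (c / 2 + 1), ∀ w ∈ Finset.range (c - 2 * j + 1),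
      AnalyticAt ℂ (fun z => T q (z + a + w) (p + b + c - 2 * j - w) (-1) 1) s)
    (h₃ : ∀ j ∈ Finset.range (a / 2 + 1), ∀ w ∈ Finset.range p,
      AnalyticAt ℂ (fun z => T (q + a - 2 * j + w + 1) z (p + b + c - 1 - w) (-1) (-1)) s)
    (h₄ : ∀ j ∈ Finset.range (a / 2 + 1), ∀ w ∈ Finset.range c,
      AnalyticAt ℂ (fun z => T q (z + a - 2 * j + w + 1) (p + b + c - 1 - w) (-1) (-1)) s) :
    ∑ i, (-1) ^ signs p q a b c i * zeta (exponents p q a b c i) s =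
      relRhs p a c
        (fun j w => T (q + a + w) s (p + b + c - 2 * j - w) 1 (-1))
        (fun j w => T q (s + a + w) (p + b + c - 2 * j - w) (-1) 1)
        (fun j w => T (q + a - 2 * j + w + 1) s (p + b + c - 1 - w) (-1) (-1))
        (fun j w => T q (s + a - 2 * j + w + 1) (p + b + c - 1 - w) (-1) (-1)) := by
  have hT : ∀ {P Q : ℕ} {x y : ℂ}, 0 < P → 0 < Q → (x = 1 ∨ x = -1) → (y = 1 ∨ y = -1) →
      IsMeroContinuation (fun s => ∑' i, tTerm P s Q x y i) (fun s => T P s Q x y) :=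
    fun hP hQ hx hy => (isMeroContinuation_T hP hQ hx hy).1
  have hmero : ∀ {f F : ℂ → ℂ}, IsMeroContinuation f F → ∀ z, MeromorphicAt F z :=
    fun h z => (h.meromorphic (mem_univ z)).meromorphicAt
  refine eq_of_analyticAt_of_eq_halfPlane (B := 1)
    (F := fun s => ∑ i, (-1) ^ signs p q a b c i * zeta (exponents p q a b c i) s)
    (G := fun s => relRhs p a c
        (fun j w => T (q + a + w) s (p + b + c - 2 * j - w) 1 (-1))
        (fun j w => T q (s + a + w) (p + b + c - 2 * j - w) (-1) 1)
        (fun j w => T (q + a - 2 * j + w + 1) s (p + b + c - 1 - w) (-1) (-1))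
        (fun j w => T q (s + a - 2 * j + w + 1) (p + b + c - 1 - w) (-1) (-1)))
    (fun z => ?_) (fun z => ?_) (fun z hz => ?_) ?_ ?_
  · exact MeromorphicAt.fun_sum fun i _ => (MeromorphicAt.const _ _).fun_mul
      (hmero (isMeroContinuation_zeta hp hq ha hb hc i) z)
  · refine meromorphicAt_relRhs
      (t₁ := fun j w s => T (q + a + w) s (p + b + c - 2 * j - w) 1 (-1))
      (t₂ := fun j w s => T q (s + a + w) (p + b + c - 2 * j - w) (-1) 1)
      (t₃ := fun j w s => T (q + a - 2 * j + w + 1) s (p + b + c - 1 - w) (-1) (-1))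
      (t₄ := fun j w s => T q (s + a - 2 * j + w + 1) (p + b + c - 1 - w) (-1) (-1))
      (fun j hj w hw => ?_) (fun j hj w hw => ?_) (fun j hj w hw => ?_)
      fun j hj w hw => ?_ <;> rw [Finset.mem_range] at hj hw
    · exact hmero (hT (by omega) (by omega) (Or.inl rfl) (Or.inr rfl)) z
    · have := meromorphicAt_comp_add_const ((a : ℂ) + w) (s := z)
        (hmero (hT (P := q) (Q := p + b + c - 2 * j - w) hq (by omega) (Or.inr rfl) (Or.inl rfl)) _)
      simpa only [add_assoc] using this
    · exact hmero (hT (by omega) (by omega) (Or.inr rfl) (Or.inr rfl)) z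
    · have := meromorphicAt_comp_add_const ((a : ℂ) - 2 * j + w + 1) (s := z)
        (hmero (hT (P := q) (Q := p + b + c - 1 - w) hq (by omega) (Or.inr rfl) (Or.inr rfl)) _)
      simpa only [sub_eq_add_neg, add_assoc] using this
  · have hre : ∀ k : ℕ, 1 < (z + k).re := fun k => by
      have : (0 : ℝ) ≤ k := Nat.cast_nonneg k
      simp only [add_re, natCast_re]
      linarith
    rw [Finset.sum_congr rfl fun i _ => by
      rw [(isMeroContinuation_zeta hp hq ha hb hc i).eq_of_one_lt_re z hz],
      functional_relation_of_one_lt_re hp hq ha hb hc hz]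
    refine relRhs_congr (fun j hj w hw => ?_) (fun j hj w hw => ?_) (fun j hj w hw => ?_)
      fun j hj w hw => ?_ <;> rw [Finset.mem_range] at hj hw
    · exact ((hT (by omega) (by omega) (Or.inl rfl) (Or.inr rfl)).eq_of_one_lt_re z hz).symm
    · refine ((hT (by omega) (by omega) (Or.inr rfl) (Or.inl rfl)).eq_of_one_lt_re _ ?_).symm
      have := hre (a + w)
      push_cast at this
      rwa [← add_assoc] at this
    · exact ((hT (by omega) (by omega) (Or.inr rfl) (Or.inr rfl)).eq_of_one_lt_re z hz).symm
    · refine ((hT (by omega) (by omega) (Or.inr rfl) (Or.inr rfl)).eq_of_one_lt_re _ ?_).symm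
      have := hre (a - 2 * j + w + 1)
      push_cast [Nat.cast_sub (show 2 * j ≤ a by omega)] at this
      rwa [show z + a - 2 * j + w + 1 = z + (a - 2 * j + w + 1) by ring]
  · exact Finset.analyticAt_fun_sum _ fun i _ => analyticAt_const.mul (h0 i)
  · exact analyticAt_relRhs
      (t₁ := fun j w s => T (q + a + w) s (p + b + c - 2 * j - w) 1 (-1))
      (t₂ := fun j w s => T q (s + a + w) (p + b + c - 2 * j - w) (-1) 1)
      (t₃ := fun j w s => T (q + a - 2 * j + w + 1) s (p + b + c - 1 - w) (-1) (-1))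
      (t₄ := fun j w s => T q (s + a - 2 * j + w + 1) (p + b + c - 1 - w) (-1) (-1)) h₁ h₂ h₃ h₄

end SU4Zeta

theorem mainTheorem2 :
    -- the functions `𝔗(P, ·, Q; x, y)`, their continuation and their expression by `ζ`
    (∀ P Q : ℕ, 0 < P → 0 < Q →
      (∀ x y : ℂ, (x = 1 ∨ x = -1) → (y = 1 ∨ y = -1) →
        (∀ s : ℂ, 1 < s.re → Summable (SU4Zeta.tTerm P s Q x y)) ∧
        SU4Zeta.IsMeroContinuation (fun s => ∑' i, SU4Zeta.tTerm P s Q x y i)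
          (fun s => SU4Zeta.T P s Q x y)) ∧
      (∀ s : ℂ,
        SU4Zeta.T P s Q 1 (-1) =
          2 * (-1) ^ P * ∑ k ∈ Finset.range (P / 2 + 1),
            riemannZeta (2 * k) * ((P + Q - 1 - 2 * k).choose (Q - 1) : ℂ) *
              SU4Zeta.phi (s + P + Q - 2 * k) +
          2 * (-1) ^ P * ∑ k ∈ Finset.range (Q / 2 + 1),
            riemannZeta (2 * k) * ((P + Q - 1 - 2 * k).choose (P - 1) : ℂ) *
              SU4Zeta.phi (s + P + Q - 2 * k)) ∧
      (∀ s : ℂ, (∀ k ∈ Finset.range (P / 2 + 1), s + P + Q - 2 * k ≠ 1) →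
        SU4Zeta.T P s Q (-1) 1 =
          2 * (-1) ^ P * ∑ k ∈ Finset.range (P / 2 + 1),
            SU4Zeta.phi (2 * k) * ((P + Q - 1 - 2 * k).choose (Q - 1) : ℂ) *
              riemannZeta (s + P + Q - 2 * k) +
          2 * (-1) ^ P * ∑ k ∈ Finset.range (Q / 2 + 1),
            SU4Zeta.phi (2 * k) * ((P + Q - 1 - 2 * k).choose (P - 1) : ℂ) *
              SU4Zeta.phi (s + P + Q - 2 * k)) ∧
      (∀ s : ℂ, (∀ k ∈ Finset.range (Q / 2 + 1), s + P + Q - 2 * k ≠ 1) →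
        SU4Zeta.T P s Q (-1) (-1) =
          2 * (-1) ^ P * ∑ k ∈ Finset.range (P / 2 + 1),
            SU4Zeta.phi (2 * k) * ((P + Q - 1 - 2 * k).choose (Q - 1) : ℂ) *
              SU4Zeta.phi (s + P + Q - 2 * k) +
          2 * (-1) ^ P * ∑ k ∈ Finset.range (Q / 2 + 1),
            SU4Zeta.phi (2 * k) * ((P + Q - 1 - 2 * k).choose (P - 1) : ℂ) *
              riemannZeta (s + P + Q - 2 * k))) ∧
    ∀ p q a b c : ℕ, 0 < p → 0 < q → 0 < a → 0 < b → 0 < c →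
      -- absolute convergence and continuation of the twelve zeta-functions
      (∀ i : Fin 12,
        (∀ s : ℂ, 1 < s.re →
          Summable (SU4Zeta.zetaTerm (SU4Zeta.exponents p q a b c i s))) ∧
        SU4Zeta.IsMeroContinuation
          (fun s => ∑' x, SU4Zeta.zetaTerm (SU4Zeta.exponents p q a b c i s) x)
          (SU4Zeta.zeta (SU4Zeta.exponents p q a b c i))) ∧
      -- the functional relation at every `s` that is not a singularity of either side
      (∀ s : ℂ,
        (∀ i : Fin 12, AnalyticAt ℂ (SU4Zeta.zeta (SU4Zeta.exponents p q a b c i)) s) →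
        (∀ j ∈ Finset.range (p / 2 + 1), ∀ w ∈ Finset.range (p - 2 * j + 1),
          AnalyticAt ℂ
            (fun z => SU4Zeta.T (q + a + w) z (p + b + c - 2 * j - w) 1 (-1)) s) →
        (∀ j ∈ Finset.range (c / 2 + 1), ∀ w ∈ Finset.range (c - 2 * j + 1),
          AnalyticAt ℂ
            (fun z => SU4Zeta.T q (z + a + w) (p + b + c - 2 * j - w) (-1) 1) s) →
        (∀ j ∈ Finset.range (a / 2 + 1), ∀ w ∈ Finset.range p,
          AnalyticAt ℂ
            (fun z => SU4Zeta.T (q + a - 2 * j + w + 1) z (p + b + c - 1 - w) (-1) (-1)) s) →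
        (∀ j ∈ Finset.range (a / 2 + 1), ∀ w ∈ Finset.range c,
          AnalyticAt ℂ
            (fun z => SU4Zeta.T q (z + a - 2 * j + w + 1) (p + b + c - 1 - w) (-1) (-1)) s) →
        ∑ i : Fin 12, (-1) ^ SU4Zeta.signs p q a b c i *
            SU4Zeta.zeta (SU4Zeta.exponents p q a b c i) s =
          2 * (-1) ^ p * ∑ j ∈ Finset.range (p / 2 + 1), SU4Zeta.phi (2 * j) *
            ∑ w ∈ Finset.range (p - 2 * j + 1),
              ((w + a - 1).choose w : ℂ) * ((p + c - 2 * j - w - 1).choose (c - 1) : ℂ) *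
                SU4Zeta.T (q + a + w) s (p + b + c - 2 * j - w) 1 (-1) +
          2 * (-1) ^ (p + a) * ∑ j ∈ Finset.range (c / 2 + 1), SU4Zeta.phi (2 * j) *
            ∑ w ∈ Finset.range (c - 2 * j + 1),
              ((w + a - 1).choose w : ℂ) * ((p + c - 2 * j - w - 1).choose (p - 1) : ℂ) *
                SU4Zeta.T q (s + a + w) (p + b + c - 2 * j - w) (-1) 1 +
          2 * (-1) ^ p * ∑ j ∈ Finset.range (a / 2 + 1), SU4Zeta.phi (2 * j) *
            ∑ w ∈ Finset.range p,
              ((w + a - 2 * j).choose w : ℂ) * ((p + c - 2 - w).choose (c - 1) : ℂ) *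
                SU4Zeta.T (q + a - 2 * j + w + 1) s (p + b + c - 1 - w) (-1) (-1) +
          2 * (-1) ^ (p + a) * ∑ j ∈ Finset.range (a / 2 + 1), SU4Zeta.phi (2 * j) *
            ∑ w ∈ Finset.range c,
              ((w + a - 2 * j).choose w : ℂ) * ((p + c - 2 - w).choose (p - 1) : ℂ) *
                SU4Zeta.T q (s + a - 2 * j + w + 1) (p + b + c - 1 - w) (-1) (-1)) := by
  refine ⟨fun P Q hP hQ => ⟨fun x y hx hy => ⟨fun s hs => SU4Zeta.summable_tTerm hP hQ hx hy hs,
    (SU4Zeta.isMeroContinuation_T hP hQ hx hy).1⟩, fun s => SU4Zeta.T_one_neg_one hP hQ s,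
    fun s hs => SU4Zeta.T_neg_one_one hP hQ hs, fun s hs => SU4Zeta.T_neg_one_neg_one hP hQ hs⟩,
    fun p q a b c hp hq ha hb hc => ⟨fun i => ⟨fun s hs =>
      SU4Zeta.summable_zetaTerm_exponents hp hq ha hb hc i hs,
      SU4Zeta.isMeroContinuation_zeta hp hq ha hb hc i⟩, fun s h₀ h₁ h₂ h₃ h₄ => ?_⟩⟩
  exact SU4Zeta.functional_relation hp hq ha hb hc h₀ h₁ h₂ h₃ h₄
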